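/- Let $K$ be an algebraically closed field of characteristic $0$, and let $N\ge 1$ and $d\ge 2$. A degree $d$ endomorphism $f$ of $\mathbb P^N$ over $K$ is given by $N+1$ homogeneous polynomials of degree $d$ in $x_1,\dots,x_{N+1}$ without a common zero; let $\mathcal M_d^N$ be the set of such endomorphisms modulo conjugation $f\mapsto \alpha^{-1}\circ f\circ\alpha$, $\alpha\in \mathrm{PGL}_{N+1}(K)$. Such an $f$ has $D=1+d+\dots+d^N$ fixed points counted with multiplicity. For a fixed point $P$ let $\gamma_{f,P}(t)$ be the characteristic polynomial of the differential $df_P$ (a Jacobian matrix of $f$ at $P$ in an affine chart). Define $\sigma_{i,j}(f)\in K$, for $0\le i\le D$ and $0\le j\le Ni$, by $$\prod_{P}\bigl(w-\gamma_{f,P}(t)\bigr)=\sum_{i=0}^{D}\sum_{j=0}^{Ni}(-1)^{i+j}\sigma_{i,j}(f)\,w^{D-i}t^{Ni-j},$$ where the product runs over the fixed points of $f$, counted with multiplicity (the dimension of the local ring of the fixed-point scheme at $P$). These numbers depend only on the class of $f$; let $\tau_{d,1}^N([f])=(\sigma_{i,j}(f))_{i,j}$ be the fixed-point multiplier map from $\mathcal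 M_d^N$ to affine space. Let $\mathcal S\subset\mathcal M_d^N$ be the set of classes of split polynomial endomorphisms of degree $d$, i.e. of homogenizations of maps $(F_1(x_1),\dots,F_N(x_N)):\mathbb A^N\to\mathbb A^N$ with polynomials $F_1,\dots,F_N\in K[x]$ all of degree $d$. Theorem. The restriction of $\tau_{d,1}^N$ to $\mathcal S$ is generically $((d-2)!)^N$-to-one: there is a Zariski-open subset $U$ of the target affine space such that $U\cap\tau_{d,1}^N(\mathcal S)$ is Zariski dense in $\tau_{d,1}^N(\mathcal S)$, and for every $y\in U\cap\tau_{d,1}^N(\mathcal S)$ there are exactly $((d-2)!)^N$ classes $c\in\mathcal S$ with $\tau_{d,1}^N(c)=y$. -/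

import Mathlib

open MvPolynomial
open scoped LinearAlgebra.Projectivization

noncomputable section

namespace ProjDyn

variable {K : Type*} [Field K] {N d : ℕ}

/-- A degree `d` endomorphism of `ℙ^N`, given by an `(N+1)`-tuple of homogeneous polynomials of
degree `d` with no common zero. (Proportional tuples are identified in `Moduli` below.) -/
structure ProjEnd (K : Type*) [Field K] (N d : ℕ) where
  /-- the coordinate polynomials -/
  poly : Fin (N + 1) → MvPolynomial (Fin (N + 1)) K
  homogeneous : ∀ i, (poly i).IsHomogeneous d
  noCommonZero : ∀ x : Fin (N + 1) → K, (∀ i, eval x (poly i) = 0) → x = 0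

namespace ProjEnd

/-- The map induced on affine cones. -/
def lift (f : ProjEnd K N d) (x : Fin (N + 1) → K) : Fin (N + 1) → K :=
  fun i => eval x (f.poly i)

theorem lift_ne_zero (f : ProjEnd K N d) {x : Fin (N + 1) → K} (hx : x ≠ 0) : f.lift x ≠ 0 :=
  fun h => hx (f.noCommonZero x fun i => congrFun h i)

/-- The self-map of `ℙ^N`. -/
def onProj (f : ProjEnd K N d) (P : ℙ K (Fin (N + 1) → K)) : ℙ K (Fin (N + 1) → K) :=
  Projectivization.mk K (f.lift P.rep) (f.lift_ne_zero P.rep_nonzero)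

/-- `g = α⁻¹ ∘ f ∘ α` as self-maps of `ℙ^N`, for some linear automorphism `α` of `ℙ^N`. Lifts of a
self-map of `ℙ^N` to the affine cone are unique up to a nonzero scalar `c`. -/
def IsConj (f g : ProjEnd K N d) : Prop :=
  ∃ (α : (Fin (N + 1) → K) ≃ₗ[K] (Fin (N + 1) → K)) (c : Kˣ),
    ∀ x, g.lift x = c • α.symm (f.lift (α x))

theorem isConj_equivalence : Equivalence (IsConj (K := K) (N := N) (d := d)) where
  refl f := ⟨LinearEquiv.refl K _, 1, fun x => by simp⟩
  symm := by
    rintro f g ⟨α, c, h⟩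
    refine ⟨α.symm, c⁻¹, fun x => ?_⟩
    rw [h]
    simp [Units.smul_def, smul_smul]
  trans := by
    rintro f g k ⟨α, c, h⟩ ⟨β, e, h'⟩
    refine ⟨β.trans α, e * c, fun x => ?_⟩
    rw [h', h]
    simp [Units.smul_def, smul_smul]

instance conjSetoid (K : Type*) [Field K] (N d : ℕ) : Setoid (ProjEnd K N d) :=
  ⟨IsConj, isConj_equivalence⟩

end ProjEnd

/-- The (points of the) moduli space `M_d^N` of degree `d` endomorphisms of `ℙ^N`, modulo
conjugation by `PGL_{N+1}`. -/
def Moduli (K : Type*) [Field K] (N d : ℕ) : Type _ := Quotient (ProjEnd.conjSetoid K N d)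

/-- The conjugacy class of an endomorphism. -/
def ProjEnd.toModuli (f : ProjEnd K N d) : Moduli K N d := Quotient.mk _ f

open Classical in
/-- The chart used at `P`: the index of the last nonvanishing homogeneous coordinate. -/
def chart (P : ℙ K (Fin (N + 1) → K)) : Fin (N + 1) :=
  (Finset.univ.filter fun i => P.rep i ≠ 0).max'
    (by
      obtain ⟨i, hi⟩ := Function.ne_iff.mp P.rep_nonzero
      exact ⟨i, by simpa using hi⟩)

/-- The homogeneous coordinates of `P`, normalised so that the coordinate `chart P` is `1`. -/
def coords (P : ℙ K (Fin (N + 1) → K)) : Fin (N + 1) → K :=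
  (P.rep (chart P))⁻¹ • P.rep

namespace ProjEnd

/-- The multiplier matrix of `f` at a fixed point `P`: the Jacobian matrix at `P` of the
dehomogenisation `z_v ↦ f_v / f_b` (`v ≠ b`) of `f` in the affine chart `x_b = 1`, `b = chart P`. -/
def multiplierMatrix (f : ProjEnd K N d) (P : ℙ K (Fin (N + 1) → K)) :
    Matrix {v // v ≠ chart P} {v // v ≠ chart P} K :=
  fun v w =>
    (eval (coords P) (pderiv (w : Fin (N + 1)) (f.poly v)) * eval (coords P) (f.poly (chart P)) -
        eval (coords P) (pderiv (w : Fin (N + 1)) (f.poly (chart P))) *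
          eval (coords P) (f.poly v)) /
      eval (coords P) (f.poly (chart P)) ^ 2

/-- The multiplier polynomial `γ_{f,P}`. -/
def multiplierPoly (f : ProjEnd K N d) (P : ℙ K (Fin (N + 1) → K)) : Polynomial K :=
  (f.multiplierMatrix P).charpoly

end ProjEnd

/-- Dehomogenisation at `x_b = 1`. -/
def dehom (b : Fin (N + 1)) :
    MvPolynomial (Fin (N + 1)) K →ₐ[K] MvPolynomial {v : Fin (N + 1) // v ≠ b} K :=
  aeval fun v => if h : v = b then 1 else X ⟨v, h⟩

/-- The ideal of the point `P` in the coordinate ring of its affine chart. -/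
def pointIdeal (P : ℙ K (Fin (N + 1) → K)) : Ideal (MvPolynomial {v // v ≠ chart P} K) :=
  RingHom.ker (eval fun v : {v // v ≠ chart P} => coords P v)

instance pointIdeal_isPrime (P : ℙ K (Fin (N + 1) → K)) : (pointIdeal P).IsPrime :=
  RingHom.ker_isPrime _

namespace ProjEnd

/-- The ideal of the fixed-point scheme `z_v = f_v / f_b` (`v ≠ b`) in the affine chart `x_b = 1`
(up to the unit `f_b` at the fixed points). -/
def fixedIdeal (f : ProjEnd K N d) (b : Fin (N + 1)) :
    Ideal (MvPolynomial {v : Fin (N + 1) // v ≠ b} K) :=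
  Ideal.span (Set.range fun v : {v : Fin (N + 1) // v ≠ b} =>
    dehom b (f.poly v) - X v * dehom b (f.poly b))

/-- The multiplicity of a fixed point `P`: the dimension of the local ring at `P` of the
fixed-point scheme. -/
def fixedMult (f : ProjEnd K N d) (P : ℙ K (Fin (N + 1) → K)) : ℕ :=
  Module.finrank K (Localization.AtPrime (pointIdeal P) ⧸
    (f.fixedIdeal (chart P)).map (algebraMap _ (Localization.AtPrime (pointIdeal P))))

/-- `Σ₁(f) = ∏_P (w - γ_{f,P}(t))`, the product over the fixed points with multiplicity, as a
polynomial in `w` with coefficients in `K[t]`. -/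
def sigmaPoly (f : ProjEnd K N d) : Polynomial (Polynomial K) :=
  ∏ᶠ P ∈ Function.fixedPoints f.onProj,
    (Polynomial.X - Polynomial.C (f.multiplierPoly P)) ^ f.fixedMult P

end ProjEnd

/-- `D₁ = 1 + d + ⋯ + d^N`, the number of fixed points counted with multiplicity. -/
def numFixed (N d : ℕ) : ℕ := ∑ k ∈ Finset.range (N + 1), d ^ k

/-- The index set `{(i, j) : 0 ≤ i ≤ D₁, 0 ≤ j ≤ N i}` of the multiplier invariants. -/
abbrev SigmaIndex (N d : ℕ) : Type := (i : Fin (numFixed N d + 1)) × Fin (N * i + 1)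

namespace ProjEnd

/-- The fixed-point multiplier map `f ↦ (σ_{i,j}^{(1)}(f))`, where
`Σ₁(f) = ∑_{i,j} (-1)^{i+j} σ_{i,j}^{(1)} w^{D₁-i} t^{N i - j}`. -/
def tau (f : ProjEnd K N d) : SigmaIndex N d → K :=
  fun s => (-1) ^ ((s.1 : ℕ) + (s.2 : ℕ)) *
    (f.sigmaPoly.coeff (numFixed N d - s.1)).coeff (N * s.1 - s.2)

/-- `f` is the homogenisation (with last coordinate homogenising) of a split polynomial
endomorphism `(F_1(x_1), …, F_N(x_N))` of `𝔸^N` with all `F_i` of degree `d`. -/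
def IsSplit (f : ProjEnd K N d) : Prop :=
  ∃ F : Fin N → Polynomial K, (∀ i, (F i).natDegree = d) ∧
    (∀ i : Fin N, f.poly i.castSucc =
      ∑ k ∈ Finset.range (d + 1), C ((F i).coeff k) * X i.castSucc ^ k * X (Fin.last N) ^ (d - k)) ∧
    f.poly (Fin.last N) = X (Fin.last N) ^ d

end ProjEnd

/-- The fibre over `y` of the fixed-point multiplier map restricted to the classes of split
polynomial endomorphisms, as a subset of the moduli space. -/
def splitFibre {N d : ℕ} (y : SigmaIndex N d → K) : Set (Moduli K N d) :=
  {c | ∃ g : ProjEnd K N d, g.IsSplit ∧ g.toModuli = c ∧ g.tau = y}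

/-- The image of the fixed-point multiplier map restricted to split polynomial endomorphisms. -/
def splitImage (K : Type*) [Field K] (N d : ℕ) : Set (SigmaIndex N d → K) :=
  {y | ∃ g : ProjEnd K N d, g.IsSplit ∧ g.tau = y}

end ProjDyn

end

/-! Write each component of a split map as `F_i = X + a_i ∏_j (X - ρ_ij)`. The affine fixed points
are the tuples of fixed points of the components, and their multiplier polynomials are the products
of `t - λ_{i,s(i)}` with `λ_ij = F_i'(ρ_ij) = 1 + a_i ∏_{k≠j} (ρ_ij - ρ_ik)`. The fixed points at
infinity contribute a factor depending only on `N` and `d` (`ProjEnd.IsSplitBy.sigmaPoly_eq`). When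
the `λ_ij` are pairwise distinct, the invariants therefore determine the matrix `λ` up to permuting
rows and permuting entries within rows (`exists_perm_of_affSigma_eq`).

It remains to count conjugacy classes with given `λ`. Put `m_j = (λ_j - 1)⁻¹` in one row. By
Lagrange interpolation the fixed points satisfy `∑ m_j ρ_j^k = 0` for `k ≤ d - 2`, and conversely
distinct points satisfying these equations arise from a polynomial with those multipliers. An affine
change of variable moves two of the points to `1` and `0`; with `n = d - 2`, there remain `n`
equations of degrees `1, …, n` in `n` unknowns. If no sum of `m_j` over a nonempty proper subset
vanishes, there are exactly `n!` solutions (`natCard_solutions`). The proof of this count is a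
deformation: over the space of admissible weights the solutions form a finite étale cover, so the
count is constant, and for equal weights the solutions are the orderings of the nontrivial
`(n+1)`-st roots of unity.

The rows are independent, which gives `(n!)^N` normalised maps. They are pairwise nonconjugate: a
conjugation of split maps with nonzero multipliers preserves infinity and acts on each component by
an affine map (`exists_affine_of_isConj`). Distinct multipliers force it to match rows and labels,
so it fixes `0` and `1`.

The genericity condition `IsGood` is symmetric in all the `λ_ij`, hence is the nonvanishing of a
polynomial in the invariants (`exists_eval_ne_zero_iff_isGood`); it holds somewhere
(`exists_isGood`), and irreducibility of the parameter space gives density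
(`vanishingIdeal_splitImage_diff`). -/

noncomputable section

namespace ProjDyn

/-! ### Weighted power sums and points of algebras of finite type -/

/-- If all subset sums of the weights are nonzero, then a nonzero solution of the homogeneous
system of weighted power sums has pairwise distinct nonzero entries. -/
theorem injective_of_weighted_power_sums {k : Type*} [Field k] {n : ℕ} {w y : Fin (n + 1) → k}
    (hw : ∀ S : Finset (Fin (n + 1)), S.Nonempty → ∑ i ∈ S, w i ≠ 0)
    (h : ∀ j < n, ∑ i, w i * y i ^ (j + 1) = 0) (h0 : ∃ i, y i ≠ 0) :
    Function.Injective y ∧ ∀ i, y i ≠ 0 := by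
  classical
  have L : ∀ p : Polynomial k, p.natDegree < n → ∑ i, w i * (y i * p.eval (y i)) = 0 := by
    intro p hp
    have : ∀ i, w i * (y i * p.eval (y i)) =
        ∑ j ∈ Finset.range n, p.coeff j * (w i * y i ^ (j + 1)) := by
      intro i
      rw [Polynomial.eval_eq_sum_range' hp, Finset.mul_sum, Finset.mul_sum]
      exact Finset.sum_congr rfl fun j _ => by ring
    simp_rw [this]
    rw [Finset.sum_comm]
    refine Finset.sum_eq_zero fun j hj => ?_
    rw [← Finset.mul_sum, h j (Finset.mem_range.mp hj), mul_zero]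
  set V := (Finset.univ.image y).erase 0 with hV
  obtain ⟨i0, hi0⟩ := h0
  have hvV : y i0 ∈ V := by simp [hV, hi0]
  have hle : (Finset.univ.image y).card ≤ n + 1 := by
    simpa using (Finset.card_image_le (s := Finset.univ) (f := y))
  have hVle : V.card ≤ (Finset.univ.image y).card := Finset.card_erase_le
  have hcard : n + 1 ≤ V.card := by
    by_contra hlt
    have hpos : 0 < V.card := Finset.card_pos.mpr ⟨_, hvV⟩
    -- `z * p(z)` vanishes at every value of `y` except `y i0`, so summing it against `w` isolates
    -- the total weight of the fibre of `y i0`. With at most `n` nonzero values, `p` has degree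
    -- below `n` and the equations apply.
    set p : Polynomial k := ∏ u ∈ V.erase (y i0), (Polynomial.X - Polynomial.C u) with hp
    have hdeg : p.natDegree < n := by
      rw [hp, Polynomial.natDegree_prod_of_monic _ _ fun u _ => Polynomial.monic_X_sub_C u]
      simp only [Polynomial.natDegree_X_sub_C, Finset.sum_const, smul_eq_mul, mul_one]
      rw [Finset.card_erase_of_mem hvV]
      omega
    have hL := L p hdeg
    have hterm : ∀ i, w i * (y i * p.eval (y i)) =
        if y i = y i0 then w i * (y i0 * p.eval (y i0)) else 0 := by
      intro i
      split_ifs with hi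
      · rw [hi]
      · by_cases hz : y i = 0
        · simp [hz]
        · have : p.eval (y i) = 0 := by
            rw [hp, Polynomial.eval_prod]
            refine Finset.prod_eq_zero (i := y i) ?_ (by simp)
            simp [hV, hi, hz]
          simp [this]
    simp_rw [hterm] at hL
    rw [← Finset.sum_filter, ← Finset.sum_mul] at hL
    have h1 : ∑ i ∈ Finset.univ.filter (fun i => y i = y i0), w i ≠ 0 :=
      hw _ ⟨i0, by simp⟩
    have h2 : p.eval (y i0) ≠ 0 := by
      rw [hp, Polynomial.eval_prod]
      refine Finset.prod_ne_zero_iff.mpr fun u hu => ?_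
      simp only [Polynomial.eval_sub, Polynomial.eval_X, Polynomial.eval_C]
      exact sub_ne_zero.mpr (Finset.ne_of_mem_erase hu).symm
    exact (mul_ne_zero h1 (mul_ne_zero hi0 h2)) hL
  constructor
  · have : (Finset.univ.image y).card = (Finset.univ : Finset (Fin (n + 1))).card := by
      simp only [Finset.card_univ, Fintype.card_fin]; omega
    have := Finset.card_image_iff.mp this
    exact fun a b hab => this (by simp) (by simp) hab
  · intro i hi
    have : (0 : k) ∈ Finset.univ.image y := by
      simpa using ⟨i, hi⟩
    have := Finset.card_erase_lt_of_mem this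
    rw [← hV] at this
    omega

/-- Maximal ideals of a finitely generated algebra over an algebraically closed field are kernels
of points. -/
theorem exists_algHom_of_isMaximal {K B : Type*} [Field K] [IsAlgClosed K] [CommRing B]
    [Algebra K B] [Algebra.FiniteType K B] (m : Ideal B) [hm : m.IsMaximal] :
    ∃ θ : B →ₐ[K] K, ∀ x, θ x = 0 ↔ x ∈ m := by
  let := Ideal.Quotient.field m
  have : Algebra.FiniteType K (B ⧸ m) :=
    Algebra.FiniteType.of_surjective (Ideal.Quotient.mkₐ K m) Ideal.Quotient.mk_surjective
  have : Module.Finite K (B ⧸ m) := finite_of_finite_type_of_isJacobsonRing K (B ⧸ m)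
  let ψ : (B ⧸ m) →ₐ[K] K := IsAlgClosed.lift
  refine ⟨ψ.comp (Ideal.Quotient.mkₐ K m), fun x => ?_⟩
  rw [AlgHom.comp_apply, map_eq_zero_iff ψ ψ.toRingHom.injective]
  exact Ideal.Quotient.eq_zero_iff_mem

/-! ### The family of all weighted power sum systems is finite étale -/

section Family

variable {R : Type*} [CommRing R] {n : ℕ}

/-- The homogeneous weighted power sums `∑ i, μ i * x i ^ (j + 1)`. -/
def weightedPsum (μ : Fin (n + 1) → R) (j : Fin n) : MvPolynomial (Fin n) R :=
  ∑ i : Fin n, C (μ i.castSucc) * X i ^ ((j : ℕ) + 1)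

/-- The weighted power sums in `x` and `1`. -/
def weightedRel (μ : Fin (n + 1) → R) (j : Fin n) : MvPolynomial (Fin n) R :=
  weightedPsum μ j + C (μ (Fin.last n))

/-- The coordinate ring of the family of solutions of weighted power sum equations. -/
abbrev WeightedAlg (μ : Fin (n + 1) → R) : Type _ :=
  MvPolynomial (Fin n) R ⧸ Ideal.span (Set.range (weightedRel μ))

theorem isHomogeneous_weightedPsum (μ : Fin (n + 1) → R) (j : Fin n) :
    (weightedPsum μ j).IsHomogeneous ((j : ℕ) + 1) := by
  refine IsHomogeneous.sum _ _ _ fun i _ => ?_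
  simpa using (isHomogeneous_C (Fin n) (μ i.castSucc)).mul ((isHomogeneous_X R i).pow ((j : ℕ) + 1))

theorem homogeneousComponent_mul_of_isHomogeneous {σ : Type*} {q h : MvPolynomial σ R} {j e : ℕ}
    (hh : h.IsHomogeneous j) :
    homogeneousComponent (e + j) (q * h) = homogeneousComponent e q * h := by
  conv_lhs => rw [← sum_homogeneousComponent q, Finset.sum_mul, map_sum]
  have : ∀ i, homogeneousComponent (e + j) (homogeneousComponent i q * h) =
      if i = e then homogeneousComponent i q * h else 0 := by
    intro i
    rw [homogeneousComponent_of_mem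
      (((homogeneousComponent_isHomogeneous i q).mul hh : _) : _ ∈ homogeneousSubmodule σ R (i + j))]
    simp [eq_comm]
  simp_rw [this]
  rw [Finset.sum_ite_eq']
  split_ifs with he
  · rfl
  · rw [homogeneousComponent_eq_zero, zero_mul]
    simpa using he

theorem homogeneousComponent_mul_of_lt {σ : Type*} {q h : MvPolynomial σ R} {j e : ℕ}
    (hh : h.IsHomogeneous j) (he : e < j) : homogeneousComponent e (q * h) = 0 := by
  rw [← sum_homogeneousComponent q, Finset.sum_mul, map_sum]
  refine Finset.sum_eq_zero fun i _ => ?_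
  rw [homogeneousComponent_of_mem
      (((homogeneousComponent_isHomogeneous i q).mul hh : _) : _ ∈ homogeneousSubmodule σ R (i + j))]
  rw [if_neg (by omega)]

variable {K : Type*} [Field K] [IsAlgClosed K] [Algebra K R] [Algebra.FiniteType K R]

theorem algHom_weights_ne_zero {B : Type*} [CommRing B] [Nontrivial B] {μ : Fin (n + 1) → R}
    (hμ : ∀ S : Finset (Fin (n + 1)), S.Nonempty → IsUnit (∑ i ∈ S, μ i)) (θ : R →+* B)
    (S : Finset (Fin (n + 1))) (hS : S.Nonempty) : ∑ i ∈ S, θ (μ i) ≠ 0 := by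
  rw [← map_sum]
  exact ((hμ S hS).map θ).ne_zero

theorem finiteType_mvPolynomial (K R : Type*) [Field K] [CommRing R] [Algebra K R]
    [Algebra.FiniteType K R] (n : ℕ) : Algebra.FiniteType K (MvPolynomial (Fin n) R) :=
  Algebra.FiniteType.trans (S := R) inferInstance inferInstance

-- Nullstellensatz: at a `K`-point where the leading forms vanish, the coordinates form a solution
-- without the constant term, and such a solution is zero by the subset sum condition.
-- Geometrically, the system has no solutions at infinity.
include K in
variable (K) in
theorem X_mem_radical_weightedPsum {μ : Fin (n + 1) → R}
    (hμ : ∀ S : Finset (Fin (n + 1)), S.Nonempty → IsUnit (∑ i ∈ S, μ i)) (i : Fin n) :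
    (X i : MvPolynomial (Fin n) R) ∈ (Ideal.span (Set.range (weightedPsum μ))).radical := by
  have := finiteType_mvPolynomial K R n
  have : IsJacobsonRing (MvPolynomial (Fin n) R) := isJacobsonRing_of_finiteType (A := K)
  rw [Ideal.radical_eq_jacobson, Ideal.jacobson, Ideal.mem_sInf]
  rintro m ⟨hm, hmax⟩
  obtain ⟨θ, hθ⟩ := exists_algHom_of_isMaximal (K := K) m
  rw [← hθ]
  by_contra hne
  -- The last entry is set to `0`, which contradicts the conclusion that all entries are nonzero as
  -- soon as one of the others is.
  have key := injective_of_weighted_power_sums (w := fun i => θ (C (μ i)))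
    (y := Fin.snoc (α := fun _ => K) (fun i => θ (X i)) 0)
    (algHom_weights_ne_zero hμ (θ.toRingHom.comp C)) ?_ ⟨i.castSucc, by simpa using hne⟩
  · exact key.2 (Fin.last n) (by simp)
  · intro j hj
    have := (hθ (weightedPsum μ ⟨j, hj⟩)).mpr (hm (Ideal.subset_span ⟨_, rfl⟩))
    rw [Fin.sum_univ_castSucc]
    simpa [weightedPsum] using this

/-- Modulo the relations each leading form equals the constant `-μ (Fin.last n)`, so a homogeneous
element of the ideal of leading forms can be rewritten in strictly smaller degree. -/
theorem homogeneousComponent_mem_of_mem_span {n : ℕ} {μ : Fin (n + 1) → R}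
    {p : MvPolynomial (Fin n) R} {e : ℕ} (hp : p.IsHomogeneous e) (h : p ∈ Ideal.span (Set.range (weightedPsum μ))) :
    ∃ q : MvPolynomial (Fin n) R, (∀ s ∈ q.support, s.degree < e) ∧
      p - q ∈ Ideal.span (Set.range (weightedRel μ)) := by
  obtain ⟨c, hc⟩ := (Ideal.mem_span_range_iff_exists_fun).mp h
  have hp' : p = ∑ j : Fin n, homogeneousComponent e (c j * weightedPsum μ j) := by
    rw [← map_sum, hc, homogeneousComponent_of_mem hp, if_pos rfl]
  refine ⟨∑ j : Fin n, if (j : ℕ) + 1 ≤ e then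
    - (C (μ (Fin.last n)) * homogeneousComponent (e - (j + 1)) (c j)) else 0, ?_, ?_⟩
  · intro s hs
    obtain ⟨j, -, hj⟩ := Finset.mem_biUnion.mp (support_sum hs)
    split_ifs at hj with hje
    · rw [support_neg] at hj
      have h1 : ((C (μ (Fin.last n)) * homogeneousComponent (e - ((j : ℕ) + 1)) (c j))).IsHomogeneous
          (e - ((j : ℕ) + 1)) := by
        simpa using (isHomogeneous_C (Fin n) (μ (Fin.last n))).mul
          (homogeneousComponent_isHomogeneous (e - ((j : ℕ) + 1)) (c j))
      have h2 := h1 (mem_support_iff.mp hj)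
      rw [Finsupp.degree_eq_weight_one (R := ℕ)]
      change Finsupp.weight 1 s < e
      rw [h2]
      omega
    · simp at hj
  · nth_rw 1 [hp']
    rw [← Finset.sum_sub_distrib]
    refine Ideal.sum_mem _ fun j _ => ?_
    split_ifs with hje
    · obtain ⟨e', rfl⟩ := Nat.exists_eq_add_of_le' hje
      rw [homogeneousComponent_mul_of_isHomogeneous (isHomogeneous_weightedPsum μ j),
        Nat.add_sub_cancel]
      have : homogeneousComponent e' (c j) * weightedPsum μ j -
          -(C (μ (Fin.last n)) * homogeneousComponent e' (c j)) =
          homogeneousComponent e' (c j) * weightedRel μ j := by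
        rw [weightedRel]; ring
      rw [this]
      exact Ideal.mul_mem_left _ _ (Ideal.subset_span ⟨_, rfl⟩)
    · rw [homogeneousComponent_mul_of_lt (isHomogeneous_weightedPsum μ j) (by omega)]
      simp

-- Some power of each variable lies in the ideal of leading forms. A monomial of large degree
-- contains such a power and so reduces to lower degree modulo the relations; monomials of bounded
-- degree therefore span.
include K in
variable (K) in
theorem finite_weightedAlg {μ : Fin (n + 1) → R}
    (hμ : ∀ S : Finset (Fin (n + 1)), S.Nonempty → IsUnit (∑ i ∈ S, μ i)) :
    Module.Finite R (WeightedAlg μ) := by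
  classical
  have hX : ∀ i : Fin n, ∃ M : ℕ, (X i : MvPolynomial (Fin n) R) ^ M ∈
      Ideal.span (Set.range (weightedPsum μ)) := fun i => X_mem_radical_weightedPsum K hμ i
  choose M hM using hX
  set D := ∑ i, M i with hD
  set mk := (Ideal.Quotient.mkₐ R (Ideal.span (Set.range (weightedRel μ)))) with hmk
  set T : Set (WeightedAlg μ) :=
    (fun s : Fin n →₀ ℕ => mk (monomial s 1)) '' {s | s.degree ≤ D} with hT
  have hTfin : T.Finite := (Finsupp.finite_of_degree_le D).image _
  have hmon : ∀ e : ℕ, ∀ s : Fin n →₀ ℕ, s.degree = e → mk (monomial s 1) ∈ Submodule.span R T := by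
    intro e
    induction e using Nat.strong_induction_on with
    | _ e ih =>
      intro s hs
      by_cases hle : s.degree ≤ D
      · exact Submodule.subset_span ⟨s, hle, rfl⟩
      · obtain ⟨i, hi⟩ : ∃ i, M i ≤ s i := by
          by_contra! hcon
          apply hle
          rw [Finsupp.degree_eq_sum]
          exact Finset.sum_le_sum fun i _ => (hcon i).le
        have hmem : (monomial s 1 : MvPolynomial (Fin n) R) ∈
            Ideal.span (Set.range (weightedPsum μ)) := by
          have : (monomial s 1 : MvPolynomial (Fin n) R) =
              monomial (s - Finsupp.single i (M i)) 1 * X i ^ M i := by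
            rw [X_pow_eq_monomial, monomial_mul, one_mul,
              tsub_add_cancel_of_le (Finsupp.single_le_iff.mpr hi)]
          rw [this]
          exact Ideal.mul_mem_left _ _ (hM i)
        obtain ⟨q, hq, hsub⟩ := homogeneousComponent_mem_of_mem_span
          (isHomogeneous_monomial (1 : R) hs) hmem
        have heq : mk (monomial s 1) = mk q := Ideal.Quotient.eq.mpr hsub
        rw [heq, q.as_sum, map_sum]
        refine Submodule.sum_mem _ fun t ht => ?_
        have : mk (monomial t (coeff t q)) = coeff t q • mk (monomial t 1) := by
          rw [← map_smul, smul_monomial, smul_eq_mul, mul_one]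
        rw [this]
        exact Submodule.smul_mem _ _ (ih _ (hq t ht) t rfl)
  refine ⟨⟨hTfin.toFinset, ?_⟩⟩
  rw [Set.Finite.coe_toFinset, eq_top_iff]
  rintro x -
  obtain ⟨p, rfl⟩ := Ideal.Quotient.mkₐ_surjective R _ x
  change mk p ∈ _
  rw [p.as_sum, map_sum]
  refine Submodule.sum_mem _ fun t _ => ?_
  have : mk (monomial t (coeff t p)) = coeff t p • mk (monomial t 1) := by
    rw [← map_smul, smul_monomial, smul_eq_mul, mul_one]
  rw [this]
  exact Submodule.smul_mem _ _ (hmon _ t rfl)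

theorem isUnit_of_forall_algHom_ne_zero {B : Type*} [CommRing B] [Algebra K B]
    [Algebra.FiniteType K B] {b : B} (h : ∀ θ : B →ₐ[K] K, θ b ≠ 0) : IsUnit b := by
  by_contra hb
  obtain ⟨m, hm, hbm⟩ := exists_max_ideal_of_mem_nonunits hb
  obtain ⟨θ, hθ⟩ := exists_algHom_of_isMaximal (K := K) m
  exact h θ ((hθ b).mpr hbm)

/-- The coordinates of a point of the family are distinct. -/
theorem weightedAlg_injective {k : Type*} [Field k] {μ : Fin (n + 1) → R}
    (hμ : ∀ S : Finset (Fin (n + 1)), S.Nonempty → IsUnit (∑ i ∈ S, μ i))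
    (θ : WeightedAlg μ →+* k) :
    Function.Injective fun i => θ (Ideal.Quotient.mk _ (X i)) := by
  have key := injective_of_weighted_power_sums
    (w := fun i => θ (Ideal.Quotient.mk _ (C (μ i))))
    (y := Fin.snoc (α := fun _ => k) (fun i => θ (Ideal.Quotient.mk _ (X i))) 1)
    (algHom_weights_ne_zero hμ ((θ.comp (Ideal.Quotient.mk _)).comp C)) ?_
    ⟨Fin.last n, by simp⟩
  · intro i j hij
    have := @key.1 i.castSucc j.castSucc (by simpa using hij)
    simpa using this
  · intro j hj
    have : θ (Ideal.Quotient.mk _ (weightedRel μ ⟨j, hj⟩)) = 0 := by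
      rw [Ideal.Quotient.eq_zero_iff_mem.mpr (Ideal.subset_span (Set.mem_range_self _)), map_zero]
    rw [Fin.sum_univ_castSucc]
    simpa [weightedRel, weightedPsum] using this

-- Jacobian criterion. At every `K`-point the Jacobian determinant is a product of weights, the
-- numbers `1, …, n` and a Vandermonde determinant in the coordinates, which are distinct.
include K in
variable (K) in
theorem etale_weightedAlg [CharZero K] {μ : Fin (n + 1) → R}
    (hμ : ∀ S : Finset (Fin (n + 1)), S.Nonempty → IsUnit (∑ i ∈ S, μ i)) :
    Algebra.Etale R (WeightedAlg μ) := by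
  have := finiteType_mvPolynomial K R n
  have : Algebra.FiniteType K (WeightedAlg μ) :=
    Algebra.FiniteType.of_surjective (Ideal.Quotient.mkₐ K _) Ideal.Quotient.mk_surjective
  let P : Algebra.PreSubmersivePresentation R (WeightedAlg μ) (Fin n) (Fin n) :=
    Algebra.PreSubmersivePresentation.naive (v := weightedRel μ) id Function.injective_id
  have hJ : IsUnit P.jacobian := by
    refine isUnit_of_forall_algHom_ne_zero (K := K) fun θ => ?_
    rw [P.jacobian_eq_jacobiMatrix_det]
    have hinj := weightedAlg_injective hμ θ.toRingHom
    have hdet : θ (algebraMap P.Ring (WeightedAlg μ) P.jacobiMatrix.det) =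
        (Matrix.of fun i j : Fin n => θ (Ideal.Quotient.mk _ (C (μ i.castSucc))) *
          (Matrix.of fun i j : Fin n => (((j : ℕ) + 1 : ℕ) : K) *
            Matrix.vandermonde (fun i => θ (Ideal.Quotient.mk _ (X i))) i j) i j).det := by
      rw [RingHom.map_det, AlgHom.map_det]
      congr 1
      ext i j
      have h1 : P.jacobiMatrix i j = pderiv i (weightedRel μ j) :=
        Algebra.PreSubmersivePresentation.jacobiMatrix_naive _ _ _ _ _ _
      have h2 : pderiv i (weightedRel μ j) =
          C (μ i.castSucc) * ((((j : ℕ) + 1 : ℕ) : MvPolynomial (Fin n) R) * X i ^ (j : ℕ)) := by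
        rw [weightedRel, weightedPsum, map_add, map_sum, pderiv_C, add_zero, Finset.sum_eq_single i]
        · simp
        · intro l _ hl
          simp [pderiv_X_of_ne hl]
        · simp
      have h3 : ∀ p, algebraMap P.Ring (WeightedAlg μ) p = Ideal.Quotient.mk _ p := by
        intro p
        rw [P.algebraMap_apply, ← Ideal.Quotient.mkₐ_eq_mk R]
        exact DFunLike.congr_fun (aeval_unique (Ideal.Quotient.mkₐ R _)).symm p
      simp only [RingHom.mapMatrix_apply, AlgHom.mapMatrix_apply, Matrix.map_apply, h1, h2, h3,
        map_mul, map_pow, map_natCast, Matrix.of_apply, Matrix.vandermonde_apply]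
    rw [hdet, Matrix.det_mul_column, Matrix.det_mul_row]
    refine mul_ne_zero (Finset.prod_ne_zero_iff.mpr fun i _ => ?_)
      (mul_ne_zero (Finset.prod_ne_zero_iff.mpr fun j _ => Nat.cast_ne_zero.mpr (by omega))
        (Matrix.det_vandermonde_ne_zero_iff.mpr hinj))
    have := algHom_weights_ne_zero hμ ((θ.toRingHom.comp (Ideal.Quotient.mk _)).comp C)
      {i.castSucc} (by simp)
    simpa using this
  let S : Algebra.SubmersivePresentation R (WeightedAlg μ) (Fin n) (Fin n) :=
    { P with jacobian_isUnit := hJ }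
  have := S.isStandardSmoothOfRelativeDimension (n := 0)
    (by simp [Algebra.Presentation.dimension])
  infer_instance

variable (K) in
/-- The number of points in the fibres of the family of solutions is constant. -/
theorem natCard_algHom_weightedAlg [CharZero K] [IsDomain R] {μ : Fin (n + 1) → R}
    (hμ : ∀ S : Finset (Fin (n + 1)), S.Nonempty → IsUnit (∑ i ∈ S, μ i)) (φ : R →ₐ[K] K) :
    letI := φ.toRingHom.toAlgebra
    Nat.card (WeightedAlg μ →ₐ[R] K) = Module.rankAtStalk (R := R) (WeightedAlg μ) ⊥ := by
  let := φ.toRingHom.toAlgebra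
  have := finite_weightedAlg K hμ
  have := etale_weightedAlg K hμ
  have e1 : (WeightedAlg μ →ₐ[R] K) ≃ (TensorProduct R K (WeightedAlg μ) →ₐ[K] K) :=
    AlgHom.liftEquiv R K (WeightedAlg μ) K
  have e2 := Algebra.IsFiniteSplit.algHomEquivPrimeSpectrum K (TensorProduct R K (WeightedAlg μ))
  -- The fibre is étale over a separably closed field, hence a product of copies of `K`, and its
  -- points are counted by its dimension.
  have e3 := Algebra.FormallyEtale.equivPiOfIsSepClosed K (TensorProduct R K (WeightedAlg μ))
  -- The rank of a finite flat module at a prime is its rank at the generic point `⊥` of the domain,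
  -- so it does not depend on `φ`.
  have hr : Module.rankAtStalk (R := K) (TensorProduct R K (WeightedAlg μ)) ⊥ =
      Module.rankAtStalk (R := R) (WeightedAlg μ) ⊥ := by
    rw [Module.rankAtStalk_baseChange]
    exact (Module.rankAtStalk_eq_of_le_of_finite_of_flat _ bot_le).symm
  rw [Nat.card_congr (e1.trans e2), ← hr, Module.rankAtStalk_eq_finrank_of_free,
    e3.toLinearEquiv.finrank_eq]
  have : IsArtinianRing (TensorProduct R K (WeightedAlg μ)) := isArtinian_of_tower K inferInstance
  have : Finite (PrimeSpectrum (TensorProduct R K (WeightedAlg μ))) :=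
    Finite.of_equiv _ (IsArtinianRing.primeSpectrumEquivMaximalSpectrum
      (R := TensorProduct R K (WeightedAlg μ))).symm
  have := Fintype.ofFinite (PrimeSpectrum (TensorProduct R K (WeightedAlg μ)))
  rw [Module.finrank_fintype_fun_eq_card, Nat.card_eq_fintype_card]
  rfl

/-- Points of a fibre of the family are solutions of the weighted power sum equations. -/
def weightedAlgHomEquiv (μ : Fin (n + 1) → R) (φ : R →ₐ[K] K) :
    letI := φ.toRingHom.toAlgebra
    (WeightedAlg μ →ₐ[R] K) ≃ {x : Fin n → K | ∀ j < n,
      ∑ i : Fin n, φ (μ i.castSucc) * x i ^ (j + 1) + φ (μ (Fin.last n)) = 0} :=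
  letI := φ.toRingHom.toAlgebra
  have halg : ∀ r, algebraMap R K r = φ r := fun _ => rfl
  have hrel : ∀ (x : Fin n → K) (j : Fin n), aeval x (weightedRel μ j) =
      ∑ i : Fin n, φ (μ i.castSucc) * x i ^ ((j : ℕ) + 1) + φ (μ (Fin.last n)) := fun x j => by
    simp [weightedRel, weightedPsum, halg]
  { toFun := fun θ => ⟨fun i => θ (Ideal.Quotient.mk _ (X i)), fun j hj => by
      rw [← hrel _ ⟨j, hj⟩]
      have h1 : aeval (R := R) (fun i => θ (Ideal.Quotient.mk _ (X i))) (weightedRel μ ⟨j, hj⟩) =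
          θ (Ideal.Quotient.mk _ (weightedRel μ ⟨j, hj⟩)) :=
        DFunLike.congr_fun (aeval_unique (θ.comp (Ideal.Quotient.mkₐ R _))).symm
          (weightedRel μ ⟨j, hj⟩)
      rw [h1, Ideal.Quotient.eq_zero_iff_mem.mpr (Ideal.subset_span (Set.mem_range_self _)),
        map_zero]⟩
    invFun := fun x => Ideal.Quotient.liftₐ _ (aeval (x : Fin n → K)) (by
      intro a ha
      have : Ideal.span (Set.range (weightedRel μ)) ≤
          RingHom.ker (aeval (R := R) (x : Fin n → K)) := by
        rw [Ideal.span_le]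
        rintro _ ⟨j, rfl⟩
        exact (hrel _ j).trans (x.2 j j.2)
      exact this ha)
    left_inv := fun θ => by
      apply Ideal.Quotient.algHom_ext
      ext i
      exact aeval_X _ _
    right_inv := fun x => by
      ext i
      exact aeval_X _ _ }

end Family

/-! ### Counting the solutions, starting from equal weights -/

/-- Adding `1` to a solution of the all-ones system gives all roots of unity. -/
theorem pow_eq_one_of_power_sums {K : Type*} [Field K] [CharZero K] {n : ℕ} {y : Fin (n + 1) → K}
    (h : ∀ j < n, ∑ i, y i ^ (j + 1) = 0) (h1 : y (Fin.last n) = 1) (i : Fin (n + 1)) :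
    y i ^ (n + 1) = 1 := by
  -- Newton's identities: vanishing of the first `n` power sums forces vanishing of the first `n`
  -- elementary symmetric functions, so `∏ (t - y i)` is `t ^ (n + 1)` plus a constant, with `1`
  -- among its roots.
  have hes : ∀ k, 0 < k → k ≤ n → aeval y (esymm (Fin (n + 1)) K k) = 0 := by
    intro k hk hkn
    have := congrArg (aeval y) (mul_esymm_eq_sum (Fin (n + 1)) K k)
    rw [map_mul, map_natCast, map_mul, map_sum] at this
    rw [Finset.sum_eq_zero, mul_zero] at this
    · exact (mul_eq_zero.mp this).resolve_left (Nat.cast_ne_zero.mpr hk.ne')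
    · intro a ha
      rw [Finset.mem_filter, Finset.HasAntidiagonal.mem_antidiagonal] at ha
      obtain ⟨j, hj⟩ := Nat.exists_eq_add_of_lt (show 0 < a.2 by omega)
      rw [map_mul]
      convert mul_zero _
      rw [psum, map_sum]
      simp only [map_pow, aeval_X]
      rw [hj, zero_add]
      exact h j (by omega)
  have hprod : ∀ t : K, ∏ i, (t - y i) =
      t ^ (n + 1) + (-1) ^ (n + 1) * aeval y (esymm (Fin (n + 1)) K (n + 1)) := by
    intro t
    have := congrArg (Polynomial.eval t)
      (Multiset.prod_X_sub_X_eq_sum_esymm (Finset.univ.val.map y))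
    rw [Multiset.map_map, Polynomial.eval_multiset_prod, Multiset.map_map,
      Polynomial.eval_finsetSum] at this
    simp only [Multiset.card_map, Finset.card_val, Finset.card_univ, Fintype.card_fin,
      ← aeval_esymm_eq_multiset_esymm (Fin (n + 1)) K] at this
    rw [Finset.sum_range_succ, Finset.sum_range_succ', Finset.sum_eq_zero] at this
    · rw [Finset.prod_eq_multiset_prod]
      refine Eq.trans (congrArg Multiset.prod (Multiset.map_congr rfl fun i _ => ?_)) (this.trans ?_)
      · simp
      · simp
    · intro k hk
      rw [hes (k + 1) (by omega) (by have := Finset.mem_range.mp hk; omega)]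
      simp
  have e1 := hprod 1
  rw [Finset.prod_eq_zero (Finset.mem_univ (Fin.last n)) (by rw [h1, sub_self]), one_pow] at e1
  have e2 := hprod (y i)
  rw [Finset.prod_eq_zero (Finset.mem_univ i) (sub_self _)] at e2
  linear_combination e1 - e2


/-- The entries exhaust the `(n+1)`-st roots of unity, a set stable under multiplication by a
primitive root `ζ`. The power sum is thus invariant under multiplication by `ζ ^ (j + 1) ≠ 1`. -/
theorem sum_pow_eq_zero_of_injective {K : Type*} [Field K] [CharZero K] [IsAlgClosed K]
    {n : ℕ} {y : Fin (n + 1) → K} (hy : Function.Injective y) (h : ∀ i, y i ^ (n + 1) = 1)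
    {j : ℕ} (hj : j < n) : ∑ i, y i ^ (j + 1) = 0 := by
  classical
  obtain ⟨ζ, hζ⟩ := HasEnoughRootsOfUnity.exists_primitiveRoot K (n + 1)
  have himg : Finset.univ.image y = Polynomial.nthRootsFinset (n + 1) (1 : K) := by
    refine Finset.eq_of_subset_of_card_le ?_ ?_
    · intro z hz
      obtain ⟨i, -, rfl⟩ := Finset.mem_image.mp hz
      exact (Polynomial.mem_nthRootsFinset (Nat.succ_pos n) _).mpr (h i)
    · rw [hζ.card_nthRootsFinset, Finset.card_image_of_injective _ hy]
      simp
  have hsum : ∑ i, y i ^ (j + 1) = ∑ z ∈ Polynomial.nthRootsFinset (n + 1) (1 : K), z ^ (j + 1) := by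
    rw [← himg, Finset.sum_image fun a _ b _ hab => hy hab]
  have hmul : ζ ^ (j + 1) * ∑ z ∈ Polynomial.nthRootsFinset (n + 1) (1 : K), z ^ (j + 1) =
      ∑ z ∈ Polynomial.nthRootsFinset (n + 1) (1 : K), z ^ (j + 1) := by
    have hζ0 : ζ ≠ 0 := hζ.ne_zero (Nat.succ_ne_zero n)
    rw [Finset.mul_sum]
    refine Finset.sum_bij' (fun z _ => ζ * z) (fun z _ => ζ⁻¹ * z) ?_ ?_ ?_ ?_ ?_
    · intro z hz
      rw [Polynomial.mem_nthRootsFinset (Nat.succ_pos n)] at hz ⊢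
      rw [mul_pow, hz, hζ.pow_eq_one, one_mul]
    · intro z hz
      rw [Polynomial.mem_nthRootsFinset (Nat.succ_pos n)] at hz ⊢
      rw [mul_pow, hz, inv_pow, hζ.pow_eq_one, inv_one, one_mul]
    · intro z _; field_simp
    · intro z _; field_simp
    · intro z _; rw [mul_pow]
  rw [hsum]
  have hne : ζ ^ (j + 1) - 1 ≠ 0 :=
    sub_ne_zero.mpr (hζ.pow_ne_one_of_pos_of_lt (Nat.succ_ne_zero j) (by omega))
  refine (mul_eq_zero.mp ?_).resolve_left hne
  linear_combination hmul

/-- A solution is the same thing as an injective enumeration of the `n` nontrivial `(n+1)`-st roots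
of unity, the root `1` being the adjoined entry. -/
theorem natCard_solutions_one (K : Type*) [Field K] [CharZero K] [IsAlgClosed K] (n : ℕ) :
    Nat.card {x : Fin n → K | ∀ j < n, ∑ i : Fin n, 1 * x i ^ (j + 1) + 1 = 0} = n.factorial := by
  classical
  obtain ⟨ζ, hζ⟩ := HasEnoughRootsOfUnity.exists_primitiveRoot K (n + 1)
  set U := (Polynomial.nthRootsFinset (n + 1) (1 : K)).erase 1 with hU
  have hUcard : Fintype.card U = n := by
    rw [Fintype.card_coe, hU, Finset.card_erase_of_mem, hζ.card_nthRootsFinset]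
    · simp
    · simp [Polynomial.mem_nthRootsFinset]
  have hones : ∀ S : Finset (Fin (n + 1)), S.Nonempty → ∑ i ∈ S, (1 : K) ≠ 0 := by
    intro S hS
    simpa using hS.ne_empty
  have hsol : ∀ x : Fin n → K, (∀ j < n, ∑ i : Fin n, 1 * x i ^ (j + 1) + 1 = 0) →
      ∀ j < n, ∑ i, (Fin.snoc (α := fun _ => K) x 1 : Fin (n + 1) → K) i ^ (j + 1) = 0 := by
    intro x hx j hj
    rw [Fin.sum_univ_castSucc]
    simpa using hx j hj
  have hinj : ∀ x : Fin n → K, (∀ j < n, ∑ i : Fin n, 1 * x i ^ (j + 1) + 1 = 0) →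
      Function.Injective (Fin.snoc (α := fun _ => K) x 1 : Fin (n + 1) → K) := fun x hx =>
    (injective_of_weighted_power_sums (w := fun _ => 1) hones
      (by simpa using hsol x hx) ⟨Fin.last n, by simp⟩).1
  let e : {x : Fin n → K | ∀ j < n, ∑ i : Fin n, 1 * x i ^ (j + 1) + 1 = 0} ≃ (Fin n ↪ U) :=
    { toFun := fun x => ⟨fun i => ⟨x.1 i, by
        have h1 := pow_eq_one_of_power_sums (hsol x.1 x.2) (by simp) i.castSucc
        have h2 := hinj x.1 x.2
        rw [hU, Finset.mem_erase, Polynomial.mem_nthRootsFinset (Nat.succ_pos n)]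
        refine ⟨fun h => ?_, by simpa using h1⟩
        have := @h2 i.castSucc (Fin.last n) (by simpa using h)
        exact (Fin.castSucc_lt_last i).ne this⟩, fun i j hij => by
          have h2 := hinj x.1 x.2
          have := @h2 i.castSucc j.castSucc (by simpa using hij)
          simpa using this⟩
      invFun := fun f => ⟨fun i => f i, fun j hj => by
        have := sum_pow_eq_zero_of_injective
          (y := (Fin.snoc (α := fun _ => K) (fun i => (f i : K)) 1 : Fin (n + 1) → K)) ?_ ?_ hj
        · rw [Fin.sum_univ_castSucc] at this
          simpa using this
        · rw [Fin.snoc_injective_iff]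
          refine ⟨fun a b hab => f.injective (Subtype.ext hab), ?_⟩
          rintro ⟨i, hi⟩
          exact (Finset.mem_erase.mp (f i).2).1 hi
        · intro i
          induction i using Fin.lastCases with
          | last => simp
          | cast i =>
            simpa using (Polynomial.mem_nthRootsFinset (Nat.succ_pos n) _).mp
              (Finset.mem_erase.mp (f i).2).2⟩
      left_inv := fun x => rfl
      right_inv := fun f => rfl }
  rw [Nat.card_congr e, Nat.card_eq_fintype_card, Fintype.card_embedding_eq, hUcard,
    Fintype.card_fin, Nat.descFactorial_self]

/-- A generic weighted power sum system in `n` unknowns has exactly `n!` solutions. -/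
theorem natCard_solutions {K : Type*} [Field K] [CharZero K] [IsAlgClosed K] {n : ℕ}
    {w : Fin (n + 1) → K} (hw : ∀ S : Finset (Fin (n + 1)), S.Nonempty → ∑ i ∈ S, w i ≠ 0) :
    Nat.card {x : Fin n → K | ∀ j < n,
      ∑ i : Fin n, w i.castSucc * x i ^ (j + 1) + w (Fin.last n) = 0} = n.factorial := by
  classical
  set Δ : MvPolynomial (Fin (n + 1)) K :=
    ∏ S ∈ Finset.univ.filter (fun S : Finset (Fin (n + 1)) => S.Nonempty), ∑ i ∈ S, X i with hΔ
  have hev : ∀ v : Fin (n + 1) → K,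
      (∀ S : Finset (Fin (n + 1)), S.Nonempty → ∑ i ∈ S, v i ≠ 0) → aeval v Δ ≠ 0 := by
    intro v hv
    rw [hΔ, map_prod]
    refine Finset.prod_ne_zero_iff.mpr fun S hS => ?_
    simpa using hv S (Finset.mem_filter.mp hS).2
  have hΔ0 : Δ ≠ 0 := fun h => hev w hw (by rw [h, map_zero])
  -- The coordinate ring of the space of weights all of whose nonempty subset sums are nonzero. Both
  -- `w` and the all-ones vector are points of it, and the fibres over them have equally many
  -- points.
  let R := Localization.Away Δ
  have : IsDomain R := IsLocalization.isDomain_localization (powers_le_nonZeroDivisors_of_noZeroDivisors hΔ0)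
  have : Algebra.FiniteType (MvPolynomial (Fin (n + 1)) K) R :=
    IsLocalization.finiteType_of_monoid_fg (Submonoid.powers Δ) R
  have : Algebra.FiniteType K R :=
    Algebra.FiniteType.trans (S := MvPolynomial (Fin (n + 1)) K) inferInstance inferInstance
  let μ : Fin (n + 1) → R := fun i => algebraMap (MvPolynomial (Fin (n + 1)) K) R (X i)
  have hμ : ∀ S : Finset (Fin (n + 1)), S.Nonempty → IsUnit (∑ i ∈ S, μ i) := by
    intro S hS
    have h1 : ∑ i ∈ S, μ i = algebraMap (MvPolynomial (Fin (n + 1)) K) R (∑ i ∈ S, X i) := (map_sum _ _ _).symm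
    rw [h1]
    refine isUnit_of_dvd_unit (map_dvd _ ?_) (IsLocalization.Away.algebraMap_isUnit (S := R) Δ)
    exact Finset.dvd_prod_of_mem _ (by simpa using hS)
  have hpt : ∀ v : Fin (n + 1) → K,
      (∀ S : Finset (Fin (n + 1)), S.Nonempty → ∑ i ∈ S, v i ≠ 0) →
      ∃ φ : R →ₐ[K] K, ∀ i, φ (μ i) = v i := by
    intro v hv
    refine ⟨IsLocalization.liftAlgHom (M := Submonoid.powers Δ) (f := aeval v) ?_, fun i => ?_⟩
    · rintro ⟨_, k, rfl⟩
      rw [map_pow]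
      exact (isUnit_iff_ne_zero.mpr (hev v hv)).pow k
    · simp [μ]
  obtain ⟨φ, hφ⟩ := hpt w hw
  obtain ⟨ψ, hψ⟩ := hpt (fun _ => 1) (fun S hS => by simpa using hS.ne_empty)
  have h1 := (Nat.card_congr (weightedAlgHomEquiv μ φ)).symm.trans (natCard_algHom_weightedAlg K hμ φ)
  have h2 := (Nat.card_congr (weightedAlgHomEquiv μ ψ)).symm.trans (natCard_algHom_weightedAlg K hμ ψ)
  simp only [hφ] at h1
  simp only [hψ] at h2
  rw [h1, ← h2]
  exact natCard_solutions_one K n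

/-! ### Local multiplicity of a product of fat points -/

section LocalMultiplicity

variable {K : Type*} [Field K] {σ : Type*} [Fintype σ]

/-- The ideal generated by the powers `(X v - p v) ^ e v`. -/
def powIdeal (p : σ → K) (e : σ → ℕ) : Ideal (MvPolynomial σ K) :=
  Ideal.span (Set.range fun v => (X v - C (p v)) ^ e v)

/-- Translation of polynomials by `p`. -/
def translate (p : σ → K) : MvPolynomial σ K →ₐ[K] MvPolynomial σ K := aeval fun v => X v + C (p v)

omit [Fintype σ] in
theorem translate_neg_translate (p : σ → K) (a : MvPolynomial σ K) :
    translate (fun v => - p v) (translate p a) = a := by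
  have : (translate fun v => - p v).comp (translate p) = AlgHom.id K _ := by
    ext v : 1
    simp [translate, algebraMap_eq]
  exact DFunLike.congr_fun this a

theorem translate_translate_neg (p : σ → K) (a : MvPolynomial σ K) :
    translate p (translate (fun v => - p v) a) = a := by
  simpa using translate_neg_translate (fun v => - p v) a

/-- The coefficients of the Taylor expansion at `p` in exponents below `e`. -/
def truncCoeff (p : σ → K) (e : σ → ℕ) : MvPolynomial σ K →ₗ[K] ((∀ v, Fin (e v)) → K) where
  toFun a s := coeff (Finsupp.equivFunOnFinite.symm fun v => (s v : ℕ)) (translate p a)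
  map_add' a b := by ext; simp
  map_smul' c a := by ext; simp

theorem truncCoeff_surjective (p : σ → K) (e : σ → ℕ) : Function.Surjective (truncCoeff p e) := by
  classical
  intro y
  refine ⟨translate (fun v => - p v) (∑ s : (∀ v, Fin (e v)),
    monomial (Finsupp.equivFunOnFinite.symm fun v => (s v : ℕ)) (y s)), ?_⟩
  ext t
  change coeff _ (translate p _) = _
  rw [translate_translate_neg, coeff_sum, Finset.sum_eq_single t]
  · simp
  · intro s _ hst
    rw [coeff_monomial, if_neg]
    intro h
    apply hst
    ext v
    simpa using DFunLike.congr_fun h v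
  · simp

/-- Translating `p` to the origin turns `powIdeal p e` into a monomial ideal, in which membership is
read off the support. -/
theorem ker_truncCoeff (p : σ → K) (e : σ → ℕ) (a : MvPolynomial σ K) :
    truncCoeff p e a = 0 ↔ a ∈ powIdeal p e := by
  classical
  have h1 : truncCoeff p e a = 0 ↔ translate p a ∈
      Ideal.span ((fun s => monomial s (1 : K)) '' Set.range fun v => Finsupp.single v (e v)) := by
    rw [mem_ideal_span_monomial_image]
    constructor
    · intro h s hs
      by_contra! hcon
      have hlt : ∀ v, s v < e v := fun v => by
        have := hcon _ ⟨v, rfl⟩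
        rwa [Finsupp.single_le_iff, not_le] at this
      have := congrFun h fun v => ⟨s v, hlt v⟩
      apply mem_support_iff.mp hs
      refine Eq.trans ?_ this
      change _ = coeff _ _
      congr 1
      ext v
      simp
    · intro h
      ext s
      change coeff _ _ = 0
      by_contra hne
      obtain ⟨_, ⟨v, rfl⟩, hv⟩ := h _ (mem_support_iff.mpr hne)
      rw [Finsupp.single_le_iff] at hv
      have := (s v).2
      simp at hv
      omega
  have h2 : Ideal.map (translate p) (powIdeal p e) =
      Ideal.span ((fun s => monomial s (1 : K)) '' Set.range fun v => Finsupp.single v (e v)) := by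
    rw [powIdeal, Ideal.map_span, ← Set.range_comp, ← Set.range_comp]
    congr 2
    ext v : 1
    simp [translate, X_pow_eq_monomial, algebraMap_eq]
  rw [h1, ← h2]
  constructor
  · intro h
    have h3 := Ideal.mem_map_of_mem (translate fun v => - p v) h
    rw [Ideal.map_mapₐ, translate_neg_translate] at h3
    have : (translate fun v => - p v).comp (translate p) = AlgHom.id K _ :=
      AlgHom.ext (translate_neg_translate p)
    rw [this] at h3
    simpa using h3
  · exact Ideal.mem_map_of_mem _

theorem finrank_quotient_powIdeal (p : σ → K) (e : σ → ℕ) :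
    Module.finrank K (MvPolynomial σ K ⧸ powIdeal p e) = ∏ v, e v := by
  classical
  have hker : LinearMap.ker (truncCoeff p e) = (powIdeal p e).restrictScalars K := by
    ext a
    exact ker_truncCoeff p e a
  have e1 := (truncCoeff p e).quotKerEquivOfSurjective (truncCoeff_surjective p e)
  have e2 : (MvPolynomial σ K ⧸ powIdeal p e) ≃ₗ[K] (MvPolynomial σ K ⧸ LinearMap.ker (truncCoeff p e)) :=
    (Submodule.Quotient.restrictScalarsEquiv K (powIdeal p e)).symm.trans
      (Submodule.quotEquivOfEq _ _ hker.symm)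
  rw [(e2.trans e1).finrank_eq, Module.finrank_fintype_fun_eq_card]
  simp

-- The quotient is already local at `p`: every polynomial differs from its value at `p` by a
-- nilpotent. Localising therefore does not change its dimension.
omit [Fintype σ] in
theorem isUnit_mk_powIdeal (p : σ → K) (e : σ → ℕ) {s : MvPolynomial σ K} (hs : eval p s ≠ 0) :
    IsUnit (Ideal.Quotient.mk (powIdeal p e) s) := by
  have hX : ∀ v, IsNilpotent (Ideal.Quotient.mk (powIdeal p e) (X v - C (p v))) := fun v =>
    ⟨e v, by
      rw [← map_pow]
      exact Ideal.Quotient.eq_zero_iff_mem.mpr (Ideal.subset_span ⟨v, rfl⟩)⟩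
  have hnil : ∀ a : MvPolynomial σ K,
      IsNilpotent (Ideal.Quotient.mk (powIdeal p e) (a - C (eval p a))) := by
    intro a
    induction a using MvPolynomial.induction_on with
    | C c => simp
    | add a b ha hb =>
      have : a + b - C (eval p (a + b)) = (a - C (eval p a)) + (b - C (eval p b)) := by
        simp only [map_add]; ring
      rw [this, map_add]
      exact (Commute.all _ _).isNilpotent_add ha hb
    | mul_X a v ha =>
      have : a * X v - C (eval p (a * X v)) =
          (a - C (eval p a)) * X v + C (eval p a) * (X v - C (p v)) := by
        simp only [map_mul, eval_X]; ring
      rw [this, map_add, map_mul, map_mul]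
      exact (Commute.all _ _).isNilpotent_add ((Commute.all _ _).isNilpotent_mul_right ha)
        ((Commute.all _ _).isNilpotent_mul_left (hX v))
  have : Ideal.Quotient.mk (powIdeal p e) s = Ideal.Quotient.mk (powIdeal p e) (C (eval p s)) +
      Ideal.Quotient.mk (powIdeal p e) (s - C (eval p s)) := by
    rw [← map_add]; congr 1; ring
  rw [this]
  exact (hnil s).isUnit_add_left_of_commute
    (((isUnit_iff_ne_zero.mpr hs).map C).map (Ideal.Quotient.mk (powIdeal p e))) (Commute.all _ _)

/-- The multiplicity at `p` of a scheme given locally by `(X v - p v) ^ e v = 0`. -/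
theorem finrank_localization_quotient {m : Ideal (MvPolynomial σ K)} [m.IsPrime] {p : σ → K}
    (hm : m = RingHom.ker (eval p)) {e : σ → ℕ} {I : Ideal (MvPolynomial σ K)}
    (hI : I.map (algebraMap _ (Localization.AtPrime m)) =
      (powIdeal p e).map (algebraMap _ (Localization.AtPrime m))) :
    Module.finrank K (Localization.AtPrime m ⧸ I.map (algebraMap _ (Localization.AtPrime m))) =
      ∏ v, e v := by
  rw [hI, ← finrank_quotient_powIdeal p e]
  set L := Localization.AtPrime m
  set J := (powIdeal p e).map (algebraMap (MvPolynomial σ K) L)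
  have hcompl : ∀ s : MvPolynomial σ K, s ∈ m.primeCompl ↔ eval p s ≠ 0 := by
    intro s
    rw [Ideal.mem_primeCompl_iff, hm, RingHom.mem_ker]
  let T : (MvPolynomial σ K ⧸ powIdeal p e) →ₐ[K] (L ⧸ J) :=
    Ideal.quotientMapₐ J (IsScalarTower.toAlgHom K (MvPolynomial σ K) L) Ideal.le_comap_map
  have hT : ∀ a, T (Ideal.Quotient.mk _ a) = Ideal.Quotient.mk J (algebraMap _ L a) := fun a => rfl
  refine (LinearEquiv.ofBijective T.toLinearMap ⟨?_, ?_⟩).finrank_eq.symm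
  · rw [← LinearMap.ker_eq_bot, LinearMap.ker_eq_bot']
    intro x hx
    obtain ⟨a, rfl⟩ := Ideal.Quotient.mk_surjective x
    have h1 : algebraMap _ L a ∈ J := Ideal.Quotient.eq_zero_iff_mem.mp hx
    rw [IsLocalization.algebraMap_mem_map_algebraMap_iff m.primeCompl] at h1
    obtain ⟨s, hs, hsa⟩ := h1
    have h2 := Ideal.Quotient.eq_zero_iff_mem.mpr hsa
    rw [map_mul] at h2
    exact (isUnit_mk_powIdeal p e ((hcompl s).mp hs)).mul_right_eq_zero.mp h2
  · intro y
    obtain ⟨y, rfl⟩ := Ideal.Quotient.mk_surjective y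
    obtain ⟨a, s, rfl⟩ := IsLocalization.exists_mk'_eq m.primeCompl y
    obtain ⟨t, ht⟩ := (isUnit_mk_powIdeal p e ((hcompl s).mp s.2)).exists_right_inv
    refine ⟨Ideal.Quotient.mk _ a * t, ?_⟩
    have hu : IsUnit (Ideal.Quotient.mk J (algebraMap _ L (s : MvPolynomial σ K))) :=
      (IsLocalization.map_units L s).map _
    apply hu.mul_left_cancel
    rw [← map_mul (Ideal.Quotient.mk J), mul_comm _ (IsLocalization.mk' L a s),
      IsLocalization.mk'_spec]
    change _ * T _ = _
    rw [← hT, ← hT, ← map_mul]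
    congr 1
    linear_combination (Ideal.Quotient.mk (powIdeal p e) a) * ht

theorem span_range_eq_of_associated {R ι : Type*} [CommRing R] {f g : ι → R}
    (h : ∀ v, Associated (f v) (g v)) :
    Ideal.span (Set.range f) = Ideal.span (Set.range g) := by
  apply le_antisymm <;> rw [Ideal.span_le] <;> rintro _ ⟨v, rfl⟩
  · exact Ideal.mem_of_dvd _ (h v).symm.dvd (Ideal.subset_span ⟨v, rfl⟩)
  · exact Ideal.mem_of_dvd _ (h v).dvd (Ideal.subset_span ⟨v, rfl⟩)

end LocalMultiplicity

/-! ### Normalised coordinates and fixed points of projective maps -/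

section Points

variable {K : Type*} [Field K] {N d : ℕ}

open Classical in
theorem rep_chart_ne_zero (P : ℙ K (Fin (N + 1) → K)) : P.rep (chart P) ≠ 0 :=
  (Finset.mem_filter.mp (Finset.max'_mem (Finset.univ.filter fun i => P.rep i ≠ 0) _)).2

open Classical in
theorem rep_eq_zero_of_chart_lt (P : ℙ K (Fin (N + 1) → K)) {v : Fin (N + 1)} (hv : chart P < v) :
    P.rep v = 0 := by
  by_contra hne
  exact absurd (Finset.le_max' (Finset.univ.filter fun i => P.rep i ≠ 0) v (by simpa using hne))
    (not_le.mpr hv)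

theorem chart_eq_of {P : ℙ K (Fin (N + 1) → K)} {b : Fin (N + 1)} (h1 : P.rep b ≠ 0)
    (h2 : ∀ v, b < v → P.rep v = 0) : chart P = b := by
  apply le_antisymm
  · by_contra! h
    exact rep_chart_ne_zero P (h2 _ h)
  · by_contra! h
    exact h1 (rep_eq_zero_of_chart_lt P h)

/-- The coordinates `x` are normalised with respect to the chart `b`. -/
def IsNormal (b : Fin (N + 1)) (x : Fin (N + 1) → K) : Prop := x b = 1 ∧ ∀ v, b < v → x v = 0

theorem IsNormal.ne_zero {b : Fin (N + 1)} {x : Fin (N + 1) → K} (h : IsNormal b x) : x ≠ 0 := by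
  rintro rfl
  exact zero_ne_one h.1

/-- The point with given normalised coordinates. -/
def IsNormal.point {b : Fin (N + 1)} {x : Fin (N + 1) → K} (h : IsNormal b x) :
    ℙ K (Fin (N + 1) → K) := Projectivization.mk K x h.ne_zero

theorem isNormal_coords (P : ℙ K (Fin (N + 1) → K)) : IsNormal (chart P) (coords P) := by
  refine ⟨?_, fun v hv => ?_⟩
  · simp [coords, rep_chart_ne_zero P]
  · simp [coords, rep_eq_zero_of_chart_lt P hv]

theorem point_coords (P : ℙ K (Fin (N + 1) → K)) : (isNormal_coords P).point = P := by
  conv_rhs => rw [← P.mk_rep]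
  rw [IsNormal.point, Projectivization.mk_eq_mk_iff']
  exact ⟨_, rfl⟩

theorem IsNormal.chart_point {b : Fin (N + 1)} {x : Fin (N + 1) → K} (h : IsNormal b x) :
    chart h.point = b := by
  obtain ⟨a, ha⟩ := Projectivization.exists_smul_eq_mk_rep K x h.ne_zero
  apply chart_eq_of
  · rw [IsNormal.point, ← ha]
    simp [Units.smul_def, h.1]
  · intro v hv
    rw [IsNormal.point, ← ha]
    simp [h.2 v hv]

theorem IsNormal.coords_point {b : Fin (N + 1)} {x : Fin (N + 1) → K} (h : IsNormal b x) :
    coords h.point = x := by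
  obtain ⟨a, ha⟩ := Projectivization.exists_smul_eq_mk_rep K x h.ne_zero
  have hrep : h.point.rep = a • x := ha.symm
  rw [coords, h.chart_point, hrep]
  ext v
  simp [Units.smul_def, h.1]

theorem IsNormal.point_eq_iff {b : Fin (N + 1)} {x : Fin (N + 1) → K} (h : IsNormal b x)
    {P : ℙ K (Fin (N + 1) → K)} : h.point = P ↔ chart P = b ∧ coords P = x := by
  constructor
  · rintro rfl
    exact ⟨h.chart_point, h.coords_point⟩
  · rintro ⟨rfl, rfl⟩
    exact point_coords P

theorem ProjEnd.lift_smul (f : ProjEnd K N d) (c : K) (x : Fin (N + 1) → K) :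
    f.lift (c • x) = c ^ d • f.lift x := by
  ext i
  simp only [ProjEnd.lift, Pi.smul_apply, smul_eq_mul, eval_eq', Finset.mul_sum]
  refine Finset.sum_congr rfl fun s hs => ?_
  have h1 : s.degree = d := by
    rw [Finsupp.degree_eq_weight_one (R := ℕ)]
    exact f.homogeneous i (mem_support_iff.mp hs)
  rw [Finsupp.degree_eq_sum] at h1
  simp only [mul_pow, Finset.prod_mul_distrib, Finset.prod_pow_eq_pow_sum, h1]
  ring

theorem ProjEnd.onProj_eq_iff (f : ProjEnd K N d) (P : ℙ K (Fin (N + 1) → K)) :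
    f.onProj P = P ↔ ∃ c : K, f.lift (coords P) = c • coords P := by
  have hr := rep_chart_ne_zero P
  have h1 : P.rep = P.rep (chart P) • coords P := by
    rw [coords, smul_smul, mul_inv_cancel₀ hr, one_smul]
  have h2 : f.onProj P = P ↔ ∃ c : K, c • P.rep = f.lift P.rep := by
    conv_lhs => rw [← P.mk_rep]
    rw [ProjEnd.onProj, Projectivization.mk_eq_mk_iff']
    simp only [P.mk_rep]
  rw [h2, h1, f.lift_smul]
  constructor
  · rintro ⟨c, hc⟩
    refine ⟨(P.rep (chart P) ^ d)⁻¹ * c * P.rep (chart P), ?_⟩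
    rw [mul_assoc, mul_smul, mul_smul, hc, smul_smul, inv_mul_cancel₀ (pow_ne_zero _ hr), one_smul]
  · rintro ⟨c, hc⟩
    refine ⟨P.rep (chart P) ^ d * c * (P.rep (chart P))⁻¹, ?_⟩
    rw [hc, smul_smul, smul_smul, inv_mul_cancel_right₀ hr]

/-- The multiplier matrix in the chart `b` at normalised coordinates `x`. -/
def ProjEnd.chartMatrix (f : ProjEnd K N d) (b : Fin (N + 1)) (x : Fin (N + 1) → K) :
    Matrix {v // v ≠ b} {v // v ≠ b} K := fun v w =>
  (eval x (pderiv (w : Fin (N + 1)) (f.poly v)) * eval x (f.poly b) -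
    eval x (pderiv (w : Fin (N + 1)) (f.poly b)) * eval x (f.poly v)) / eval x (f.poly b) ^ 2

theorem ProjEnd.multiplierPoly_eq (f : ProjEnd K N d) {P : ℙ K (Fin (N + 1) → K)}
    {b : Fin (N + 1)} {x : Fin (N + 1) → K} (hb : chart P = b) (hx : coords P = x) :
    f.multiplierPoly P = (f.chartMatrix b x).charpoly := by
  subst hb hx
  rfl

/-- The chart of `P` occurs in the type of its local ring. Allowing any prime `m` equal to the ideal
of the point lets the hypothesis be checked in a chart `b` known explicitly. -/
theorem ProjEnd.fixedMult_eq (f : ProjEnd K N d) {P : ℙ K (Fin (N + 1) → K)}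
    {b : Fin (N + 1)} {x : Fin (N + 1) → K} (hb : chart P = b) (hx : coords P = x)
    (e : {v // v ≠ b} → ℕ)
    (hI : ∀ (m : Ideal (MvPolynomial {v // v ≠ b} K)) [m.IsPrime],
      m = RingHom.ker (eval fun v : {v // v ≠ b} => x v) →
      (f.fixedIdeal b).map (algebraMap _ (Localization.AtPrime m)) =
        (powIdeal (fun v : {v // v ≠ b} => x v) e).map (algebraMap _ (Localization.AtPrime m))) :
    f.fixedMult P = ∏ v, e v := by
  subst hb hx
  have := pointIdeal_isPrime P
  exact finrank_localization_quotient (m := pointIdeal P) rfl (hI _ rfl)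

/-- Labels may repeat points: a fixed point of multiplicity `r` carries `r` labels, so the product
with multiplicities becomes a plain product over labels. -/
theorem ProjEnd.sigmaPoly_eq_prod (f : ProjEnd K N d) {L : Type*} [Fintype L]
    (pt : L → ℙ K (Fin (N + 1) → K)) (γ : L → Polynomial K)
    (hpt : ∀ P, f.onProj P = P ↔ ∃ l, pt l = P)
    (hγ : ∀ l, f.multiplierPoly (pt l) = γ l)
    (hm : ∀ l, f.fixedMult (pt l) = Nat.card {l' // pt l' = pt l}) :
    f.sigmaPoly = ∏ l, (Polynomial.X - Polynomial.C (γ l)) := by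
  classical
  have hset : Function.fixedPoints f.onProj = ↑(Finset.univ.image pt) := by
    ext P
    simpa [Function.IsFixedPt] using hpt P
  rw [ProjEnd.sigmaPoly, hset, finprod_mem_coe_finset]
  simp_rw [← hγ]
  rw [Finset.prod_comp (fun P => Polynomial.X - Polynomial.C (f.multiplierPoly P)) pt]
  refine Finset.prod_congr rfl fun P hP => ?_
  obtain ⟨l, -, rfl⟩ := Finset.mem_image.mp hP
  rw [hm, Nat.card_eq_fintype_card, Fintype.card_subtype]

end Points

/-! ### Derivatives and multipliers of split polynomial maps -/

section Split

variable {K : Type*} [Field K] {N d : ℕ}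

/-- `f` is the homogenisation of the split polynomial map with components `F`. -/
def ProjEnd.IsSplitBy (f : ProjEnd K N d) (F : Fin N → Polynomial K) : Prop :=
  (∀ i, (F i).natDegree = d) ∧
    (∀ i : Fin N, f.poly i.castSucc =
      ∑ k ∈ Finset.range (d + 1), C ((F i).coeff k) * X i.castSucc ^ k * X (Fin.last N) ^ (d - k)) ∧
    f.poly (Fin.last N) = X (Fin.last N) ^ d

variable {f : ProjEnd K N d} {F : Fin N → Polynomial K}

namespace ProjEnd.IsSplitBy

theorem coeff_ne_zero (hf : f.IsSplitBy F) (hd : 0 < d) (i : Fin N) : (F i).coeff d ≠ 0 := by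
  rw [← hf.1 i]
  intro h
  have : F i = 0 := Polynomial.leadingCoeff_eq_zero.mp h
  have h2 := hf.1 i
  rw [this, Polynomial.natDegree_zero] at h2
  omega

theorem eval_last (hf : f.IsSplitBy F) (x : Fin (N + 1) → K) :
    eval x (f.poly (Fin.last N)) = x (Fin.last N) ^ d := by
  rw [hf.2.2]; simp

theorem eval_castSucc (hf : f.IsSplitBy F) (x : Fin (N + 1) → K) (i : Fin N) :
    eval x (f.poly i.castSucc) =
      ∑ k ∈ Finset.range (d + 1), (F i).coeff k * x i.castSucc ^ k * x (Fin.last N) ^ (d - k) := by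
  rw [hf.2.1, map_sum]; simp

theorem eval_castSucc_of_one (hf : f.IsSplitBy F) {x : Fin (N + 1) → K}
    (hx : x (Fin.last N) = 1) (i : Fin N) :
    eval x (f.poly i.castSucc) = (F i).eval (x i.castSucc) := by
  rw [hf.eval_castSucc, Polynomial.eval_eq_sum_range, hf.1 i]
  simp [hx]

theorem sum_range_zero_pow {R : Type*} [CommSemiring R] (g : ℕ → R) (d : ℕ) :
    ∑ k ∈ Finset.range (d + 1), g k * 0 ^ (d - k) = g d := by
  rw [Finset.sum_range_succ, Finset.sum_eq_zero, zero_add, Nat.sub_self, pow_zero, mul_one]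
  intro k hk
  rw [Finset.mem_range] at hk
  rw [zero_pow (by omega), mul_zero]

theorem eval_castSucc_of_zero (hf : f.IsSplitBy F) {x : Fin (N + 1) → K}
    (hx : x (Fin.last N) = 0) (i : Fin N) :
    eval x (f.poly i.castSucc) = (F i).coeff d * x i.castSucc ^ d := by
  rw [hf.eval_castSucc, hx, sum_range_zero_pow fun k => (F i).coeff k * x i.castSucc ^ k]

theorem pderiv_last (hf : f.IsSplitBy F) (x : Fin (N + 1) → K) (w : Fin (N + 1)) :
    eval x (pderiv w (f.poly (Fin.last N))) =
      if w = Fin.last N then d * x (Fin.last N) ^ (d - 1) else 0 := by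
  rw [hf.2.2]
  split_ifs with h
  · subst h; simp
  · simp [pderiv_X_of_ne (Ne.symm h)]

theorem pderiv_castSucc_of_ne (hf : f.IsSplitBy F) (x : Fin (N + 1) → K) {i j : Fin N}
    (hij : i ≠ j) : eval x (pderiv j.castSucc (f.poly i.castSucc)) = 0 := by
  have h1 : i.castSucc ≠ j.castSucc := by simpa using hij
  rw [hf.2.1, map_sum, map_sum]
  refine Finset.sum_eq_zero fun k _ => ?_
  simp [Derivation.leibniz, pderiv_X_of_ne h1, pderiv_X_of_ne (Fin.castSucc_lt_last j).ne']

theorem pderiv_castSucc_self (hf : f.IsSplitBy F) (x : Fin (N + 1) → K) (i : Fin N) :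
    eval x (pderiv i.castSucc (f.poly i.castSucc)) =
      ∑ k ∈ Finset.range (d + 1), (F i).coeff k * (k * x i.castSucc ^ (k - 1)) *
        x (Fin.last N) ^ (d - k) := by
  rw [hf.2.1, map_sum, map_sum]
  refine Finset.sum_congr rfl fun k _ => ?_
  simp [Derivation.leibniz, pderiv_X_of_ne (Fin.castSucc_lt_last i).ne']
  ring

theorem pderiv_castSucc_of_one (hf : f.IsSplitBy F) {x : Fin (N + 1) → K}
    (hx : x (Fin.last N) = 1) (i : Fin N) :
    eval x (pderiv i.castSucc (f.poly i.castSucc)) = (F i).derivative.eval (x i.castSucc) := by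
  rw [hf.pderiv_castSucc_self, Polynomial.derivative_eval,
    Polynomial.sum_over_range' _ _ (d + 1) (by rw [hf.1 i]; omega)]
  · simp [hx, mul_assoc]
  · simp

theorem pderiv_castSucc_of_zero (hf : f.IsSplitBy F) {x : Fin (N + 1) → K}
    (hx : x (Fin.last N) = 0) (i : Fin N) :
    eval x (pderiv i.castSucc (f.poly i.castSucc)) =
      (F i).coeff d * (d * x i.castSucc ^ (d - 1)) := by
  rw [hf.pderiv_castSucc_self, hx,
    sum_range_zero_pow fun k => (F i).coeff k * (k * x i.castSucc ^ (k - 1))]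

/-- The multiplier polynomial at an affine point. -/
theorem charpoly_chartMatrix_last (hf : f.IsSplitBy F) {x : Fin (N + 1) → K}
    (hx : x (Fin.last N) = 1) :
    (f.chartMatrix (Fin.last N) x).charpoly =
      ∏ i : Fin N, (Polynomial.X - Polynomial.C ((F i).derivative.eval (x i.castSucc))) := by
  have hdiag : f.chartMatrix (Fin.last N) x = Matrix.diagonal fun v : {v // v ≠ Fin.last N} =>
      (F (v.1.castPred v.2)).derivative.eval (x v) := by
    ext v w
    obtain ⟨i, hi⟩ := Fin.exists_castSucc_eq.mpr v.2
    obtain ⟨j, hj⟩ := Fin.exists_castSucc_eq.mpr w.2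
    rw [ProjEnd.chartMatrix, hf.eval_last, hf.pderiv_last, if_neg w.2, hx, Matrix.diagonal_apply]
    split_ifs with hvw
    · subst hvw
      simp only [← hi, hf.pderiv_castSucc_of_one hx]
      simp
    · have hij : i ≠ j := by
        rintro rfl
        exact hvw (Subtype.ext (hi.symm.trans hj))
      rw [← hi, ← hj, hf.pderiv_castSucc_of_ne x hij]
      simp
  rw [hdiag, Matrix.charpoly_diagonal]
  refine (Fintype.prod_equiv (finSuccAboveEquiv (Fin.last N)) _ _ fun i => ?_).symm
  simp [finSuccAboveEquiv_apply]

/-- The multiplier polynomial at a point at infinity. -/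
theorem charpoly_chartMatrix_castSucc (hf : f.IsSplitBy F) (hd : 2 ≤ d) {x : Fin (N + 1) → K}
    (hx : x (Fin.last N) = 0) {b : Fin N} (hb : x b.castSucc = 1)
    (hfix : ∀ i : Fin N, (F i).coeff d * x i.castSucc ^ d = (F b).coeff d * x i.castSucc)
    {c : Fin (N + 1) → K} (hc0 : ∀ v, x v = 0 → c v = 0) (hc1 : ∀ v, x v ≠ 0 → c v = d) :
    (f.chartMatrix b.castSucc x).charpoly =
      ∏ v : {v // v ≠ b.castSucc}, (Polynomial.X - Polynomial.C (c v)) := by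
  have hab := hf.coeff_ne_zero (by omega) b
  have hfb : eval x (f.poly b.castSucc) = (F b).coeff d := by
    rw [hf.eval_castSucc_of_zero hx, hb]; simp
  -- Off the diagonal only the column of the homogenising coordinate can be nonzero, and that
  -- coordinate is last in the order.
  rw [Matrix.charpoly_of_isUpperTriangular]
  · refine Finset.prod_congr rfl fun v _ => ?_
    congr 2
    rw [ProjEnd.chartMatrix, hfb]
    rcases Fin.eq_castSucc_or_eq_last v.1 with ⟨i, hi⟩ | hl
    · have hib : b ≠ i := by rintro rfl; exact v.2 hi
      rw [hi, hf.pderiv_castSucc_of_zero hx, hf.pderiv_castSucc_of_ne x hib]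
      by_cases h0 : x i.castSucc = 0
      · rw [hc0 _ h0, h0, zero_pow (by omega)]; simp
      · have h1 : (F i).coeff d * x i.castSucc ^ (d - 1) = (F b).coeff d := by
          apply mul_right_cancel₀ h0
          rw [← hfix i, mul_assoc, ← pow_succ, Nat.sub_add_cancel (by omega)]
        rw [hc1 _ h0]
        field_simp
        linear_combination (d : K) * (F b).coeff d * h1
    · rw [hl, hc0 _ hx, hf.pderiv_last, if_pos rfl, hf.eval_last, hx, zero_pow (by omega), zero_pow (by omega)]
      simp
  · intro v w hvw
    change w.1 < v.1 at hvw
    rw [ProjEnd.chartMatrix]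
    obtain ⟨j, hj⟩ := Fin.exists_castSucc_eq.mpr (hvw.trans_le (Fin.le_last _)).ne
    have hjb : b ≠ j := by rintro rfl; exact w.2 hj.symm
    rw [← hj, hf.pderiv_castSucc_of_ne x hjb]
    rcases Fin.eq_castSucc_or_eq_last v.1 with ⟨i, hi⟩ | hl
    · have hij : i ≠ j := by rintro rfl; rw [hi, hj] at hvw; exact lt_irrefl _ hvw
      rw [hi, hf.pderiv_castSucc_of_ne x hij]
      simp
    · rw [hl, hf.pderiv_last, if_neg (Fin.castSucc_lt_last j).ne]
      simp

end ProjEnd.IsSplitBy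

end Split

/-! ### Multiplicities of the fixed points of split maps -/

section SplitIdeal

variable {K : Type*} [Field K] {N d : ℕ} {f : ProjEnd K N d} {F : Fin N → Polynomial K}

theorem isUnit_algebraMap_localization {σ : Type*} {x : σ → K} {m : Ideal (MvPolynomial σ K)}
    [m.IsPrime] (hm : m = RingHom.ker (eval x)) {s : MvPolynomial σ K} (hs : eval x s ≠ 0) :
    IsUnit (algebraMap (MvPolynomial σ K) (Localization.AtPrime m) s) := by
  refine IsLocalization.map_units (M := m.primeCompl) (Localization.AtPrime m) ⟨s, ?_⟩
  rwa [Ideal.mem_primeCompl_iff, hm, RingHom.mem_ker]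

/-- The two generating families are related by a triangular matrix with units on the diagonal, `l`
being the pivot whose multiples correct all other generators. -/
theorem span_range_eq_of_triangular {R ι : Type*} [CommRing R] (l : ι) {g t : ι → R}
    (hl : ∃ u, g l = t l * u ∧ IsUnit u)
    (h : ∀ v, v ≠ l → ∃ u w, g v = t v * u + t l * w ∧ IsUnit u) :
    Ideal.span (Set.range g) = Ideal.span (Set.range t) := by
  obtain ⟨ul, hul, hU⟩ := hl
  apply le_antisymm <;> rw [Ideal.span_le] <;> rintro _ ⟨v, rfl⟩
  · have htl : t l ∈ Ideal.span (Set.range t) := Ideal.subset_span ⟨l, rfl⟩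
    by_cases hv : v = l
    · rw [hv, hul]
      exact Ideal.mul_mem_right _ _ htl
    · obtain ⟨u, w, h1, -⟩ := h v hv
      rw [h1]
      exact Ideal.add_mem _ (Ideal.mul_mem_right _ _ (Ideal.subset_span ⟨v, rfl⟩))
        (Ideal.mul_mem_right _ _ htl)
  · have htl : t l ∈ Ideal.span (Set.range g) := by
      rw [← Ideal.mul_unit_mem_iff_mem _ hU, ← hul]
      exact Ideal.subset_span ⟨l, rfl⟩
    by_cases hv : v = l
    · rwa [hv]
    · obtain ⟨u, w, h1, h2⟩ := h v hv
      change t v ∈ Ideal.span (Set.range g)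
      rw [← Ideal.mul_unit_mem_iff_mem _ h2, eq_sub_of_add_eq h1.symm]
      exact Ideal.sub_mem _ (Ideal.subset_span ⟨v, rfl⟩) (Ideal.mul_mem_right _ _ htl)

namespace ProjEnd.IsSplitBy

theorem dehom_castSucc (hf : f.IsSplitBy F) (b : Fin (N + 1)) (i : Fin N) :
    dehom b (f.poly i.castSucc) = ∑ k ∈ Finset.range (d + 1), C ((F i).coeff k) *
      dehom b (X i.castSucc) ^ k * dehom b (X (Fin.last N)) ^ (d - k) := by
  rw [hf.2.1, map_sum]
  refine Finset.sum_congr rfl fun k _ => ?_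
  rw [map_mul, map_mul, map_pow, map_pow, ← algebraMap_eq, AlgHom.commutes, ← algebraMap_eq]

theorem dehom_X_self (b : Fin (N + 1)) : dehom b (X b : MvPolynomial (Fin (N + 1)) K) = 1 := by
  simp [dehom]

theorem dehom_X_of_ne {b v : Fin (N + 1)} (h : v ≠ b) :
    dehom b (X v : MvPolynomial (Fin (N + 1)) K) = X ⟨v, h⟩ := by
  simp [dehom, h]

theorem dehom_last (hf : f.IsSplitBy F) (b : Fin (N + 1)) :
    dehom b (f.poly (Fin.last N)) = dehom b (X (Fin.last N)) ^ d := by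
  rw [hf.2.2, map_pow]

theorem generator_last (hf : f.IsSplitBy F) {a : Fin N → K} {ρ : Fin N → Fin d → K}
    (hρ : ∀ i, F i = Polynomial.X + Polynomial.C (a i) * ∏ j, (Polynomial.X - Polynomial.C (ρ i j)))
    (v : {v : Fin (N + 1) // v ≠ Fin.last N}) :
    dehom (Fin.last N) (f.poly v) - X v * dehom (Fin.last N) (f.poly (Fin.last N)) =
      C (a (v.1.castPred v.2)) * ∏ j, (X v - C (ρ (v.1.castPred v.2) j)) := by
  obtain ⟨i, hi⟩ := Fin.exists_castSucc_eq.mpr v.2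
  have hv : v = ⟨i.castSucc, (Fin.castSucc_lt_last i).ne⟩ := Subtype.ext hi.symm
  subst hv
  rw [hf.dehom_castSucc, hf.dehom_last, dehom_X_self, dehom_X_of_ne (Fin.castSucc_lt_last i).ne]
  simp only [one_pow, mul_one, Fin.castPred_castSucc]
  have h1 : Polynomial.aeval (X ⟨i.castSucc, (Fin.castSucc_lt_last i).ne⟩ :
      MvPolynomial {v : Fin (N + 1) // v ≠ Fin.last N} K) (F i) =
      ∑ k ∈ Finset.range (d + 1), C ((F i).coeff k) *
        X ⟨i.castSucc, (Fin.castSucc_lt_last i).ne⟩ ^ k := by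
    rw [Polynomial.aeval_eq_sum_range, hf.1 i]
    exact Finset.sum_congr rfl fun k _ => by rw [smul_eq_C_mul]
  rw [← h1, hρ i]
  simp [map_prod, algebraMap_eq]

/-- The multiplicity of an affine fixed point. -/
theorem fixedMult_affine [DecidableEq K] (hf : f.IsSplitBy F) {a : Fin N → K}
    {ρ : Fin N → Fin d → K} (ha : ∀ i, a i ≠ 0)
    (hρ : ∀ i, F i = Polynomial.X + Polynomial.C (a i) * ∏ j, (Polynomial.X - Polynomial.C (ρ i j)))
    {P : ℙ K (Fin (N + 1) → K)} {x : Fin (N + 1) → K} (hb : chart P = Fin.last N)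
    (hx : coords P = x) :
    f.fixedMult P = ∏ i : Fin N, (Finset.univ.filter fun j => ρ i j = x i.castSucc).card := by
  rw [f.fixedMult_eq hb hx (fun v => (Finset.univ.filter fun j =>
    ρ (v.1.castPred v.2) j = x v).card)]
  · refine (Fintype.prod_equiv (finSuccAboveEquiv (Fin.last N)) _ _ fun i => ?_).symm
    simp [finSuccAboveEquiv_apply]
  · intro m _ hm
    rw [ProjEnd.fixedIdeal, powIdeal, Ideal.map_span, Ideal.map_span, ← Set.range_comp,
      ← Set.range_comp]
    refine span_range_eq_of_associated fun v => ?_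
    simp only [Function.comp]
    -- In the variable `X v`, the linear factors with root `x v` make up the power of `X v - C (x
    -- v)`; the other factors and the leading coefficient are units at the point.
    rw [hf.generator_last hρ, ← Finset.prod_filter_mul_prod_filter_not Finset.univ
      (fun j => ρ (v.1.castPred v.2) j = x v)]
    have h1 : ∏ j with ρ (v.1.castPred v.2) j = x v, (X v - C (ρ (v.1.castPred v.2) j)) =
        (X v - C (x v)) ^ (Finset.univ.filter fun j => ρ (v.1.castPred v.2) j = x v).card := by
      rw [← Finset.prod_const]
      exact Finset.prod_congr rfl fun j hj => by rw [(Finset.mem_filter.mp hj).2]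
    rw [h1, mul_left_comm, map_mul]
    refine associated_mul_unit_left _ _ (isUnit_algebraMap_localization hm ?_)
    rw [map_mul, eval_C, map_prod]
    refine mul_ne_zero (ha _) (Finset.prod_ne_zero_iff.mpr fun j hj => ?_)
    rw [map_sub, eval_X, eval_C]
    exact sub_ne_zero.mpr (Ne.symm (Finset.mem_filter.mp hj).2)

/-- The fixed points at infinity are simple. -/
theorem fixedMult_infinity [CharZero K] (hf : f.IsSplitBy F) (hd : 2 ≤ d) {b : Fin N}
    {P : ℙ K (Fin (N + 1) → K)} {x : Fin (N + 1) → K} (hP : chart P = b.castSucc)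
    (hxP : coords P = x) (hx : x (Fin.last N) = 0)
    (hfix : ∀ i : Fin N, (F i).coeff d * x i.castSucc ^ d = (F b).coeff d * x i.castSucc) :
    f.fixedMult P = 1 := by
  rw [f.fixedMult_eq hP hxP (fun _ => 1), Finset.prod_const_one]
  intro m _ hm
  set L := Localization.AtPrime m
  have hab := hf.coeff_ne_zero (by omega) b
  set l : {v // v ≠ b.castSucc} := ⟨Fin.last N, (Fin.castSucc_lt_last b).ne'⟩ with hl
  set G := dehom b.castSucc (f.poly b.castSucc) with hG
  have hdl : dehom b.castSucc (X (Fin.last N) : MvPolynomial (Fin (N + 1)) K) = X l :=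
    dehom_X_of_ne (Fin.castSucc_lt_last b).ne'
  -- Modulo the equation `X l` of the hyperplane at infinity only the top-degree term of each
  -- component survives.
  have hdvd : ∀ i : Fin N, (X l : MvPolynomial {v // v ≠ b.castSucc} K) ∣
      dehom b.castSucc (f.poly i.castSucc) -
        C ((F i).coeff d) * dehom b.castSucc (X i.castSucc) ^ d := by
    intro i
    rw [hf.dehom_castSucc, Finset.sum_range_succ, Nat.sub_self, pow_zero, mul_one, add_sub_cancel_right,
      hdl]
    refine Finset.dvd_sum fun k hk => ?_
    rw [Finset.mem_range] at hk
    exact (dvd_pow_self _ (by omega)).mul_left _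
  have hGdvd : X l ∣ G - C ((F b).coeff d) := by
    have := hdvd b
    rwa [dehom_X_self, one_pow, mul_one] at this
  have hgl : dehom b.castSucc (f.poly l) - X l * G = X l * (X l ^ (d - 1) - G) := by
    rw [hl, hf.dehom_last, hdl, mul_sub, ← pow_succ', Nat.sub_add_cancel (by omega)]
  have hul : IsUnit (algebraMap _ L (X l ^ (d - 1) - G)) := by
    refine isUnit_algebraMap_localization hm ?_
    obtain ⟨W, hW⟩ := hGdvd
    rw [sub_eq_iff_eq_add.mp hW]
    simp [hl, hx, zero_pow (show d - 1 ≠ 0 by omega), hab]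
  have hv : ∀ i : Fin N, ∀ hi : i.castSucc ≠ b.castSucc, ∃ U W,
      dehom b.castSucc (f.poly i.castSucc) - X ⟨i.castSucc, hi⟩ * G =
        (X ⟨i.castSucc, hi⟩ - C (x i.castSucc)) * U + X l * W ∧ IsUnit (algebraMap _ L U) := by
    intro i hi
    -- The generator in direction `i` reduces at infinity to `q`, whose derivative at `x i.castSucc`
    -- is `-(F b).coeff d` or `(d - 1) * (F b).coeff d`. The root is simple, so the cofactor `U` is
    -- a unit at the point.
    set q : Polynomial K := Polynomial.C ((F i).coeff d) * Polynomial.X ^ d -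
      Polynomial.C ((F b).coeff d) * Polynomial.X with hq
    have hroot : q.IsRoot (x i.castSucc) := by
      simp [hq, hfix i]
    obtain ⟨U, hU⟩ := Polynomial.dvd_iff_isRoot.mpr hroot
    have hUx : U.eval (x i.castSucc) ≠ 0 := by
      have h1 : q.derivative.eval (x i.castSucc) = U.eval (x i.castSucc) := by
        rw [hU]; simp
      rw [← h1, hq]
      simp only [Polynomial.derivative_sub, Polynomial.derivative_mul, Polynomial.derivative_C,
        zero_mul, zero_add, Polynomial.derivative_X_pow, Polynomial.derivative_X, mul_one,
        Polynomial.eval_sub, Polynomial.eval_mul, Polynomial.eval_C, Polynomial.eval_pow,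
        Polynomial.eval_X]
      by_cases h0 : x i.castSucc = 0
      · simp [h0, zero_pow (show d - 1 ≠ 0 by omega), hab]
      · have h2 : (F i).coeff d * x i.castSucc ^ (d - 1) = (F b).coeff d := by
          apply mul_right_cancel₀ h0
          rw [← hfix i, mul_assoc, ← pow_succ, Nat.sub_add_cancel (by omega)]
        have h3 : (F i).coeff d * ((d : K) * x i.castSucc ^ (d - 1)) - (F b).coeff d =
            ((d : K) - 1) * (F b).coeff d := by
          linear_combination (d : K) * h2
        rw [h3]
        refine mul_ne_zero (sub_ne_zero.mpr ?_) hab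
        exact_mod_cast (show d ≠ 1 by omega)
    obtain ⟨W1, hW1⟩ := hdvd i
    obtain ⟨W2, hW2⟩ := hGdvd
    refine ⟨Polynomial.aeval (X ⟨i.castSucc, hi⟩) U, W1 - X ⟨i.castSucc, hi⟩ * W2, ?_, ?_⟩
    · have h1 := congrArg (Polynomial.aeval (X ⟨i.castSucc, hi⟩ :
        MvPolynomial {v // v ≠ b.castSucc} K)) hU
      rw [hq] at h1
      simp only [map_sub, map_mul, map_pow, Polynomial.aeval_X, Polynomial.aeval_C,
        algebraMap_eq] at h1
      rw [dehom_X_of_ne hi] at hW1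
      linear_combination hW1 - X ⟨i.castSucc, hi⟩ * hW2 + h1
    · refine isUnit_algebraMap_localization hm ?_
      have : eval (fun v : {v // v ≠ b.castSucc} => x v) (Polynomial.aeval (X ⟨i.castSucc, hi⟩) U) =
          U.eval (x i.castSucc) := by
        have h2 := Polynomial.aeval_algHom_apply
          (aeval (R := K) fun v : {v // v ≠ b.castSucc} => x v) (X ⟨i.castSucc, hi⟩) U
        rw [aeval_X] at h2
        exact h2.symm
      rwa [this]
  have hcase : ∀ v : {v // v ≠ b.castSucc}, v = l ∨ ∃ i : Fin N, ∃ hi : i.castSucc ≠ b.castSucc,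
      v = ⟨i.castSucc, hi⟩ := by
    rintro ⟨v, hv⟩
    rcases Fin.eq_castSucc_or_eq_last v with ⟨i, rfl⟩ | rfl
    · exact Or.inr ⟨i, hv, rfl⟩
    · exact Or.inl rfl
  rw [ProjEnd.fixedIdeal, powIdeal, Ideal.map_span, Ideal.map_span, ← Set.range_comp,
    ← Set.range_comp]
  simp only [Function.comp_def, pow_one]
  refine span_range_eq_of_triangular l ⟨algebraMap _ L (X l ^ (d - 1) - G), ?_, hul⟩ fun v hvl => ?_
  · rw [← map_mul, hgl, show x l.1 = 0 from hx, C_0, sub_zero]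
  · obtain ⟨i, hi, rfl⟩ := (hcase v).resolve_left hvl
    obtain ⟨U, W, h, hU⟩ := hv i hi
    refine ⟨algebraMap _ L U, algebraMap _ L W, ?_, hU⟩
    rw [← map_mul, ← map_mul, ← map_add, h, show x l.1 = 0 from hx, C_0, sub_zero]

end ProjEnd.IsSplitBy

end SplitIdeal

/-! ### The product over all fixed points, affine and at infinity -/

section Sigma

variable {K : Type*} [Field K] {N d : ℕ} {f : ProjEnd K N d} {F : Fin N → Polynomial K}

/-- A labelling of the solutions of `a x ^ d = c x`, with `0` labelled by `0`. -/
theorem exists_root_labelling [CharZero K] [IsAlgClosed K] (hd : 2 ≤ d) {a c : K} (ha : a ≠ 0)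
    (hc : c ≠ 0) : ∃ r : Fin d → K, Function.Injective r ∧ (∀ k, r k = 0 ↔ (k : ℕ) = 0) ∧
      ∀ x, a * x ^ d = c * x ↔ ∃ k, r k = x := by
  obtain ⟨m, rfl⟩ := Nat.exists_eq_add_of_le' hd
  obtain ⟨ζ, hζ⟩ := HasEnoughRootsOfUnity.exists_primitiveRoot K (m + 1)
  obtain ⟨μ, hμ⟩ := IsAlgClosed.exists_pow_nat_eq (c / a) (Nat.succ_pos m)
  have hμ0 : μ ≠ 0 := by
    rintro rfl
    rw [zero_pow (Nat.succ_ne_zero m)] at hμ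
    exact div_ne_zero hc ha hμ.symm
  have hζ0 : ζ ≠ 0 := hζ.ne_zero (Nat.succ_ne_zero m)
  -- Here `d - 1 = m + 1`: label `0` is the zero solution, and the exponents `1, …, m + 1` run once
  -- through the `m + 1` nonzero solutions.
  refine ⟨fun k => if (k : ℕ) = 0 then 0 else μ * ζ ^ (k : ℕ), ?_, ?_, ?_⟩
  · intro i j hij
    simp only at hij
    split_ifs at hij with h1 h2 h2
    · exact Fin.ext (h1.trans h2.symm)
    · exact absurd hij.symm (mul_ne_zero hμ0 (pow_ne_zero _ hζ0))
    · exact absurd hij (mul_ne_zero hμ0 (pow_ne_zero _ hζ0))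
    · have h3 := mul_left_cancel₀ hμ0 hij
      have h4 : ζ ^ ((i : ℕ) - 1) = ζ ^ ((j : ℕ) - 1) := by
        apply mul_right_cancel₀ hζ0
        rw [← pow_succ, ← pow_succ, Nat.sub_add_cancel (by omega), Nat.sub_add_cancel (by omega), h3]
      have := hζ.pow_inj (by omega) (by omega) h4
      exact Fin.ext (by omega)
  · intro k
    simp only
    split_ifs with h
    · simp [h]
    · simp [h, hμ0, hζ0]
  · intro x
    constructor
    · intro hx
      by_cases h0 : x = 0
      · exact ⟨0, by simp [h0]⟩
      · have h1 : x ^ (m + 1) = c / a := by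
          rw [eq_div_iff ha]
          apply mul_right_cancel₀ h0
          rw [← hx]; ring
        have h2 : (x / (μ * ζ)) ^ (m + 1) = 1 := by
          rw [div_pow, mul_pow, h1, hμ, hζ.pow_eq_one, mul_one, div_self (div_ne_zero hc ha)]
        obtain ⟨i, hi, hi2⟩ := hζ.eq_pow_of_pow_eq_one h2
        refine ⟨⟨i + 1, by omega⟩, ?_⟩
        simp only [Nat.succ_ne_zero, if_false]
        rw [pow_succ, hi2]
        field_simp
    · rintro ⟨k, rfl⟩
      simp only
      split_ifs with h
      · simp
      · have h1 : (μ * ζ ^ (k : ℕ)) ^ (m + 1) = c / a := by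
          rw [mul_pow, hμ, ← pow_mul, mul_comm (k : ℕ), pow_mul, hζ.pow_eq_one, one_pow, mul_one]
        rw [pow_succ _ (m + 1), h1]
        field_simp

variable (K N d) in
/-- The labels of the fixed points at infinity. -/
abbrev InfLabel (N d : ℕ) : Type := (b : Fin N) × (Fin b → Fin d)

/-- The multiplier in the direction `v` of the fixed point at infinity with label `l`. -/
def infMult (K : Type*) [Field K] (l : InfLabel N d) (v : Fin (N + 1)) : K :=
  if h : (v : ℕ) < l.1 then (if (l.2 ⟨v, h⟩ : ℕ) = 0 then 0 else d)
  else if (v : ℕ) = l.1 then d else 0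

/-- The multiplier polynomial of the fixed point at infinity with label `l`. -/
def infPoly (K : Type*) [Field K] (l : InfLabel N d) : Polynomial K :=
  ∏ v : {v // v ≠ l.1.castSucc}, (Polynomial.X - Polynomial.C (infMult K l v))

/-- The multiplier polynomial of the affine fixed point with label `s`. -/
def affPoly (F : Fin N → Polynomial K) (ρ : Fin N → Fin d → K) (s : Fin N → Fin d) :
    Polynomial K :=
  ∏ i, (Polynomial.X - Polynomial.C ((F i).derivative.eval (ρ i (s i))))

/-- The coordinates of a point at infinity. -/
def infCoords (r : Fin N → Fin N → Fin d → K) (l : InfLabel N d) (v : Fin (N + 1)) : K :=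
  if h : (v : ℕ) < l.1 then r l.1 ⟨v, h.trans l.1.2⟩ (l.2 ⟨v, h⟩)
  else if (v : ℕ) = l.1 then 1 else 0

theorem isNormal_snoc (y : Fin N → K) :
    IsNormal (Fin.last N) (Fin.snoc (α := fun _ => K) y 1) :=
  ⟨by simp, fun v hv => absurd hv (not_lt.mpr (Fin.le_last v))⟩

theorem isNormal_infCoords (r : Fin N → Fin N → Fin d → K) (l : InfLabel N d) :
    IsNormal l.1.castSucc (infCoords r l) := by
  refine ⟨by simp [infCoords], fun v hv => ?_⟩
  have : (l.1 : ℕ) < v := hv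
  rw [infCoords, dif_neg (by omega), if_neg (by omega)]

namespace ProjEnd.IsSplitBy

/-- The product formula for `Σ₁` of a split polynomial endomorphism. -/
theorem sigmaPoly_eq [CharZero K] [IsAlgClosed K] (hf : f.IsSplitBy F) (hd : 2 ≤ d)
    {a : Fin N → K} {ρ : Fin N → Fin d → K} (ha : ∀ i, a i ≠ 0)
    (hρ : ∀ i, F i = Polynomial.X + Polynomial.C (a i) * ∏ j, (Polynomial.X - Polynomial.C (ρ i j))) :
    f.sigmaPoly = (∏ s : Fin N → Fin d, (Polynomial.X - Polynomial.C (affPoly F ρ s))) *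
      ∏ l : InfLabel N d, (Polynomial.X - Polynomial.C (infPoly K l)) := by
  classical
  have hco := hf.coeff_ne_zero (by omega)
  -- `r b v` lists the possible `v`-th coordinates of a fixed point at infinity normalised by `x_b =
  -- 1`, where fixedness reads `a_v x^d = a_b x`. Coordinates before `b` are chosen independently
  -- and those after `b` vanish.
  choose r hrinj hr0 hr using fun b v : Fin N => exists_root_labelling hd (hco v) (hco b)
  have hfixρ : ∀ i (z : K), (F i).eval z = z ↔ ∃ j, ρ i j = z := by
    intro i z
    rw [hρ i]
    rw [Polynomial.eval_add, Polynomial.eval_X, add_eq_left, Polynomial.eval_mul,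
      Polynomial.eval_C, Polynomial.eval_prod, mul_eq_zero, Finset.prod_eq_zero_iff]
    simp [ha i, sub_eq_zero, eq_comm]
  set pt : (Fin N → Fin d) ⊕ InfLabel N d → ℙ K (Fin (N + 1) → K) :=
    Sum.elim (fun s => (isNormal_snoc fun i => ρ i (s i)).point)
      (fun l => (isNormal_infCoords r l).point) with hpt
  have hinfl : ∀ l : InfLabel N d, infCoords r l (Fin.last N) = 0 := fun l =>
    (isNormal_infCoords r l).2 _ (Fin.castSucc_lt_last _)
  have hinfb : ∀ l : InfLabel N d, infCoords r l l.1.castSucc = 1 := fun l =>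
    (isNormal_infCoords r l).1
  have hinffix : ∀ (l : InfLabel N d) (i : Fin N), (F i).coeff d * infCoords r l i.castSucc ^ d =
      (F l.1).coeff d * infCoords r l i.castSucc := by
    intro l i
    rw [infCoords]
    split_ifs with h1 h2
    · exact (hr _ _ _).mpr ⟨_, rfl⟩
    · have : i = l.1 := Fin.ext h2
      simp [this]
    · simp [show d ≠ 0 by omega]
  have hinf0 : ∀ (l : InfLabel N d) v, infCoords r l v = 0 → infMult K l v = 0 := by
    intro l v
    rw [infCoords, infMult]
    split_ifs with h1 h2 h2
    · simp
    · intro h; exact absurd ((hr0 _ _ _).mp h) h2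
    · simp
    · simp
  have hinf1 : ∀ (l : InfLabel N d) v, infCoords r l v ≠ 0 → infMult K l v = d := by
    intro l v
    rw [infCoords, infMult]
    split_ifs with h1 h2 h2
    · intro h; exact absurd ((hr0 _ _ _).mpr h2) h
    · simp
    · simp
    · simp
  have key := f.sigmaPoly_eq_prod pt
    (Sum.elim (fun s => affPoly F ρ s) (fun l => infPoly K l)) ?_ ?_ ?_
  · rw [key, Fintype.prod_sum_type]
    rfl
  · intro P
    rw [f.onProj_eq_iff]
    have hn := isNormal_coords P
    constructor
    · rintro ⟨c, hc⟩
      rcases Fin.eq_castSucc_or_eq_last (chart P) with ⟨b, hb⟩ | hb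
      · rw [hb] at hn
        have hl : coords P (Fin.last N) = 0 := hn.2 _ (Fin.castSucc_lt_last b)
        have hci : ∀ i : Fin N, (F i).coeff d * coords P i.castSucc ^ d = c * coords P i.castSucc :=
          fun i => by
            rw [← hf.eval_castSucc_of_zero hl]
            exact congrFun hc i.castSucc
        have hcb : (F b).coeff d = c := by
          have := hci b
          rwa [hn.1, one_pow, mul_one, mul_one] at this
        subst hcb
        choose s hs using fun i => (hr b i _).mp (hci i)
        refine ⟨Sum.inr ⟨b, fun v => s ⟨v, v.2.trans b.2⟩⟩, ?_⟩
        refine (isNormal_infCoords _ _).point_eq_iff.mpr ⟨hb, ?_⟩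
        ext v
        rw [infCoords]
        split_ifs with h1 h2
        · exact (hs ⟨v, h1.trans b.2⟩).symm
        · have : v = b.castSucc := Fin.ext h2
          rw [this, hn.1]
        · refine hn.2 v ?_
          simp only at h1 h2
          change (b : ℕ) < v
          omega
      · rw [hb] at hn
        have hc1 : c = 1 := by
          have := congrFun hc (Fin.last N)
          rw [ProjEnd.lift, hf.eval_last, Pi.smul_apply, hn.1, one_pow, smul_eq_mul, mul_one] at this
          exact this.symm
        subst hc1
        have hci : ∀ i : Fin N, (F i).eval (coords P i.castSucc) = coords P i.castSucc := fun i => by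
          rw [← hf.eval_castSucc_of_one hn.1]
          simpa [ProjEnd.lift] using congrFun hc i.castSucc
        choose s hs using fun i => (hfixρ i _).mp (hci i)
        refine ⟨Sum.inl s, (isNormal_snoc _).point_eq_iff.mpr ⟨hb, ?_⟩⟩
        ext v
        induction v using Fin.lastCases with
        | last => simp [hn.1]
        | cast i => simp [hs i]
    · rintro ⟨s | l, rfl⟩
      · refine ⟨1, ?_⟩
        simp only [hpt, Sum.elim_inl, (isNormal_snoc _).coords_point, one_smul]
        ext v
        induction v using Fin.lastCases with
        | last => simp [ProjEnd.lift, hf.eval_last]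
        | cast i =>
          rw [ProjEnd.lift, hf.eval_castSucc_of_one (by simp)]
          simpa using (hfixρ i _).mpr ⟨_, rfl⟩
      · refine ⟨(F l.1).coeff d, ?_⟩
        simp only [hpt, Sum.elim_inr, (isNormal_infCoords _ _).coords_point]
        ext v
        induction v using Fin.lastCases with
        | last => simp [ProjEnd.lift, hf.eval_last, hinfl, show d ≠ 0 by omega]
        | cast i =>
          rw [ProjEnd.lift, hf.eval_castSucc_of_zero (hinfl l), hinffix]
          rfl
  · rintro (s | l)
    · simp only [hpt, Sum.elim_inl]
      rw [f.multiplierPoly_eq (isNormal_snoc _).chart_point (isNormal_snoc _).coords_point,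
        hf.charpoly_chartMatrix_last (by simp)]
      simp [affPoly]
    · simp only [hpt, Sum.elim_inr]
      rw [f.multiplierPoly_eq (isNormal_infCoords _ _).chart_point
        (isNormal_infCoords _ _).coords_point,
        hf.charpoly_chartMatrix_castSucc hd (hinfl l) (hinfb l) (hinffix l) (hinf0 l) (hinf1 l)]
      rfl
  · rintro (s | l)
    · simp only [hpt, Sum.elim_inl]
      rw [hf.fixedMult_affine ha hρ (isNormal_snoc _).chart_point (isNormal_snoc _).coords_point]
      -- Two affine labels give the same point exactly when they agree in every coordinate, so the
      -- number of labels is the product of the root multiplicities.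
      have e : {l' // pt l' = (isNormal_snoc fun i => ρ i (s i)).point} ≃
          (∀ i, {j // ρ i j = ρ i (s i)}) :=
        { toFun := fun l' i => match l' with
            | ⟨Sum.inl s', h⟩ => ⟨s' i, by
                have := ((isNormal_snoc _).point_eq_iff.mp h).2
                rw [(isNormal_snoc _).coords_point] at this
                simpa using (congrFun this i.castSucc).symm⟩
            | ⟨Sum.inr l, h⟩ => by
                have := ((isNormal_infCoords _ _).point_eq_iff.mp h).1
                rw [(isNormal_snoc _).chart_point] at this
                exact absurd this (Fin.castSucc_lt_last _).ne'
          invFun := fun s' => ⟨Sum.inl fun i => s' i, by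
            refine (isNormal_snoc _).point_eq_iff.mpr
              ⟨(isNormal_snoc _).chart_point, ?_⟩
            rw [(isNormal_snoc _).coords_point]
            congr 1
            ext i
            exact (s' i).2.symm⟩
          left_inv := by
            rintro ⟨s' | l, h⟩
            · rfl
            · have := ((isNormal_infCoords _ _).point_eq_iff.mp h).1
              rw [(isNormal_snoc _).chart_point] at this
              exact absurd this (Fin.castSucc_lt_last _).ne'
          right_inv := fun s' => rfl }
      rw [Nat.card_congr e, Nat.card_pi]
      refine Finset.prod_congr rfl fun i _ => ?_
      rw [Nat.card_eq_fintype_card, Fintype.card_subtype]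
      simp
    · simp only [hpt, Sum.elim_inr]
      rw [hf.fixedMult_infinity hd (isNormal_infCoords _ _).chart_point
        (isNormal_infCoords _ _).coords_point (hinfl l) (hinffix l), eq_comm,
        Nat.card_eq_one_iff_unique]
      refine ⟨⟨?_⟩, ⟨⟨Sum.inr l, rfl⟩⟩⟩
      have huniq : ∀ l', pt l' = (isNormal_infCoords r l).point → l' = Sum.inr l := by
        rintro (s | l') h
        · have := ((isNormal_snoc _).point_eq_iff.mp h).1
          rw [(isNormal_infCoords _ _).chart_point] at this
          exact absurd this (Fin.castSucc_lt_last _).ne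
        · obtain ⟨h1, h2⟩ := (isNormal_infCoords _ _).point_eq_iff.mp h
          rw [(isNormal_infCoords _ _).chart_point] at h1
          rw [(isNormal_infCoords _ _).coords_point] at h2
          obtain ⟨b, s⟩ := l
          obtain ⟨b', s'⟩ := l'
          have h1' : b = b' := Fin.castSucc_injective _ h1
          subst h1'
          congr
          ext v : 1
          have h3 := congrFun h2 ⟨v, v.2.trans (b.2.trans (Nat.lt_succ_self N))⟩
          rw [infCoords, infCoords, dif_pos v.2, dif_pos v.2] at h3
          exact (hrinj _ _ h3).symm
      rintro ⟨l1, h1⟩ ⟨l2, h2⟩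
      exact Subtype.ext ((huniq _ h1).trans (huniq _ h2).symm)

end ProjEnd.IsSplitBy

end Sigma

/-! ### Split maps parametrised by leading coefficients and fixed points -/

section Rooted

variable {N d : ℕ}

/-- The polynomial with leading coefficient `a` and fixed points `ρ`. -/
def rootedPoly {R : Type*} [CommRing R] (a : R) (ρ : Fin d → R) : Polynomial R :=
  Polynomial.X + Polynomial.C a * ∏ j, (Polynomial.X - Polynomial.C (ρ j))

/-- The multiplier of `rootedPoly a ρ` at `ρ j`. -/
def rootMult {R : Type*} [CommRing R] (a : R) (ρ : Fin d → R) (j : Fin d) : R :=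
  1 + a * ∏ k ∈ Finset.univ.erase j, (ρ j - ρ k)

theorem eval_rootedPoly {R : Type*} [CommRing R] (a : R) (ρ : Fin d → R) (z : R) :
    (rootedPoly a ρ).eval z = z + a * ∏ j, (z - ρ j) := by
  simp [rootedPoly, Polynomial.eval_prod]

theorem eval_derivative_rootedPoly {R : Type*} [CommRing R] (a : R) (ρ : Fin d → R) (j : Fin d) :
    (rootedPoly a ρ).derivative.eval (ρ j) = rootMult a ρ j := by
  have : rootedPoly a ρ = Polynomial.X + Polynomial.C a * ((Polynomial.X - Polynomial.C (ρ j)) *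
      ∏ k ∈ Finset.univ.erase j, (Polynomial.X - Polynomial.C (ρ k))) := by
    rw [Finset.mul_prod_erase _ (fun k => Polynomial.X - Polynomial.C (ρ k)) (Finset.mem_univ j)]
    rfl
  rw [this]
  simp [rootMult, Polynomial.eval_prod]

variable {K : Type*} [Field K]

theorem natDegree_rootedPoly (hd : 2 ≤ d) {a : K} (ha : a ≠ 0) (ρ : Fin d → K) :
    (rootedPoly a ρ).natDegree = d := by
  have h1 : (Polynomial.C a * ∏ j, (Polynomial.X - Polynomial.C (ρ j))).natDegree = d := by
    rw [Polynomial.natDegree_C_mul ha,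
      Polynomial.natDegree_prod_of_monic _ _ fun u _ => Polynomial.monic_X_sub_C _]
    simp
  rw [rootedPoly, Polynomial.natDegree_add_eq_right_of_natDegree_lt, h1]
  rw [h1, Polynomial.natDegree_X]
  omega

theorem coeff_rootedPoly (hd : 2 ≤ d) (a : K) (ρ : Fin d → K) :
    (rootedPoly a ρ).coeff d = a := by
  have h1 : (∏ j, (Polynomial.X - Polynomial.C (ρ j))).natDegree = d := by
    rw [Polynomial.natDegree_prod_of_monic _ _ fun u _ => Polynomial.monic_X_sub_C _]
    simp
  have h2 : (∏ j, (Polynomial.X - Polynomial.C (ρ j))).coeff d = 1 := by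
    have := Polynomial.monic_prod_of_monic Finset.univ
      (fun j => Polynomial.X - Polynomial.C (ρ j)) fun j _ => Polynomial.monic_X_sub_C _
    rw [Polynomial.Monic, Polynomial.leadingCoeff, h1] at this
    exact this
  rw [rootedPoly, Polynomial.coeff_add, Polynomial.coeff_C_mul, h2,
    Polynomial.coeff_X_of_ne_one (by omega), zero_add, mul_one]

theorem exists_rootedPoly [IsAlgClosed K] (hd : 2 ≤ d) {F : Polynomial K} (hF : F.natDegree = d) :
    ∃ a ρ, a ≠ 0 ∧ F = rootedPoly (d := d) a ρ := by
  set p := F - Polynomial.X with hp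
  have hdeg : p.natDegree = d := by
    rw [hp, Polynomial.natDegree_sub_eq_left_of_natDegree_lt, hF]
    rw [hF, Polynomial.natDegree_X]; omega
  have hsplit := IsAlgClosed.splits p
  have hcard : Multiset.card p.roots = d := by
    rw [← hdeg]; exact hsplit.natDegree_eq_card_roots.symm
  obtain ⟨l, hl⟩ := Quot.exists_rep p.roots
  have hlen : l.length = d := by
    rw [← hcard, ← hl]; rfl
  subst hlen
  refine ⟨p.leadingCoeff, l.get, ?_, ?_⟩
  · intro h
    rw [Polynomial.leadingCoeff_eq_zero] at h
    rw [h, Polynomial.natDegree_zero] at hdeg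
    omega
  · have h1 := hsplit.eq_prod_roots
    have h2 : (p.roots.map fun a => Polynomial.X - Polynomial.C a).prod =
        ∏ j, (Polynomial.X - Polynomial.C (l.get j)) := by
      rw [← hl]
      change (Multiset.map _ (l : Multiset K)).prod = _
      rw [Multiset.map_coe, Multiset.prod_coe, ← List.prod_ofFn]
      congr 1
      exact (List.ofFn_getElem_eq_map l _).symm
    rw [rootedPoly, ← h2, ← h1, hp]
    ring

/-- `f` is the homogenisation of the split map with components `rootedPoly (a i) (ρ i)`. -/
abbrev ProjEnd.IsRooted (f : ProjEnd K N d) (a : Fin N → K) (ρ : Fin N → Fin d → K) : Prop :=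
  f.IsSplitBy fun i => rootedPoly (a i) (ρ i)

theorem ProjEnd.IsRooted.lift_castSucc {f : ProjEnd K N d} {a : Fin N → K} {ρ : Fin N → Fin d → K}
    (hf : f.IsRooted a ρ) (hd : 2 ≤ d) (x : Fin (N + 1) → K) (i : Fin N) :
    f.lift x i.castSucc = x i.castSucc * x (Fin.last N) ^ (d - 1) +
      a i * ∏ j, (x i.castSucc - ρ i j * x (Fin.last N)) := by
  rw [ProjEnd.lift]
  by_cases ht : x (Fin.last N) = 0
  · rw [hf.eval_castSucc_of_zero ht, coeff_rootedPoly hd, ht, zero_pow (by omega)]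
    simp
  · have h1 : eval x (f.poly i.castSucc) = x (Fin.last N) ^ d *
        (rootedPoly (a i) (ρ i)).eval (x i.castSucc / x (Fin.last N)) := by
      rw [hf.eval_castSucc, Polynomial.eval_eq_sum_range, hf.1 i, Finset.mul_sum]
      refine Finset.sum_congr rfl fun k hk => ?_
      have hk' : k ≤ d := Nat.lt_succ_iff.mp (Finset.mem_range.mp hk)
      have h2 : x (Fin.last N) ^ d = x (Fin.last N) ^ (d - k) * x (Fin.last N) ^ k := by
        rw [← pow_add, Nat.sub_add_cancel hk']
      rw [h2, div_pow]
      field_simp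
    have h3 : ∏ j, (x i.castSucc - ρ i j * x (Fin.last N)) =
        x (Fin.last N) ^ d * ∏ j, (x i.castSucc / x (Fin.last N) - ρ i j) := by
      have : x (Fin.last N) ^ d = ∏ _j : Fin d, x (Fin.last N) := by simp
      rw [this, ← Finset.prod_mul_distrib]
      refine Finset.prod_congr rfl fun j _ => ?_
      field_simp
    have h4 : x (Fin.last N) ^ d = x (Fin.last N) ^ (d - 1) * x (Fin.last N) := by
      rw [← pow_succ, Nat.sub_add_cancel (by omega)]
    rw [h1, eval_rootedPoly, h3, mul_add]
    congr 1
    · rw [h4]; field_simp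
    · ring

theorem ProjEnd.IsRooted.lift_last {f : ProjEnd K N d} {a : Fin N → K} {ρ : Fin N → Fin d → K}
    (hf : f.IsRooted a ρ) (x : Fin (N + 1) → K) :
    f.lift x (Fin.last N) = x (Fin.last N) ^ d := hf.eval_last x

theorem exists_isRooted (hd : 2 ≤ d) {a : Fin N → K} (ha : ∀ i, a i ≠ 0)
    (ρ : Fin N → Fin d → K) : ∃ f : ProjEnd K N d, f.IsRooted a ρ := by
  set F := fun i => rootedPoly (a i) (ρ i)
  let p : Fin (N + 1) → MvPolynomial (Fin (N + 1)) K :=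
    Fin.snoc (α := fun _ => MvPolynomial (Fin (N + 1)) K) (fun i : Fin N =>
      ∑ k ∈ Finset.range (d + 1), C ((F i).coeff k) * X i.castSucc ^ k * X (Fin.last N) ^ (d - k))
      (X (Fin.last N) ^ d)
  have hlast : p (Fin.last N) = X (Fin.last N) ^ d := by simp [p]
  have hcast : ∀ i : Fin N, p i.castSucc = ∑ k ∈ Finset.range (d + 1),
      C ((F i).coeff k) * X i.castSucc ^ k * X (Fin.last N) ^ (d - k) := fun i => by simp [p]
  refine ⟨⟨p, ?_, ?_⟩, fun i => natDegree_rootedPoly hd (ha i) (ρ i), hcast, hlast⟩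
  · intro v
    induction v using Fin.lastCases with
    | last => rw [hlast]; simpa using (isHomogeneous_X K (Fin.last N)).pow d
    | cast i =>
      rw [hcast]
      refine IsHomogeneous.sum _ _ _ fun k hk => ?_
      have hk' : k ≤ d := Nat.lt_succ_iff.mp (Finset.mem_range.mp hk)
      have := ((isHomogeneous_C (Fin (N + 1)) ((F i).coeff k)).mul
        ((isHomogeneous_X K i.castSucc).pow k)).mul ((isHomogeneous_X K (Fin.last N)).pow (d - k))
      convert this using 1
      omega
  · intro x hx
    have h0 : x (Fin.last N) = 0 := by
      have := hx (Fin.last N)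
      rw [hlast, map_pow, eval_X] at this
      exact pow_eq_zero_iff (by omega) |>.mp this
    ext v
    induction v using Fin.lastCases with
    | last => exact h0
    | cast i =>
      have := hx i.castSucc
      rw [hcast, map_sum] at this
      simp only [map_mul, map_pow, eval_C, eval_X, h0] at this
      rw [ProjEnd.IsSplitBy.sum_range_zero_pow fun k => (F i).coeff k * x i.castSucc ^ k,
        coeff_rootedPoly hd] at this
      exact pow_eq_zero_iff (by omega) |>.mp ((mul_eq_zero.mp this).resolve_left (ha i))

theorem ProjEnd.IsSplit.exists_isRooted [IsAlgClosed K] (hd : 2 ≤ d) {f : ProjEnd K N d}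
    (hf : f.IsSplit) : ∃ a ρ, (∀ i, a i ≠ 0) ∧ f.IsRooted a ρ := by
  obtain ⟨F, hF⟩ := hf
  choose a ρ ha hρ using fun i => exists_rootedPoly hd (hF.1 i)
  refine ⟨a, ρ, ha, ?_⟩
  have : F = fun i => rootedPoly (a i) (ρ i) := funext hρ
  rwa [ProjEnd.IsRooted, ← this]

theorem ProjEnd.IsRooted.isSplit {f : ProjEnd K N d} {a : Fin N → K} {ρ : Fin N → Fin d → K}
    (hf : f.IsRooted a ρ) : f.IsSplit := ⟨_, hf⟩

end Rooted

/-! ### The invariants as functions of the component multipliers -/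

section TauOf

variable {N d : ℕ} {K : Type*} [Field K]

/-- The contribution of the affine fixed points to `Σ₁`, in terms of the multipliers. -/
def affSigma {R : Type*} [CommRing R] (lam : Fin N → Fin d → R) : Polynomial (Polynomial R) :=
  ∏ s : Fin N → Fin d,
    (Polynomial.X - Polynomial.C (∏ i, (Polynomial.X - Polynomial.C (lam i (s i)))))

/-- The contribution of the points at infinity to `Σ₁`. -/
def infSigma (K : Type*) [Field K] (N d : ℕ) : Polynomial (Polynomial K) :=
  ∏ l : InfLabel N d, (Polynomial.X - Polynomial.C (infPoly K l))

variable (K) in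
/-- The multiplier invariants as a function of the multipliers of the components. -/
def tauOf {R : Type*} [CommRing R] [Algebra K R] (lam : Fin N → Fin d → R) :
    SigmaIndex N d → R := fun s =>
  (-1) ^ ((s.1 : ℕ) + (s.2 : ℕ)) *
    ((affSigma lam * (infSigma K N d).map (Polynomial.mapRingHom (algebraMap K R))).coeff
      (numFixed N d - s.1)).coeff (N * s.1 - s.2)

/-- Working over any `K`-algebra allows the invariants to be formed for generic parameters and then
specialised. -/
theorem map_tauOf {R S : Type*} [CommRing R] [Algebra K R] [CommRing S] [Algebra K S]
    (φ : R →ₐ[K] S) (lam : Fin N → Fin d → R) (s : SigmaIndex N d) :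
    φ (tauOf K lam s) = tauOf K (fun i j => φ (lam i j)) s := by
  have h1 : affSigma (fun i j => φ (lam i j)) =
      (affSigma lam).map (Polynomial.mapRingHom (φ : R →+* S)) := by
    simp [affSigma, Polynomial.map_prod]
  have h2 : (infSigma K N d).map (Polynomial.mapRingHom (algebraMap K S)) =
      ((infSigma K N d).map (Polynomial.mapRingHom (algebraMap K R))).map
        (Polynomial.mapRingHom (φ : R →+* S)) := by
    rw [Polynomial.map_map]
    congr 1
    ext <;> simp
  rw [tauOf, tauOf, h1, h2, ← Polynomial.map_mul, Polynomial.coeff_map]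
  simp

theorem ProjEnd.IsRooted.sigmaPoly_eq [CharZero K] [IsAlgClosed K] (hd : 2 ≤ d)
    {f : ProjEnd K N d} {a : Fin N → K} {ρ : Fin N → Fin d → K} (ha : ∀ i, a i ≠ 0)
    (hf : f.IsRooted a ρ) :
    f.sigmaPoly = affSigma (fun i j => rootMult (a i) (ρ i) j) * infSigma K N d := by
  rw [ProjEnd.IsSplitBy.sigmaPoly_eq hf hd ha fun i => rfl]
  simp only [affPoly, eval_derivative_rootedPoly]
  rfl

theorem ProjEnd.IsRooted.tau_eq [CharZero K] [IsAlgClosed K] (hd : 2 ≤ d) {f : ProjEnd K N d}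
    {a : Fin N → K} {ρ : Fin N → Fin d → K} (ha : ∀ i, a i ≠ 0) (hf : f.IsRooted a ρ) :
    f.tau = tauOf K fun i j => rootMult (a i) (ρ i) j := by
  ext s
  rw [ProjEnd.tau, hf.sigmaPoly_eq hd ha, tauOf]
  simp [Polynomial.mapRingHom_id]

/-- All multiplier polynomials. -/
def labelPoly (lam : Fin N → Fin d → K) : (Fin N → Fin d) ⊕ InfLabel N d → Polynomial K :=
  Sum.elim (fun s => ∏ i, (Polynomial.X - Polynomial.C (lam i (s i)))) (infPoly K)

theorem natDegree_labelPoly (lam : Fin N → Fin d → K) (l) :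
    (labelPoly lam l).natDegree = N := by
  rcases l with s | l
  · rw [labelPoly, Sum.elim_inl,
      Polynomial.natDegree_prod_of_monic _ _ fun u _ => Polynomial.monic_X_sub_C _]
    simp
  · rw [labelPoly, Sum.elim_inr, infPoly,
      Polynomial.natDegree_prod_of_monic _ _ fun u _ => Polynomial.monic_X_sub_C _]
    simp

theorem affSigma_mul_infSigma (lam : Fin N → Fin d → K) :
    affSigma lam * infSigma K N d = ∏ l, (Polynomial.X - Polynomial.C (labelPoly lam l)) := by
  rw [Fintype.prod_sum_type]
  rfl

theorem card_label : Fintype.card ((Fin N → Fin d) ⊕ InfLabel N d) = numFixed N d := by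
  rw [Fintype.card_sum, Fintype.card_sigma, numFixed, Finset.sum_range_succ, add_comm,
    Finset.sum_range]
  simp

theorem natDegree_coeff_prod_X_sub_C {L : Type*} [Fintype L] {γ : L → Polynomial K} {N : ℕ}
    (hγ : ∀ l, (γ l).natDegree ≤ N) {k : ℕ} (hk : k ≤ Fintype.card L) :
    ((∏ l, (Polynomial.X - Polynomial.C (γ l))).coeff k).natDegree ≤ N * (Fintype.card L - k) := by
  have h1 : ∏ l, (Polynomial.X - Polynomial.C (γ l)) =
      ∏ l, (Polynomial.X + Polynomial.C (-γ l)) := by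
    simp [sub_eq_add_neg]
  rw [h1, Finset.prod_X_add_C_coeff _ _ (by simpa using hk)]
  refine Polynomial.natDegree_sum_le_of_forall_le _ _ fun t ht => ?_
  refine (Polynomial.natDegree_prod_le _ _).trans ?_
  rw [Finset.mem_powersetCard] at ht
  rw [mul_comm, ← smul_eq_mul, ← Finset.card_univ, ← ht.2]
  refine Finset.sum_le_card_nsmul _ _ _ fun l _ => ?_
  rw [Polynomial.natDegree_neg]
  exact hγ l

/-- By degree bounds, the index set covers every coefficient that can be nonzero, so the invariants
determine the whole polynomial. The factor from infinity is common and nonzero, and cancels. -/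
theorem affSigma_eq_of_tauOf_eq {lam mu : Fin N → Fin d → K} (h : tauOf K lam = tauOf K mu) :
    affSigma lam = affSigma mu := by
  have hmon : (infSigma K N d) ≠ 0 :=
    (Polynomial.monic_prod_of_monic _ _ fun l _ => Polynomial.monic_X_sub_C _).ne_zero
  apply mul_right_cancel₀ hmon
  have hcoeff : ∀ k n, k ≤ numFixed N d → n ≤ N * (numFixed N d - k) →
      ((affSigma lam * infSigma K N d).coeff k).coeff n =
        ((affSigma mu * infSigma K N d).coeff k).coeff n := by
    intro k n hk hn
    have := congrFun h ⟨⟨numFixed N d - k, by omega⟩,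
      ⟨N * (numFixed N d - k) - n, Nat.lt_succ_of_le (Nat.sub_le _ _)⟩⟩
    simp only [tauOf, Algebra.algebraMap_self, Polynomial.mapRingHom_id, Polynomial.map_id] at this
    have h2 := mul_left_cancel₀ (pow_ne_zero _ (neg_ne_zero.mpr one_ne_zero)) this
    rwa [Nat.sub_sub_self hk, Nat.sub_sub_self hn] at h2
  ext k n
  by_cases hk : k ≤ numFixed N d
  · by_cases hn : n ≤ N * (numFixed N d - k)
    · exact hcoeff k n hk hn
    · have hz : ∀ nu : Fin N → Fin d → K,
          ((affSigma nu * infSigma K N d).coeff k).coeff n = 0 := by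
        intro nu
        apply Polynomial.coeff_eq_zero_of_natDegree_lt
        rw [affSigma_mul_infSigma]
        refine (natDegree_coeff_prod_X_sub_C (fun l => (natDegree_labelPoly nu l).le)
          (by rwa [card_label])).trans_lt ?_
        rw [card_label]
        omega
      rw [hz, hz]
  · have hz : ∀ nu : Fin N → Fin d → K, (affSigma nu * infSigma K N d).coeff k = 0 := by
      intro nu
      apply Polynomial.coeff_eq_zero_of_natDegree_lt
      rw [affSigma_mul_infSigma,
        Polynomial.natDegree_prod_of_monic _ _ fun u _ => Polynomial.monic_X_sub_C _]
      simp only [Polynomial.natDegree_X_sub_C, Finset.sum_const, smul_eq_mul, mul_one,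
        Finset.card_univ, card_label]
      omega
    rw [hz, hz]

end TauOf

/-! ### Recovering the multiplier matrix -/

section Recovery

variable {N d : ℕ} {K : Type*} [Field K]

/-- Each affine multiplier polynomial of `lam` is a root of `affSigma mu`, so it equals one of `mu`;
the two then have the same roots in `t`. -/
theorem exists_eq_of_affSigma_eq {lam mu : Fin N → Fin d → K} (h : affSigma lam = affSigma mu)
    (s : Fin N → Fin d) : ∃ s' : Fin N → Fin d, ∀ i, ∃ k, mu k (s' k) = lam i (s i) := by
  have h1 : (affSigma mu).eval (∏ i, (Polynomial.X - Polynomial.C (lam i (s i)))) = 0 := by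
    rw [← h, affSigma, Polynomial.eval_prod]
    exact Finset.prod_eq_zero (Finset.mem_univ s)
      (by rw [Polynomial.eval_sub, Polynomial.eval_X, Polynomial.eval_C, sub_self])
  rw [affSigma, Polynomial.eval_prod, Finset.prod_eq_zero_iff] at h1
  obtain ⟨s', -, hs'⟩ := h1
  rw [Polynomial.eval_sub, Polynomial.eval_X, Polynomial.eval_C, sub_eq_zero] at hs'
  refine ⟨s', fun i => ?_⟩
  have h2 := congrArg (Polynomial.eval (lam i (s i))) hs'
  rw [Polynomial.eval_prod, Polynomial.eval_prod,
    Finset.prod_eq_zero (Finset.mem_univ i) (by simp)] at h2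
  obtain ⟨k, -, hk⟩ := Finset.prod_eq_zero_iff.mp h2.symm
  refine ⟨k, ?_⟩
  rw [Polynomial.eval_sub, Polynomial.eval_X, Polynomial.eval_C, sub_eq_zero] at hk
  exact hk.symm

/-- If the multipliers of the components are pairwise distinct, then they are determined by the
multiplier invariants up to permutations. -/
theorem exists_perm_of_affSigma_eq (hd : 0 < d) {lam mu : Fin N → Fin d → K}
    (hinj : Function.Injective fun x : Fin N × Fin d => lam x.1 x.2)
    (h : affSigma lam = affSigma mu) :
    ∃ (σ : Equiv.Perm (Fin N)) (e : Fin N → Fin d → Fin d), (∀ i, Function.Injective (e i)) ∧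
      ∀ i j, mu (σ i) (e i j) = lam i j := by
  choose T hT using exists_eq_of_affSigma_eq h
  have hex : ∀ x : Fin N × Fin d, ∃ y : Fin N × Fin d, mu y.1 y.2 = lam x.1 x.2 := fun x => by
    obtain ⟨k, hk⟩ := hT (fun _ => x.2) x.1
    exact ⟨(k, _), hk⟩
  choose π hπ using hex
  have hπinj : Function.Injective π := fun x x' hx => hinj (by
    change lam x.1 x.2 = lam x'.1 x'.2
    rw [← hπ, ← hπ, hx])
  have hπsurj : Function.Surjective π := Finite.surjective_of_injective hπinj
  have hmu : ∀ y y' : Fin N × Fin d, mu y.1 y.2 = mu y'.1 y'.2 → y = y' := by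
    intro y y' hy
    obtain ⟨x, rfl⟩ := hπsurj y
    obtain ⟨x', rfl⟩ := hπsurj y'
    rw [hπ, hπ] at hy
    exact congrArg π (hinj hy)
  have hdis : ∀ i j i' j', i ≠ i' → (π (i, j)).1 ≠ (π (i', j')).1 := by
    intro i j i' j' hii hcon
    -- A single fixed point has both eigenvalues `lam i j` and `lam i' j'`. The matching fixed point
    -- for `mu` uses only one entry of each row, so two distinct entries in a common row are
    -- impossible.
    set s : Fin N → Fin d := Function.update (fun _ => j') i j with hs
    obtain ⟨k, hk⟩ := hT s i
    obtain ⟨k', hk'⟩ := hT s i'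
    have hsi : s i = j := by simp [hs]
    have hsi' : s i' = j' := by simp [hs, hii.symm]
    have e1 : (k, T s k) = π (i, j) := hmu _ _ (by rw [hπ]; simpa [hsi] using hk)
    have e2 : (k', T s k') = π (i', j') := hmu _ _ (by rw [hπ]; simpa [hsi'] using hk')
    rw [← e1, ← e2] at hcon
    simp only at hcon
    subst hcon
    have := hπinj (e1.symm.trans e2)
    exact hii (congrArg Prod.fst this)
  set σ : Fin N → Fin N := fun i => (π (i, ⟨0, hd⟩)).1 with hσ
  have hσinj : Function.Injective σ := by
    intro i i' hi
    by_contra hne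
    exact hdis i ⟨0, hd⟩ i' ⟨0, hd⟩ hne hi
  have hσbij : Function.Bijective σ := Finite.injective_iff_bijective.mp hσinj
  have hrow : ∀ i j, (π (i, j)).1 = σ i := by
    intro i j
    obtain ⟨i'', hi''⟩ := hσbij.2 (π (i, j)).1
    by_cases heq : i = i''
    · rw [← hi'', heq]
    · exact absurd hi''.symm (hdis i j i'' ⟨0, hd⟩ heq)
  refine ⟨Equiv.ofBijective σ hσbij, fun i j => (π (i, j)).2, ?_, ?_⟩
  · intro i j j' hj
    have : π (i, j) = π (i, j') := Prod.ext ((hrow i j).trans (hrow i j').symm) hj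
    exact congrArg Prod.snd (hπinj this)
  · intro i j
    rw [Equiv.ofBijective_apply, ← hrow i j, hπ]

end Recovery

/-! ### The genericity condition as a symmetric polynomial -/

section Good

variable {K : Type*} [Field K] {ι : Type*} [Fintype ι] [DecidableEq ι]

/-- The genericity condition on the multipliers. -/
def IsGood (d : ℕ) (lam : ι → K) : Prop :=
  (∀ x, lam x ≠ 0) ∧ (∀ x, lam x ≠ 1) ∧ Function.Injective lam ∧
    ∀ S : Finset ι, S.Nonempty → S.card < d → ∑ x ∈ S, (lam x - 1)⁻¹ ≠ 0

variable (K ι) in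
/-- The symmetric polynomial whose nonvanishing defines genericity. -/
def goodPoly (d : ℕ) : MvPolynomial ι K :=
  (∏ x, X x) * (∏ x, (X x - 1)) * (∏ z ∈ Finset.univ.offDiag, (X z.1 - X z.2)) *
    ∏ S ∈ Finset.univ.filter (fun S : Finset ι => S.Nonempty ∧ S.card < d),
      ∑ x ∈ S, ∏ y ∈ Finset.univ.erase x, (X y - 1)

theorem goodPoly_isSymmetric (d : ℕ) : (goodPoly K ι d).IsSymmetric := by
  intro e
  simp only [goodPoly, map_mul, map_prod, map_sum, map_sub, rename_X, map_one]
  congr 1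
  · congr 1
    · congr 1
      · exact Equiv.prod_comp e fun x => (X x : MvPolynomial ι K)
      · exact Equiv.prod_comp e fun x => (X x - 1 : MvPolynomial ι K)
    · refine Finset.prod_equiv (e.prodCongr e) ?_ ?_ <;> simp
  · refine Finset.prod_equiv (Equiv.finsetCongr e) ?_ ?_
    · simp
    · intro S _
      rw [Equiv.finsetCongr_apply, Finset.sum_map]
      refine Finset.sum_congr rfl fun x _ => ?_
      refine Finset.prod_equiv e ?_ ?_ <;> simp

/-- The last factors of `goodPoly` are the subset sums of the `(lam x - 1)⁻¹` with denominators
cleared by `∏ (lam y - 1)`, which is invertible once the second factor is nonzero. -/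
theorem eval_goodPoly_ne_zero_iff {d : ℕ} {lam : ι → K} :
    eval lam (goodPoly K ι d) ≠ 0 ↔ IsGood d lam := by
  have hsum : (∀ x, lam x ≠ 1) → ∀ S : Finset ι,
      ∑ x ∈ S, ∏ y ∈ Finset.univ.erase x, (lam y - 1) =
        (∏ y, (lam y - 1)) * ∑ x ∈ S, (lam x - 1)⁻¹ := by
    intro h1 S
    rw [Finset.mul_sum]
    refine Finset.sum_congr rfl fun x _ => ?_
    rw [eq_mul_inv_iff_mul_eq₀ (sub_ne_zero.mpr (h1 x)),
      Finset.prod_erase_mul _ _ (Finset.mem_univ x)]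
  have hprod : (∀ x, lam x ≠ 1) → ∏ y, (lam y - 1) ≠ 0 := fun h1 =>
    Finset.prod_ne_zero_iff.mpr fun y _ => sub_ne_zero.mpr (h1 y)
  simp only [goodPoly, map_mul, map_prod, map_sum, map_sub, eval_X, map_one, ne_eq, mul_eq_zero,
    not_or, Finset.prod_eq_zero_iff, not_exists, not_and, IsGood, and_assoc]
  constructor
  · rintro ⟨h0, h1, h2, h3⟩
    have h1' : ∀ x, lam x ≠ 1 := fun x => sub_ne_zero.mp (h1 x (Finset.mem_univ x))
    refine ⟨fun x => h0 x (Finset.mem_univ x), h1', ?_, ?_⟩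
    · intro x y hxy
      by_contra hne
      exact h2 (x, y) (by simpa using hne) (by simp [hxy])
    · intro S hS hSd hz
      refine h3 S (by simpa using ⟨hS, hSd⟩) ?_
      rw [hsum h1', hz, mul_zero]
  · rintro ⟨h0, h1, h2, h3⟩
    refine ⟨fun x _ => h0 x, fun x _ => sub_ne_zero.mpr (h1 x), ?_, ?_⟩
    · rintro ⟨x, y⟩ hxy
      have : x ≠ y := by simpa using hxy
      exact sub_ne_zero.mpr (h2.ne this)
    · intro S hS
      rw [hsum h1]
      have := (Finset.mem_filter.mp hS).2
      exact mul_ne_zero (hprod h1) (h3 S this.1 this.2)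

end Good

/-! ### Symmetric functions of the multipliers are polynomials in the invariants -/

section TauAlg

variable (K : Type*) [Field K] (N d : ℕ)

/-- The functions of the multipliers that are polynomials in the multiplier invariants. -/
def tauAlg : Subalgebra K ((Fin N → Fin d → K) → K) :=
  (aeval (fun s lam => tauOf K lam s) :
    MvPolynomial (SigmaIndex N d) K →ₐ[K] ((Fin N → Fin d → K) → K)).range

variable {K N d}

theorem mem_tauAlg {h : (Fin N → Fin d → K) → K} :
    h ∈ tauAlg K N d ↔ ∃ G : MvPolynomial (SigmaIndex N d) K,
      ∀ lam, eval (tauOf K lam) G = h lam := by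
  have key : ∀ G : MvPolynomial (SigmaIndex N d) K, ∀ lam : Fin N → Fin d → K,
      aeval (fun s (lam : Fin N → Fin d → K) => tauOf K lam s) G lam = eval (tauOf K lam) G := by
    intro G lam
    have := MvPolynomial.comp_aeval_apply (fun s (lam : Fin N → Fin d → K) => tauOf K lam s)
      (Pi.evalAlgHom K (fun _ : Fin N → Fin d → K => K) lam) G
    exact this
  rw [tauAlg, AlgHom.mem_range]
  refine exists_congr fun G => ?_
  rw [funext_iff]
  exact forall_congr' fun lam => by rw [key]

/-- The fundamental theorem of symmetric polynomials, for values in a subalgebra of functions. -/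
theorem symmetric_mem_of_esymm_mem {T W : Type*} [Fintype W] {A : Subalgebra K (T → K)}
    {R : T → W → K} (h : ∀ k ≤ Fintype.card W, (fun t => aeval (R t) (esymm W K k)) ∈ A)
    {p : MvPolynomial W K} (hp : p.IsSymmetric) : (fun t => aeval (R t) p) ∈ A := by
  obtain ⟨q, hq⟩ := esymmAlgHom_surjective (σ := W) K (le_refl (Fintype.card W)) ⟨p, hp⟩
  have hq' : aeval (fun i : Fin (Fintype.card W) => esymm W K (i + 1)) q = p := by
    rw [← esymmAlgHom_apply, hq]
  rw [← hq']
  clear hq hq'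
  induction q using MvPolynomial.induction_on with
  | C a =>
    simp only [algHom_C, AlgHom.commutes]
    exact A.algebraMap_mem a
  | add q r hq hr =>
    simp only [map_add]
    exact A.add_mem hq hr
  | mul_X q i hq =>
    simp only [map_mul, aeval_X]
    exact A.mul_mem hq (h (i + 1) i.2)

/-- Newton's identities, solved for `esymm` by dividing by `k` in characteristic zero. -/
theorem esymm_mem_of_psum_mem [CharZero K] {T W : Type*} [Fintype W] {A : Subalgebra K (T → K)}
    {R : T → W → K} (h : ∀ k, (fun t => aeval (R t) (psum W K k)) ∈ A) (k : ℕ) :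
    (fun t => aeval (R t) (esymm W K k)) ∈ A := by
  induction k using Nat.strong_induction_on with
  | _ k ih =>
    rcases Nat.eq_zero_or_pos k with rfl | hk
    · simp only [esymm_zero, map_one]
      exact A.one_mem
    · have h1 : (fun t => aeval (R t) (esymm W K k)) =
          ((k : K)⁻¹ * (-1) ^ (k + 1)) • ∑ a ∈ (Finset.HasAntidiagonal.antidiagonal k).filter (fun a => a.1 < k),
            ((-1 : K) ^ a.1) • ((fun t => aeval (R t) (esymm W K a.1)) *
              (fun t => aeval (R t) (psum W K a.2))) := by
        ext t
        have h2 := congrArg (aeval (R t)) (mul_esymm_eq_sum W K k)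
        simp only [map_mul, map_natCast, map_pow, map_neg, map_one, map_sum] at h2
        simp only [Pi.smul_apply, Finset.sum_apply, Pi.mul_apply, smul_eq_mul]
        rw [mul_assoc, ← mul_assoc, mul_assoc, eq_inv_mul_iff_mul_eq₀ (Nat.cast_ne_zero.mpr hk.ne'), h2]
        simp only [mul_assoc]
      rw [h1]
      refine A.smul_mem (A.sum_mem fun a ha => A.smul_mem (A.mul_mem (ih _ ?_) (h _)) _) _
      exact (Finset.mem_filter.mp ha).2

/-- All eigenvalues of the multipliers at all fixed points. -/
def allRoots (lam : Fin N → Fin d → K) (w : ((Fin N → Fin d) ⊕ InfLabel N d) × Fin N) : K :=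
  Sum.elim (fun s => lam w.2 (s w.2)) (fun l => infMult K l (l.1.castSucc.succAbove w.2)) w.1

theorem labelPoly_eq_prod (lam : Fin N → Fin d → K) (l) :
    labelPoly lam l = ∏ i, (Polynomial.X - Polynomial.C (allRoots lam (l, i))) := by
  rcases l with s | l
  · rfl
  · exact (Fintype.prod_equiv (finSuccAboveEquiv l.1.castSucc) _ _ fun i => by
      simp [allRoots, finSuccAboveEquiv_apply]).symm

theorem coeff_zero_affSigma_mul_infSigma (lam : Fin N → Fin d → K) :
    (affSigma lam * infSigma K N d).coeff 0 = (-1) ^ numFixed N d *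
      ∏ w, (Polynomial.X - Polynomial.C (allRoots lam w)) := by
  rw [affSigma_mul_infSigma, Polynomial.coeff_zero_eq_eval_zero, Polynomial.eval_prod,
    Fintype.prod_prod_type]
  simp only [Polynomial.eval_sub, Polynomial.eval_X, Polynomial.eval_C, zero_sub,
    ← labelPoly_eq_prod]
  rw [Finset.prod_neg, Finset.card_univ, card_label]

/-- The invariants with `i` maximal come from the coefficient of `w^0`, which up to sign is the
product of all multiplier polynomials. Its coefficients are, up to sign, the elementary symmetric
functions of all eigenvalues. -/
theorem esymm_allRoots_mem (k : ℕ) (hk : k ≤ Fintype.card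
      (((Fin N → Fin d) ⊕ InfLabel N d) × Fin N)) :
    (fun lam : Fin N → Fin d → K => aeval (allRoots lam) (esymm _ K k)) ∈ tauAlg K N d := by
  have hcard : Fintype.card (((Fin N → Fin d) ⊕ InfLabel N d) × Fin N) = N * numFixed N d := by
    rw [Fintype.card_prod, card_label, Fintype.card_fin, mul_comm]
  rw [hcard] at hk
  let s : SigmaIndex N d := ⟨⟨numFixed N d, Nat.lt_succ_self _⟩, ⟨k, Nat.lt_succ_of_le hk⟩⟩
  have h1 : (fun lam : Fin N → Fin d → K => aeval (allRoots lam) (esymm _ K k)) =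
      fun lam => tauOf K lam s := by
    ext lam
    have h2 := Multiset.prod_X_sub_C_coeff (Finset.univ.val.map (allRoots lam))
      (k := N * numFixed N d - k) (by simp [hcard])
    rw [Multiset.map_map, Multiset.card_map, Finset.card_val, Finset.card_univ, hcard,
      Nat.sub_sub_self hk, ← aeval_esymm_eq_multiset_esymm _ K] at h2
    have h3 : ((Finset.univ.val.map ((fun t => Polynomial.X - Polynomial.C t) ∘ allRoots lam)).prod :
        Polynomial K) = ∏ w, (Polynomial.X - Polynomial.C (allRoots lam w)) := rfl
    rw [h3] at h2
    simp only [tauOf, s, Algebra.algebraMap_self, Polynomial.mapRingHom_id, Polynomial.map_id,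
      Nat.sub_self]
    have h4 : ((-1 : Polynomial K) ^ numFixed N d) = Polynomial.C ((-1) ^ numFixed N d) := by simp
    rw [coeff_zero_affSigma_mul_infSigma, h4, Polynomial.coeff_C_mul, h2, pow_add]
    have e1 : ((-1 : K) ^ numFixed N d) * (-1) ^ numFixed N d = 1 := by
      rw [← mul_pow]; simp
    have e2 : ((-1 : K) ^ k) * (-1) ^ k = 1 := by
      rw [← mul_pow]; simp
    linear_combination (- aeval (allRoots lam) (esymm _ K k)) * (e1 * (-1) ^ k * (-1) ^ k + e2)
  rw [h1]
  exact mem_tauAlg.mpr ⟨X s, fun lam => by simp⟩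

theorem sum_sum_apply {M : Type*} [CommSemiring M] (g : Fin N → Fin d → M) :
    ∑ s : Fin N → Fin d, ∑ i, g i (s i) = (d : M) ^ (N - 1) * ∑ i, ∑ j, g i j := by
  rw [Finset.sum_comm, Finset.mul_sum]
  refine Finset.sum_congr rfl fun i _ => ?_
  rw [← Equiv.sum_comp (Equiv.funSplitAt i (Fin d)).symm, Fintype.sum_prod_type, Finset.mul_sum]
  refine Finset.sum_congr rfl fun j _ => ?_
  simp

/-- Each `lam i j` is an eigenvalue at `d ^ (N - 1)` affine fixed points. A power sum of all
eigenvalues is therefore that multiple of the wanted power sum plus a constant from infinity. -/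
theorem psum_mem [CharZero K] (hd : d ≠ 0) (k : ℕ) :
    (fun lam : Fin N → Fin d → K =>
      aeval (fun x : Fin N × Fin d => lam x.1 x.2) (psum (Fin N × Fin d) K k)) ∈ tauAlg K N d := by
  have h1 := symmetric_mem_of_esymm_mem (A := tauAlg K N d) (R := allRoots) esymm_allRoots_mem
    (psum_isSymmetric _ K k)
  set c : K := ∑ l : InfLabel N d, ∑ i, infMult K l (l.1.castSucc.succAbove i) ^ k
  have h2 : (fun lam : Fin N → Fin d → K =>
      aeval (fun x : Fin N × Fin d => lam x.1 x.2) (psum (Fin N × Fin d) K k)) =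
      ((d : K) ^ (N - 1))⁻¹ • ((fun lam => aeval (allRoots lam) (psum _ K k)) - fun _ => c) := by
    ext lam
    simp only [Pi.smul_apply, Pi.sub_apply, smul_eq_mul]
    rw [eq_inv_mul_iff_mul_eq₀ (pow_ne_zero _ (Nat.cast_ne_zero.mpr hd)), psum, psum]
    simp only [map_sum, map_pow, aeval_X]
    simp only [Fintype.sum_prod_type, Fintype.sum_sum_type, allRoots, Sum.elim_inl, Sum.elim_inr]
    rw [sum_sum_apply fun i j => lam i j ^ k]
    ring
  rw [h2]
  exact (tauAlg K N d).smul_mem ((tauAlg K N d).sub_mem h1 ((tauAlg K N d).algebraMap_mem c)) _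

/-- Genericity is an open condition on the multiplier invariants. -/
theorem exists_eval_ne_zero_iff_isGood [CharZero K] (hd : d ≠ 0) :
    ∃ G : MvPolynomial (SigmaIndex N d) K, ∀ lam : Fin N → Fin d → K,
      eval (tauOf K lam) G ≠ 0 ↔ IsGood d fun x : Fin N × Fin d => lam x.1 x.2 := by
  have h := symmetric_mem_of_esymm_mem (A := tauAlg K N d)
    (R := fun (lam : Fin N → Fin d → K) (x : Fin N × Fin d) => lam x.1 x.2)
    (fun k _ => esymm_mem_of_psum_mem (psum_mem hd) k) (goodPoly_isSymmetric d)
  obtain ⟨G, hG⟩ := mem_tauAlg.mp h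
  refine ⟨G, fun lam => ?_⟩
  rw [hG, ← eval_goodPoly_ne_zero_iff]
  rfl

end TauAlg

/-! ### Density of the generic locus in the image -/

section Density

variable {N d : ℕ} {K : Type*} [Field K] [IsAlgClosed K] [CharZero K]

/-- The image is parametrised by pairs `(a, ρ)` with all `a i` nonzero, and the polynomial ring in
these parameters is a domain. If `Q` vanishes where `G` does not, the pullback of `Q` times a
nonzero polynomial is zero, so that pullback is zero. -/
theorem vanishingIdeal_splitImage_diff (hd : 2 ≤ d) {G : MvPolynomial (SigmaIndex N d) K}
    {a₀ : Fin N → K} {ρ₀ : Fin N → Fin d → K} (ha₀ : ∀ i, a₀ i ≠ 0)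
    (hG : eval (tauOf K fun i j => rootMult (a₀ i) (ρ₀ i) j) G ≠ 0) :
    vanishingIdeal K (splitImage K N d \ zeroLocus K (Ideal.span {G})) =
      vanishingIdeal K (splitImage K N d) := by
  refine le_antisymm (fun Q hQ => ?_) (vanishingIdeal_anti_mono Set.sdiff_subset)
  let R := MvPolynomial (Fin N ⊕ Fin N × Fin d) K
  let T : SigmaIndex N d → R := tauOf K fun i j =>
    rootMult (X (Sum.inl i) : R) (fun j => X (Sum.inr (i, j))) j
  let pt (a : Fin N → K) (ρ : Fin N → Fin d → K) : Fin N ⊕ Fin N × Fin d → K :=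
    Sum.elim a fun x => ρ x.1 x.2
  have hT : ∀ a ρ P, eval (pt a ρ) (aeval T P) =
      eval (tauOf K fun i j => rootMult (a i) (ρ i) j) P := by
    intro a ρ P
    have h1 : ∀ s, aeval (pt a ρ) (T s) = tauOf K (fun i j => rootMult (a i) (ρ i) j) s := by
      intro s
      rw [map_tauOf]
      simp [rootMult, pt]
    have h2 := MvPolynomial.comp_aeval_apply T (aeval (pt a ρ)) P
    simp only [h1] at h2
    exact h2
  have hzero : aeval T Q * (aeval T G * ∏ i : Fin N, X (Sum.inl i)) = 0 := by
    refine MvPolynomial.funext fun x => ?_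
    obtain ⟨a, ρ, rfl⟩ : ∃ a ρ, x = pt a ρ :=
      ⟨fun i => x (Sum.inl i), fun i j => x (Sum.inr (i, j)), by ext (i | i) <;> rfl⟩
    rw [map_mul, map_mul, hT, hT, map_prod, map_zero]
    by_contra hne
    have h2 := right_ne_zero_of_mul (right_ne_zero_of_mul hne)
    have ha : ∀ i, a i ≠ 0 := fun i => by
      simpa [pt] using Finset.prod_ne_zero_iff.mp h2 i (Finset.mem_univ i)
    obtain ⟨f, hf⟩ := exists_isRooted hd ha ρ
    refine left_ne_zero_of_mul hne (hQ _ ⟨⟨f, hf.isSplit, hf.tau_eq hd ha⟩, fun hz => ?_⟩)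
    exact left_ne_zero_of_mul (right_ne_zero_of_mul hne) (hz G (Ideal.mem_span_singleton_self G))
  have hne : aeval T G * ∏ i : Fin N, X (Sum.inl i) ≠ 0 := by
    intro h
    have := congrArg (eval (pt a₀ ρ₀)) h
    rw [map_mul, hT, map_prod, map_zero] at this
    refine mul_ne_zero hG (Finset.prod_ne_zero_iff.mpr fun i _ => ?_) this
    simpa [pt] using ha₀ i
  have hQ0 := (mul_eq_zero.mp hzero).resolve_right hne
  rintro _ ⟨g, hg, rfl⟩
  obtain ⟨a, ρ, ha, hf⟩ := hg.exists_isRooted hd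
  rw [hf.tau_eq hd ha]
  have := hT a ρ Q
  rw [hQ0, map_zero] at this
  exact this.symm

end Density

/-! ### Fixed points with prescribed multipliers and Lagrange interpolation -/

section Lagrange

variable {K : Type*} [Field K] {n : ℕ}

theorem sum_mul_pow_eq_zero_of_mul_prod_eq {p m : Fin (n + 2) → K} {a : K}
    (h : ∀ j, m j * (a * ∏ k ∈ Finset.univ.erase j, (p j - p k)) = 1) {k : ℕ} (hk : k ≤ n) :
    ∑ j, m j * p j ^ k = 0 := by
  classical
  have ha : a ≠ 0 := by
    rintro rfl
    simpa using h 0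
  have hD : ∀ j, ∏ k ∈ Finset.univ.erase j, (p j - p k) ≠ 0 := fun j hj => by
    simpa [hj] using h j
  have hp : Function.Injective p := by
    intro i j hij
    by_contra hne
    exact hD i (Finset.prod_eq_zero (Finset.mem_erase.mpr ⟨Ne.symm hne, Finset.mem_univ j⟩)
      (sub_eq_zero.mpr hij))
  -- Compare coefficients of `X ^ (n + 1)` in the interpolation of `X ^ k` at `n + 2` nodes; on the
  -- left this is `0` since `k ≤ n`.
  have h1 := Lagrange.coeff_eq_sum (s := Finset.univ) (v := p) hp.injOn
    (P := (Polynomial.X ^ k : Polynomial K)) (by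
      rw [Polynomial.degree_X_pow, Finset.card_univ, Fintype.card_fin]
      exact_mod_cast (by omega : k < n + 2))
  rw [Finset.card_univ, Fintype.card_fin, Polynomial.coeff_X_pow, if_neg (by omega)] at h1
  have h2 : ∑ j, m j * p j ^ k = a⁻¹ * ∑ j, (Polynomial.X ^ k : Polynomial K).eval (p j) /
      ∏ k ∈ Finset.univ.erase j, (p j - p k) := by
    rw [Finset.mul_sum]
    refine Finset.sum_congr rfl fun j _ => ?_
    rw [Polynomial.eval_pow, Polynomial.eval_X]
    have := hD j
    field_simp
    linear_combination p j ^ k * h j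
  rw [h2, ← h1, mul_zero]

/-- The equations force all `m j * D j` to agree, and `a` is the inverse of their common value. -/
theorem exists_mul_prod_eq_of_sum_mul_pow_eq_zero {p m : Fin (n + 2) → K}
    (hp : Function.Injective p) (hm : m 0 ≠ 0) (h : ∀ k ≤ n, ∑ j, m j * p j ^ k = 0) :
    ∃ a ≠ 0, ∀ j, m j * (a * ∏ k ∈ Finset.univ.erase j, (p j - p k)) = 1 := by
  classical
  set D : Fin (n + 2) → K := fun j => ∏ k ∈ Finset.univ.erase j, (p j - p k) with hDdef
  have hD : ∀ j, D j ≠ 0 := fun j => Finset.prod_ne_zero_iff.mpr fun k hk =>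
    sub_ne_zero.mpr (hp.ne (Finset.ne_of_mem_erase hk).symm)
  have hpoly : ∀ q : Polynomial K, q.natDegree < n + 1 → ∑ j, m j * q.eval (p j) = 0 := by
    intro q hq
    have : ∀ j, m j * q.eval (p j) =
        ∑ k ∈ Finset.range (n + 1), q.coeff k * (m j * p j ^ k) := by
      intro j
      rw [Polynomial.eval_eq_sum_range' hq, Finset.mul_sum]
      exact Finset.sum_congr rfl fun k _ => by ring
    simp_rw [this]
    rw [Finset.sum_comm]
    refine Finset.sum_eq_zero fun k hk => ?_
    rw [← Finset.mul_sum, h k (Nat.lt_succ_iff.mp (Finset.mem_range.mp hk)), mul_zero]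
  have key : ∀ j, m j * D j = m 0 * D 0 := by
    intro j
    by_cases hj : j = 0
    · rw [hj]
    set s : Finset (Fin (n + 2)) := (Finset.univ.erase j).erase 0 with hs
    have h0 : (0 : Fin (n + 2)) ∈ Finset.univ.erase j := by simp [Ne.symm hj]
    have hcard : s.card = n := by
      rw [hs, Finset.card_erase_of_mem h0, Finset.card_erase_of_mem (Finset.mem_univ j)]
      simp
    -- This polynomial has degree `n` and vanishes at all nodes except `p 0` and `p j`, leaving a
    -- two-term relation.
    have hq := hpoly (∏ k ∈ s, (Polynomial.X - Polynomial.C (p k))) (by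
      rw [Polynomial.natDegree_prod_of_monic _ _ fun u _ => Polynomial.monic_X_sub_C _]
      simp [hcard])
    simp only [Polynomial.eval_prod, Polynomial.eval_sub, Polynomial.eval_X,
      Polynomial.eval_C] at hq
    rw [← Finset.add_sum_erase _ _ (Finset.mem_univ j), ← Finset.add_sum_erase _ _ h0,
      Finset.sum_eq_zero (s := (Finset.univ.erase j).erase 0) fun l hl => by
        rw [Finset.prod_eq_zero hl (sub_self _), mul_zero]] at hq
    have e1 : D j = (p j - p 0) * ∏ k ∈ s, (p j - p k) := by
      rw [hDdef, hs]
      exact (Finset.mul_prod_erase _ (fun k => p j - p k) h0).symm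
    have e2 : D 0 = (p 0 - p j) * ∏ k ∈ s, (p 0 - p k) := by
      rw [hDdef, hs, Finset.erase_right_comm]
      exact (Finset.mul_prod_erase _ (fun k => p 0 - p k) (by simp [hj])).symm
    rw [e1, e2]
    linear_combination (p j - p 0) * hq
  refine ⟨(m 0 * D 0)⁻¹, inv_ne_zero (mul_ne_zero hm (hD 0)), fun j => ?_⟩
  change m j * (_ * D j) = 1
  rw [mul_left_comm, key j, inv_mul_cancel₀ (mul_ne_zero hm (hD 0))]

/-- The points `x₁, …, xₙ, 1, 0`. -/
def normPoints (x : Fin n → K) : Fin (n + 2) → K :=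
  Fin.snoc (α := fun _ => K) (Fin.snoc (α := fun _ => K) x 1) 0

/-- The admissible values of `x` for which `x₁, …, xₙ, 1, 0` are the fixed points of a polynomial
with holomorphic indices `-m`. -/
def normSol (m : Fin (n + 2) → K) : Set (Fin n → K) :=
  {x | ∀ j < n, ∑ i : Fin n, m i.castSucc.castSucc * x i ^ (j + 1) + m (Fin.last n).castSucc = 0}

theorem sum_normPoints (m : Fin (n + 2) → K) (x : Fin n → K) (j : ℕ) :
    ∑ i, m i * normPoints x i ^ (j + 1) =
      ∑ i : Fin n, m i.castSucc.castSucc * x i ^ (j + 1) + m (Fin.last n).castSucc := by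
  rw [Fin.sum_univ_castSucc, Fin.sum_univ_castSucc]
  simp [normPoints]

variable {m : Fin (n + 2) → K}

/-- The node `0` drops out of every power sum with positive exponent. The other `n + 1` weights have
nonzero subset sums because such subsets are proper, so their nodes are distinct and nonzero. -/
theorem normPoints_injective
    (hm : ∀ S : Finset (Fin (n + 2)), S.Nonempty → S.card < n + 2 → ∑ i ∈ S, m i ≠ 0)
    {x : Fin n → K} (hx : x ∈ normSol m) : Function.Injective (normPoints x) := by
  have h := injective_of_weighted_power_sums (n := n) (w := fun i => m i.castSucc)
    (y := Fin.snoc (α := fun _ => K) x 1) ?_ ?_ ⟨Fin.last n, by simp⟩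
  · intro i j hij
    induction i using Fin.lastCases with
    | last =>
      induction j using Fin.lastCases with
      | last => rfl
      | cast j => simp only [normPoints, Fin.snoc_last, Fin.snoc_castSucc] at hij
                  exact absurd hij.symm (h.2 j)
    | cast i =>
      induction j using Fin.lastCases with
      | last => simp only [normPoints, Fin.snoc_last, Fin.snoc_castSucc] at hij
                exact absurd hij (h.2 i)
      | cast j => simp only [normPoints, Fin.snoc_castSucc] at hij
                  rw [h.1 hij]
  · intro S hS
    have := hm (S.map Fin.castSuccEmb) (by simpa using hS) (by
      rw [Finset.card_map]
      exact (Finset.card_le_univ S).trans_lt (by simp))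
    simpa using this
  · intro j hj
    rw [Fin.sum_univ_castSucc]
    simpa using hx j hj

theorem natCard_normSol [CharZero K] [IsAlgClosed K]
    (hm : ∀ S : Finset (Fin (n + 2)), S.Nonempty → S.card < n + 2 → ∑ i ∈ S, m i ≠ 0) :
    Nat.card (normSol m) = n.factorial := by
  refine natCard_solutions (w := fun i => m i.castSucc) fun S hS => ?_
  have := hm (S.map Fin.castSuccEmb) (by simpa using hS) (by
    rw [Finset.card_map]
    exact (Finset.card_le_univ S).trans_lt (by simp))
  simpa using this

theorem exists_of_mem_normSol
    (hm : ∀ S : Finset (Fin (n + 2)), S.Nonempty → S.card < n + 2 → ∑ i ∈ S, m i ≠ 0)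
    (hm0 : ∑ j, m j = 0) {x : Fin n → K} (hx : x ∈ normSol m) :
    ∃ a ≠ 0, ∀ j, m j * (a * ∏ k ∈ Finset.univ.erase j,
      (normPoints x j - normPoints x k)) = 1 := by
  refine exists_mul_prod_eq_of_sum_mul_pow_eq_zero (normPoints_injective hm hx) ?_ ?_
  · simpa using hm {0} (by simp) (by simp)
  -- Exponent `0` is the condition that the weights sum to zero; the positive exponents are the
  -- equations of `normSol`.
  · rintro (_ | k) hk
    · simpa using hm0
    · rw [sum_normPoints]
      exact hx k hk

theorem mem_normSol_of_mul_prod_eq {x : Fin n → K} {a : K}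
    (h : ∀ j, m j * (a * ∏ k ∈ Finset.univ.erase j, (normPoints x j - normPoints x k)) = 1) :
    x ∈ normSol m := fun j hj => by
  rw [← sum_normPoints]
  exact sum_mul_pow_eq_zero_of_mul_prod_eq h hj

end Lagrange

/-! ### Existence of generic multipliers -/

section Existence

variable {N n : ℕ} {K : Type*} [Field K]

/-- Over an infinite field, a subspace is not covered by finitely many proper subspaces. Each linear
form to be avoided is nonzero on a difference of two basis vectors in one row. The value `-1` is
excluded because it corresponds to multiplier `0`. -/
theorem exists_generic_indices [CharZero K] (N d : ℕ) (hd : 2 ≤ d) :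
    ∃ m : Fin N × Fin d → K, (∀ i, ∑ j, m (i, j) = 0) ∧ (∀ x, m x ≠ -1) ∧
      Function.Injective m ∧
      ∀ S : Finset (Fin N × Fin d), S.Nonempty → S.card < d → ∑ x ∈ S, m x ≠ 0 := by
  classical
  let V : Submodule K (Fin N × Fin d → K) :=
    { carrier := {m | ∀ i, ∑ j, m (i, j) = 0}
      add_mem' := fun {a b} ha hb i => by simp [Finset.sum_add_distrib, ha i, hb i]
      zero_mem' := fun i => by simp
      smul_mem' := fun c a ha i => by simp [← Finset.mul_sum, ha i] }
  let I := {S : Finset (Fin N × Fin d) // S.Nonempty ∧ S.card < d} ⊕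
    {z : (Fin N × Fin d) × (Fin N × Fin d) // z.1 ≠ z.2}
  let φ : I → Module.Dual K (Fin N × Fin d → K) := Sum.elim
    (fun S => ∑ x ∈ S.1, LinearMap.proj x) (fun z => (LinearMap.proj z.1.1 : Module.Dual K (Fin N × Fin d → K)) - LinearMap.proj z.1.2)
  let tv (i : Fin N) (j j' : Fin d) : Fin N × Fin d → K := Pi.single (i, j) 1 - Pi.single (i, j') 1
  have htv : ∀ i j j', tv i j j' ∈ V := by
    intro i j j' k
    by_cases h : i = k
    · subst h
      simp [tv, Pi.single_apply, Finset.sum_sub_distrib]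
    · simp [tv, Ne.symm h]
  obtain ⟨m, hmV, hm⟩ := Module.Dual.exists_forall_mem_ne_zero_of_forall_exists V φ (by
    rintro (⟨S, hS, hSd⟩ | ⟨⟨⟨i, j⟩, y⟩, hz⟩)
    · obtain ⟨⟨i, j⟩, hx⟩ := hS
      -- A set with fewer than `d` elements cannot contain a full row, the only obvious vanishing
      -- sum.
      obtain ⟨j', hj'⟩ : ∃ j', (i, j') ∉ S := by
        by_contra! hcon
        have h1 : (Finset.univ.map ⟨fun j : Fin d => (i, j), Prod.mk_right_injective i⟩) ⊆ S := by
          intro x hx'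
          obtain ⟨j', -, rfl⟩ := Finset.mem_map.mp hx'
          exact hcon j'
        have := Finset.card_le_card h1
        simp at this
        omega
      refine ⟨tv i j j', htv i j j', ?_⟩
      simp [φ, tv, Finset.sum_sub_distrib, Pi.single_apply, hx, hj']
    · have : Nontrivial (Fin d) := Fin.nontrivial_iff_two_le.mpr hd
      obtain ⟨j', hj'⟩ := exists_ne j
      refine ⟨tv i j j', htv i j j', ?_⟩
      have hz' : (i, j) ≠ y := hz
      have hj2 : (i, j) ≠ (i, j') := fun h => hj' (Prod.ext_iff.mp h).2.symm
      simp only [φ, Sum.elim_inr, tv, LinearMap.sub_apply, LinearMap.proj_apply, Pi.sub_apply,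
        Pi.single_eq_same, Pi.single_eq_of_ne hj2, Pi.single_eq_of_ne hz'.symm]
      by_cases hy : y = (i, j')
      · subst hy
        rw [Pi.single_eq_same]
        norm_num
      · rw [Pi.single_eq_of_ne hy]
        norm_num)
  -- All conditions but the last are homogeneous, so a nonzero scaling by `t` can be used to avoid
  -- the value `-1`.
  obtain ⟨t, ht⟩ := Infinite.exists_notMem_finset
    (insert (0 : K) (Finset.univ.image fun x => -(m x)⁻¹))
  simp only [Finset.mem_insert, Finset.mem_image, Finset.mem_univ, true_and, not_or,
    not_exists] at ht
  refine ⟨t • m, fun i => ?_, fun x hx => ?_, fun x y hxy => ?_, fun S hS hSd => ?_⟩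
  · simp [← Finset.mul_sum, hmV i]
  · refine ht.2 x ?_
    have hx' : t * m x = -1 := hx
    have hmx : m x ≠ 0 := by
      intro h0
      simp [h0] at hx'
    field_simp
    linear_combination -hx'
  · by_contra hne
    have h1 := hm (Sum.inr ⟨(x, y), hne⟩)
    have h2 : t * m x = t * m y := hxy
    exact h1 (sub_eq_zero.mpr (mul_left_cancel₀ ht.1 h2))
  · have h1 := hm (Sum.inl ⟨S, hS, hSd⟩)
    simp only [φ, Sum.elim_inl, LinearMap.coe_sum, Finset.sum_apply, LinearMap.proj_apply] at h1
    simp only [Pi.smul_apply, smul_eq_mul, ← Finset.mul_sum]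
    exact mul_ne_zero ht.1 h1

theorem row_sum_ne_zero {m : Fin N × Fin (n + 2) → K}
    (hm : ∀ S : Finset (Fin N × Fin (n + 2)), S.Nonempty → S.card < n + 2 → ∑ x ∈ S, m x ≠ 0)
    (i : Fin N) (S : Finset (Fin (n + 2))) (hS : S.Nonempty) (hSd : S.card < n + 2) :
    ∑ j ∈ S, m (i, j) ≠ 0 := by
  have := hm (S.map ⟨fun j => (i, j), Prod.mk_right_injective i⟩) (by simpa using hS)
    (by rwa [Finset.card_map])
  rwa [Finset.sum_map] at this

/-- The indices `m` are chosen first; solving the power sum equations row by row realises the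
multipliers `1 + m⁻¹`. -/
theorem exists_isGood [CharZero K] [IsAlgClosed K] :
    ∃ (a : Fin N → K) (ρ : Fin N → Fin (n + 2) → K), (∀ i, a i ≠ 0) ∧
      IsGood (n + 2) fun x : Fin N × Fin (n + 2) => rootMult (a x.1) (ρ x.1) x.2 := by
  obtain ⟨m, h0, h1, h2, h3⟩ := exists_generic_indices (K := K) N (n + 2) (by omega)
  have hrow := row_sum_ne_zero h3
  have hex : ∀ i, ∃ x, x ∈ normSol fun j => m (i, j) := by
    intro i
    have := natCard_normSol (hrow i)
    have hne : Nat.card (normSol fun j => m (i, j)) ≠ 0 := by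
      rw [this]; exact Nat.factorial_ne_zero n
    have := (Nat.card_ne_zero.mp hne).1
    exact ⟨_, this.some.2⟩
  choose x hx using hex
  choose a ha hax using fun i => exists_of_mem_normSol (hrow i) (h0 i) (hx i)
  have hm0 : ∀ y, m y ≠ 0 := fun y => by simpa using h3 {y} (by simp) (by simp)
  have hlam : ∀ y : Fin N × Fin (n + 2),
      rootMult (a y.1) (normPoints (x y.1)) y.2 = 1 + (m y)⁻¹ := by
    rintro ⟨i, j⟩
    rw [rootMult, ← eq_inv_of_mul_eq_one_right (hax i j)]
  refine ⟨a, fun i => normPoints (x i), ha, ?_⟩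
  simp only [IsGood, hlam]
  refine ⟨fun y hy => h1 y ?_, fun y hy => hm0 y ?_, fun y y' hyy => h2 ?_, fun S hS hSd => ?_⟩
  · have := hm0 y
    field_simp at hy
    linear_combination hy
  · simpa using hy
  · simpa using hyy
  · simpa using h3 S hS hSd

end Existence

/-! ### Affine changes of variable in the components -/

section Affine

variable {N d : ℕ} {K : Type*} [Field K]

/-- Multipliers are invariant under affine conjugation, which multiplies the leading coefficient by
`α ^ (d - 1)`. -/
theorem rootMult_affine {a α β : K} {p q : Fin d → K} {e : Equiv.Perm (Fin d)}
    (h : ∀ j, p (e j) = α * q j + β) (j : Fin d) :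
    rootMult (a * α ^ (d - 1)) q j = rootMult a p (e j) := by
  have h1 : ∏ k ∈ Finset.univ.erase (e j), (p (e j) - p k) =
      ∏ k ∈ Finset.univ.erase j, (α * (q j - q k)) := by
    symm
    refine Finset.prod_equiv e (fun k => by simp) fun k _ => ?_
    rw [h, h]
    ring
  rw [rootMult, rootMult, h1, Finset.prod_mul_distrib, Finset.prod_const,
    Finset.card_erase_of_mem (Finset.mem_univ j), Finset.card_univ, Fintype.card_fin]
  ring

/-- The linear map inducing `x ↦ α x + β` on the coordinates, permuted by `σ`. -/
def affineEquiv (σ : Equiv.Perm (Fin N)) (α β : Fin N → K) (hα : ∀ i, α i ≠ 0) :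
    (Fin (N + 1) → K) ≃ₗ[K] (Fin (N + 1) → K) where
  toFun x := Fin.snoc (α := fun _ => K) (fun k => α (σ.symm k) * x (σ.symm k).castSucc +
    β (σ.symm k) * x (Fin.last N)) (x (Fin.last N))
  invFun y := Fin.snoc (α := fun _ => K) (fun i => (α i)⁻¹ * (y (σ i).castSucc -
    β i * y (Fin.last N))) (y (Fin.last N))
  map_add' x y := by
    ext v
    induction v using Fin.lastCases with
    | last => simp
    | cast i => simp; ring
  map_smul' c x := by
    ext v
    induction v using Fin.lastCases with
    | last => simp
    | cast i => simp; ring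
  left_inv x := by
    ext v
    induction v using Fin.lastCases with
    | last => simp
    | cast i => simp [hα i]
  right_inv y := by
    ext v
    induction v using Fin.lastCases with
    | last => simp
    | cast i => simp [hα]

theorem affineEquiv_last (σ : Equiv.Perm (Fin N)) {α β : Fin N → K} (hα : ∀ i, α i ≠ 0)
    (x : Fin (N + 1) → K) : affineEquiv σ α β hα x (Fin.last N) = x (Fin.last N) := by
  simp [affineEquiv]

theorem affineEquiv_castSucc (σ : Equiv.Perm (Fin N)) {α β : Fin N → K} (hα : ∀ i, α i ≠ 0)
    (x : Fin (N + 1) → K) (i : Fin N) : affineEquiv σ α β hα x (σ i).castSucc =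
      α i * x i.castSucc + β i * x (Fin.last N) := by
  simp [affineEquiv]

theorem ProjEnd.IsRooted.isConj_of_affine (hd : 2 ≤ d) {f g : ProjEnd K N d} {a b : Fin N → K}
    {ρ ρ' : Fin N → Fin d → K} (hf : f.IsRooted a ρ) (hg : g.IsRooted b ρ')
    (σ : Equiv.Perm (Fin N)) (e : Fin N → Equiv.Perm (Fin d)) {α β : Fin N → K}
    (hα : ∀ i, α i ≠ 0) (hρ : ∀ i j, ρ (σ i) (e i j) = α i * ρ' i j + β i)
    (hb : ∀ i, b i = a (σ i) * α i ^ (d - 1)) : ProjEnd.IsConj f g := by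
  refine ⟨affineEquiv σ α β hα, 1, fun x => ?_⟩
  rw [one_smul, LinearEquiv.eq_symm_apply]
  ext v
  induction v using Fin.lastCases with
  | last => rw [affineEquiv_last, hf.lift_last, hg.lift_last, affineEquiv_last]
  | cast k =>
    obtain ⟨i, rfl⟩ := σ.surjective k
    rw [affineEquiv_castSucc, hf.lift_castSucc hd, hg.lift_castSucc hd, hg.lift_last,
      affineEquiv_last, affineEquiv_castSucc, hb]
    have h1 : ∏ j, (α i * x i.castSucc + β i * x (Fin.last N) - ρ (σ i) j * x (Fin.last N)) =
        α i ^ d * ∏ j, (x i.castSucc - ρ' i j * x (Fin.last N)) := by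
      rw [← Equiv.prod_comp (e i)]
      have : α i ^ d = ∏ _j : Fin d, α i := by simp
      rw [this, ← Finset.prod_mul_distrib]
      refine Finset.prod_congr rfl fun j _ => ?_
      rw [hρ]
      ring
    have h2 : x (Fin.last N) ^ d = x (Fin.last N) ^ (d - 1) * x (Fin.last N) := by
      rw [← pow_succ, Nat.sub_add_cancel (by omega)]
    have h3 : α i ^ d = α i ^ (d - 1) * α i := by
      rw [← pow_succ, Nat.sub_add_cancel (by omega)]
    rw [h1, h2, h3]
    ring

end Affine

/-! ### Conjugations between split maps -/

section Conj

variable {N d : ℕ} {K : Type*} [Field K]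

theorem mul_eq_zero_of_pow_add_pow [CharZero K] (hd : 2 ≤ d) {u v c p q : K} (hc : c ≠ 0)
    (h : ∀ s r, u * s ^ d + v * r ^ d = c * (p * s + q * r) ^ d) : p * q = 0 := by
  by_contra hpq
  have h1 := h 1 0
  have h2 := h 0 1
  -- At `(q, p)` the two terms of the linear form both equal `p * q`, so comparison with `(1, 0)`
  -- and `(0, 1)` yields `2 ^ d = 2`.
  have h3 := h q p
  rw [zero_pow (by omega)] at h1 h2
  simp only [one_pow, mul_one, mul_zero, add_zero, zero_add] at h1 h2
  have h4 : c * (p * q) ^ d * ((2 : K) ^ d - 2) = 0 := by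
    have e1 : p * q + q * p = 2 * (p * q) := by ring
    rw [e1, mul_pow, h1, h2] at h3
    rw [mul_pow] at h3 ⊢
    linear_combination -h3
  have h5 := (mul_eq_zero.mp h4).resolve_left (mul_ne_zero hc (pow_ne_zero _ hpq))
  have h6 : (2 : ℕ) ^ d = 2 := by exact_mod_cast sub_eq_zero.mp h5
  have h7 : 2 ^ 2 ≤ 2 ^ d := Nat.pow_le_pow_right (by norm_num) hd
  omega

theorem apply_eq_sum (α : (Fin (N + 1) → K) ≃ₗ[K] (Fin (N + 1) → K)) (x : Fin (N + 1) → K)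
    (v : Fin (N + 1)) : α x v = ∑ k : Fin N, α (Pi.single k.castSucc 1) v * x k.castSucc +
      α (Pi.single (Fin.last N) 1) v * x (Fin.last N) := by
  rw [← Fin.sum_univ_castSucc (fun k => α (Pi.single k 1) v * x k)]
  conv_lhs => rw [pi_eq_sum_univ' x]
  rw [map_sum, Finset.sum_apply]
  refine Finset.sum_congr rfl fun k _ => ?_
  rw [map_smul, Pi.smul_apply, smul_eq_mul, mul_comm]

/-- A polynomial all of whose fixed points have nonzero multiplier is not affinely equivalent to a
power of the same affine map. -/
theorem not_affine_rootedPoly_eq_pow {b A B c : K} {ρ : Fin d → K} (hd : 2 ≤ d) (hA : A ≠ 0)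
    (hmult : ∀ j, rootMult b ρ j ≠ 0)
    (h : ∀ z, A * (rootedPoly b ρ).eval z + B = c * (A * z + B) ^ d) [Infinite K] (hb : b ≠ 0) :
    False := by
  have h1 : Polynomial.C A * rootedPoly b ρ + Polynomial.C B =
      Polynomial.C c * (Polynomial.C A * Polynomial.X + Polynomial.C B) ^ d := by
    refine Polynomial.funext fun z => ?_
    simpa using h z
  have h2 := h (-B / A)
  have e1 : A * (-B / A) + B = 0 := by field_simp; ring
  rw [e1, zero_pow (by omega), mul_zero, eval_rootedPoly] at h2
  have h3 : A * b * ∏ j, (-B / A - ρ j) = 0 := by linear_combination h2 - e1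
  obtain ⟨j, -, hj⟩ := Finset.prod_eq_zero_iff.mp
    ((mul_eq_zero.mp h3).resolve_left (mul_ne_zero hA hb))
  have h4 := congrArg (fun p => p.derivative.eval (ρ j)) h1
  simp only [Polynomial.derivative_add, Polynomial.derivative_C_mul, Polynomial.derivative_C,
    add_zero, Polynomial.derivative_pow, Polynomial.eval_mul, Polynomial.eval_C,
    eval_derivative_rootedPoly, Polynomial.eval_pow, Polynomial.eval_add, Polynomial.eval_X] at h4
  rw [← sub_eq_zero.mp hj, e1, zero_pow (by omega), mul_zero, zero_mul, mul_zero] at h4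
  exact hmult j ((mul_eq_zero.mp h4).resolve_left hA)

variable [CharZero K] {f g : ProjEnd K N d} {a b : Fin N → K} {ρ ρ' : Fin N → Fin d → K}

/-- The last coordinate of `f` is a pure power. If its pullback under `α` involved `x_j`, the `j`-th
component of `g` would be affinely equivalent to a power map and would have a fixed point of
multiplier zero. -/
theorem conj_last_coeff_eq_zero (hd : 2 ≤ d) (hf : f.IsRooted a ρ) (hg : g.IsRooted b ρ')
    (hb : ∀ i, b i ≠ 0) (hmult : ∀ i j, rootMult (b i) (ρ' i) j ≠ 0)
    {α : (Fin (N + 1) → K) ≃ₗ[K] (Fin (N + 1) → K)} {c : K}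
    (h : ∀ x, α (g.lift x) = c • f.lift (α x)) (j : Fin N) :
    α (Pi.single j.castSucc 1) (Fin.last N) = 0 := by
  by_contra hA
  have hd0 : 0 < d := by omega
  set A : Fin N → K := fun k => α (Pi.single k.castSucc 1) (Fin.last N) with hAdef
  set AN := α (Pi.single (Fin.last N) 1) (Fin.last N)
  refine not_affine_rootedPoly_eq_pow (B := ∑ k ∈ Finset.univ.erase j, A k * ρ' k ⟨0, hd0⟩ + AN) (c := c)
    hd hA (hmult j) (fun z => ?_) (hb j)
  -- The other coordinates sit at fixed points of their components, so `g` leaves their contribution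
  -- `B` to the last coordinate unchanged.
  let x : Fin (N + 1) → K := Fin.snoc (α := fun _ => K)
    (Function.update (fun k => ρ' k ⟨0, hd0⟩) j z) 1
  have hxN : x (Fin.last N) = 1 := Fin.snoc_last (α := fun _ => K) _ _
  have hxj : x j.castSucc = z := by simp [x]
  have hxk : ∀ k ∈ Finset.univ.erase j, x k.castSucc = ρ' k ⟨0, hd0⟩ := fun k hk => by
    simp [x, Finset.ne_of_mem_erase hk]
  have h1 := congrFun (h x) (Fin.last N)
  rw [Pi.smul_apply, smul_eq_mul, hf.lift_last, apply_eq_sum α x, apply_eq_sum α (g.lift x),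
    hg.lift_last, hxN, one_pow, mul_one, ← Finset.add_sum_erase _ _ (Finset.mem_univ j),
    ← Finset.add_sum_erase _ (fun k : Fin N => α (Pi.single k.castSucc 1) (Fin.last N) *
      x k.castSucc) (Finset.mem_univ j), hxj] at h1
  have h2 : g.lift x j.castSucc = (rootedPoly (b j) (ρ' j)).eval z := by
    rw [hg.lift_castSucc hd, eval_rootedPoly, hxN, hxj]
    simp
  have h3 : ∑ k ∈ Finset.univ.erase j, α (Pi.single k.castSucc 1) (Fin.last N) *
      g.lift x k.castSucc = ∑ k ∈ Finset.univ.erase j, A k * ρ' k ⟨0, hd0⟩ := by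
    refine Finset.sum_congr rfl fun k hk => ?_
    rw [hg.lift_castSucc hd, hxN, hxk k hk,
      Finset.prod_eq_zero (Finset.mem_univ ⟨0, hd0⟩) (by rw [mul_one, sub_self])]
    simp [A]
  have h4 : ∑ k ∈ Finset.univ.erase j, α (Pi.single k.castSucc 1) (Fin.last N) *
      x k.castSucc = ∑ k ∈ Finset.univ.erase j, A k * ρ' k ⟨0, hd0⟩ :=
    Finset.sum_congr rfl fun k hk => by rw [hxk k hk]
  rw [h2, h3, h4, add_assoc, add_assoc] at h1
  exact h1

/-- At infinity both maps are diagonal power maps. A row of `α` with two nonzero entries would write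
a sum of two `d`-th powers as the `d`-th power of a form involving both variables. -/
theorem conj_coeff_mul_eq_zero (hd : 2 ≤ d) (hf : f.IsRooted a ρ) (hg : g.IsRooted b ρ')
    (ha : ∀ i, a i ≠ 0) {α : (Fin (N + 1) → K) ≃ₗ[K] (Fin (N + 1) → K)} {c : K} (hc : c ≠ 0)
    (h : ∀ x, α (g.lift x) = c • f.lift (α x))
    (hlast : ∀ j : Fin N, α (Pi.single j.castSucc 1) (Fin.last N) = 0) (i : Fin N) {k l : Fin N}
    (hkl : k ≠ l) : α (Pi.single k.castSucc 1) i.castSucc *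
      α (Pi.single l.castSucc 1) i.castSucc = 0 := by
  refine mul_eq_zero_of_pow_add_pow hd (mul_ne_zero hc (ha i))
    (u := α (Pi.single k.castSucc 1) i.castSucc * b k)
    (v := α (Pi.single l.castSucc 1) i.castSucc * b l) fun s r => ?_
  let x : Fin (N + 1) → K := Pi.single k.castSucc s + Pi.single l.castSucc r
  have hxN : x (Fin.last N) = 0 := by simp [x, Fin.castSucc_ne_last]
  have hkl' : k.castSucc ≠ l.castSucc := fun hh => hkl (Fin.castSucc_injective N hh)
  have hxk : x k.castSucc = s := by simp [x, hkl']
  have hxl : x l.castSucc = r := by simp [x, hkl'.symm]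
  have hxo : ∀ m : Fin N, m ≠ k ∧ m ≠ l → x m.castSucc = 0 := fun m hm => by
    have h1 : m.castSucc ≠ k.castSucc := fun hh => hm.1 (Fin.castSucc_injective N hh)
    have h2 : m.castSucc ≠ l.castSucc := fun hh => hm.2 (Fin.castSucc_injective N hh)
    simp [x, h1, h2]
  have hgm : ∀ m : Fin N, g.lift x m.castSucc = b m * x m.castSucc ^ d := fun m => by
    rw [hg.lift_castSucc hd, hxN, zero_pow (by omega)]
    simp
  have hαN : α x (Fin.last N) = 0 := by
    rw [apply_eq_sum, hxN]
    simp [hlast]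
  have hαi : α x i.castSucc = α (Pi.single k.castSucc 1) i.castSucc * s +
      α (Pi.single l.castSucc 1) i.castSucc * r := by
    rw [apply_eq_sum, hxN, Fintype.sum_eq_add k l hkl fun m hm => by rw [hxo m hm, mul_zero],
      hxk, hxl]
    ring
  have h1 := congrFun (h x) i.castSucc
  rw [apply_eq_sum α (g.lift x), hg.lift_last, hxN, zero_pow (by omega),
    Fintype.sum_eq_add k l hkl fun m hm => by
      rw [hgm, hxo m hm, zero_pow (by omega), mul_zero, mul_zero], hgm, hgm, hxk, hxl,
    Pi.smul_apply, smul_eq_mul, hf.lift_castSucc hd, hαN, hαi, zero_pow (by omega)] at h1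
  simp only [mul_zero, add_zero, sub_zero, zero_add, Finset.prod_const, Finset.card_univ,
    Fintype.card_fin] at h1
  linear_combination h1

/-- A conjugation between split maps acts on each component by a one-variable affine
conjugation. -/
theorem exists_affine_of_isConj (hd : 2 ≤ d) (hf : f.IsRooted a ρ) (hg : g.IsRooted b ρ')
    (ha : ∀ i, a i ≠ 0) (hb : ∀ i, b i ≠ 0) (hmult : ∀ i j, rootMult (b i) (ρ' i) j ≠ 0)
    (h : ProjEnd.IsConj f g) (i : Fin N) : ∃ (k : Fin N) (A B : K), A ≠ 0 ∧ ∀ s,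
      A * (rootedPoly (b k) (ρ' k)).eval s + B = (rootedPoly (a i) (ρ i)).eval (A * s + B) := by
  obtain ⟨α, c, h⟩ := h
  have h' : ∀ x, α (g.lift x) = (c : K) • f.lift (α x) := fun x => by
    rw [h, Units.smul_def, map_smul, LinearEquiv.apply_symm_apply]
  have hlast := conj_last_coeff_eq_zero hd hf hg hb hmult h'
  have hmul := fun k l hkl => conj_coeff_mul_eq_zero hd hf hg ha c.ne_zero h' hlast i
    (k := k) (l := l) hkl
  set τ := α (Pi.single (Fin.last N) 1) (Fin.last N) with hτ
  have hαN : ∀ x, α x (Fin.last N) = τ * x (Fin.last N) := fun x => by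
    rw [apply_eq_sum]
    simp [hlast, hτ]
  have hτ0 : τ ≠ 0 := by
    intro h0
    have := hαN (α.symm (Pi.single (Fin.last N) 1))
    rw [LinearEquiv.apply_symm_apply, h0, zero_mul, Pi.single_eq_same] at this
    exact one_ne_zero this
  obtain ⟨k, hk⟩ : ∃ k : Fin N, α (Pi.single k.castSucc 1) i.castSucc ≠ 0 := by
    by_contra! hcon
    have h1 := apply_eq_sum α (α.symm (Pi.single i.castSucc 1)) i.castSucc
    have h2 := hαN (α.symm (Pi.single i.castSucc 1))
    rw [LinearEquiv.apply_symm_apply, Pi.single_eq_of_ne (Fin.castSucc_ne_last i).symm] at h2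
    rw [LinearEquiv.apply_symm_apply, Pi.single_eq_same,
      (mul_eq_zero.mp h2.symm).resolve_left hτ0] at h1
    simp [hcon] at h1
  set A := α (Pi.single k.castSucc 1) i.castSucc with hA
  set B := α (Pi.single (Fin.last N) 1) i.castSucc with hB
  have hαi : ∀ x, α x i.castSucc = A * x k.castSucc + B * x (Fin.last N) := fun x => by
    rw [apply_eq_sum, Fintype.sum_eq_single k fun l hl => by
      rw [(mul_eq_zero.mp (hmul k l hl.symm)).resolve_left hk, zero_mul]]
  refine ⟨k, A / τ, B / τ, div_ne_zero hk hτ0, fun s => ?_⟩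
  let x : Fin (N + 1) → K := Pi.single k.castSucc s + Pi.single (Fin.last N) 1
  have hxN : x (Fin.last N) = 1 := by simp [x, Fin.castSucc_ne_last]
  have hxk : x k.castSucc = s := by simp [x, Fin.castSucc_ne_last]
  have hg1 : g.lift x k.castSucc = (rootedPoly (b k) (ρ' k)).eval s := by
    rw [hg.lift_castSucc hd, eval_rootedPoly, hxN, hxk]
    simp
  have h1 := congrFun (h' x) i.castSucc
  have h2 := congrFun (h' x) (Fin.last N)
  rw [hαN, hg.lift_last, Pi.smul_apply, smul_eq_mul, hf.lift_last, hαN, hxN, one_pow] at h2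
  rw [hαi, hg.lift_last, hg1, Pi.smul_apply, smul_eq_mul, hf.lift_castSucc hd, hαN, hαi, hxN,
    hxk, one_pow] at h1
  simp only [mul_one] at h1 h2
  have h3 : ∏ j, (A * s + B - ρ i j * τ) = τ ^ d * ∏ j, (A / τ * s + B / τ - ρ i j) := by
    have : τ ^ d = ∏ _j : Fin d, τ := by simp
    rw [this, ← Finset.prod_mul_distrib]
    refine Finset.prod_congr rfl fun j _ => ?_
    field_simp
  have h4 : τ ^ d = τ ^ (d - 1) * τ := by
    rw [← pow_succ, Nat.sub_add_cancel (by omega)]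
  -- The last coordinate gives `τ = c * τ ^ d`; this removes the scalar `c` after dehomogenising by
  -- `τ`.
  have h5 : (c : K) * τ ^ (d - 1) = 1 := by
    refine mul_right_cancel₀ hτ0 ?_
    rw [mul_assoc, ← h4, ← h2, one_mul]
  rw [h3] at h1
  rw [eval_rootedPoly (a i)]
  have h6 : (A / τ) * (rootedPoly (b k) (ρ' k)).eval s + B / τ =
      (A * (rootedPoly (b k) (ρ' k)).eval s + B) / τ := by ring
  rw [h6, h1, div_eq_iff hτ0]
  have h7 : A / τ * s + B / τ = (A * s + B) / τ := by ring
  have h8 : (A * s + B) / τ * τ = A * s + B := div_mul_cancel₀ _ hτ0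
  rw [h7]
  linear_combination (A * s + B) * h5 - (a i * ∏ j, ((A * s + B) / τ - ρ i j)) * h2 - h8

/-- If two polynomials are affinely conjugate, the conjugation matches their fixed points together
with the multipliers. -/
theorem exists_rootMult_eq {a b A B : K} {p q : Fin d → K} (ha : a ≠ 0) (hA : A ≠ 0)
    (h : ∀ s, A * (rootedPoly b q).eval s + B = (rootedPoly a p).eval (A * s + B)) (j : Fin d) :
    ∃ j', p j' = A * q j + B ∧ rootMult a p j' = rootMult b q j := by
  have h1 := h (q j)
  rw [eval_rootedPoly, eval_rootedPoly, Finset.prod_eq_zero (Finset.mem_univ j) (sub_self _)] at h1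
  have h2 : a * ∏ k, (A * q j + B - p k) = 0 := by linear_combination -h1
  obtain ⟨j', -, hj'⟩ := Finset.prod_eq_zero_iff.mp ((mul_eq_zero.mp h2).resolve_left ha)
  refine ⟨j', (sub_eq_zero.mp hj').symm, ?_⟩
  have h3 : Polynomial.C A * rootedPoly b q + Polynomial.C B =
      (rootedPoly a p).comp (Polynomial.C A * Polynomial.X + Polynomial.C B) := by
    refine Polynomial.funext fun z => ?_
    simpa using h z
  have h4 := congrArg (fun p => p.derivative.eval (q j)) h3
  simp only [Polynomial.derivative_add, Polynomial.derivative_C_mul, Polynomial.derivative_C,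
    add_zero, Polynomial.derivative_comp, Polynomial.eval_mul, Polynomial.eval_C,
    eval_derivative_rootedPoly, Polynomial.derivative_X, mul_one,
    Polynomial.eval_comp, Polynomial.eval_add, Polynomial.eval_X] at h4
  rw [sub_eq_zero.mp hj', eval_derivative_rootedPoly] at h4
  exact (mul_left_cancel₀ hA h4).symm

/-- The affine conjugation preserves multipliers, and these are distinct across all rows and labels.
Hence it pairs component `i` with component `i` and each fixed point with the one of the same label.
-/
theorem exists_affine_of_isConj_of_rootMult_eq (hd : 2 ≤ d) (hf : f.IsRooted a ρ)
    (hg : g.IsRooted b ρ') (ha : ∀ i, a i ≠ 0) (hb : ∀ i, b i ≠ 0) {lam : Fin N → Fin d → K}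
    (hinj : Function.Injective fun x : Fin N × Fin d => lam x.1 x.2) (h0 : ∀ i j, lam i j ≠ 0)
    (hlf : ∀ i j, rootMult (a i) (ρ i) j = lam i j) (hlg : ∀ i j, rootMult (b i) (ρ' i) j = lam i j)
    (h : ProjEnd.IsConj f g) (i : Fin N) : ∃ A B : K, ∀ j, ρ i j = A * ρ' i j + B := by
  obtain ⟨k, A, B, hA, hAB⟩ := exists_affine_of_isConj hd hf hg ha hb
    (fun i j => by rw [hlg]; exact h0 i j) h i
  have key : ∀ j, i = k ∧ ρ i j = A * ρ' k j + B := by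
    intro j
    obtain ⟨j', hj', hm⟩ := exists_rootMult_eq (ha i) hA hAB j
    rw [hlf, hlg] at hm
    have := Prod.ext_iff.mp (@hinj (i, j') (k, j) hm)
    simp only at this
    rw [this.2] at hj'
    exact ⟨this.1, hj'⟩
  refine ⟨A, B, fun j => ?_⟩
  obtain ⟨rfl, hj⟩ := key j
  exact hj

end Conj

/-! ### Counting a generic fibre -/

section Fibre

variable {N n : ℕ} {K : Type*} [Field K]

theorem normPoints_last (x : Fin n → K) : normPoints x (Fin.last (n + 1)) = 0 := by
  simp [normPoints]

theorem normPoints_castSucc_last (x : Fin n → K) : normPoints x (Fin.last n).castSucc = 1 := by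
  simp [normPoints]

theorem injective_normPoints : Function.Injective (normPoints : (Fin n → K) → _) := by
  intro x y h
  ext i
  simpa [normPoints] using congrFun h i.castSucc.castSucc

theorem eq_normPoints {p : Fin (n + 2) → K} (h0 : p (Fin.last (n + 1)) = 0)
    (h1 : p (Fin.last n).castSucc = 1) :
    p = normPoints fun i => p i.castSucc.castSucc := by
  ext j
  induction j using Fin.lastCases with
  | last => rw [h0, normPoints_last]
  | cast j =>
    induction j using Fin.lastCases with
    | last => rw [h1, normPoints_castSucc_last]
    | cast j => simp [normPoints]

theorem normPoints_eq_of_affine {x y : Fin n → K} {A B : K}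
    (h : ∀ j, normPoints x j = A * normPoints y j + B) : x = y := by
  have h0 := h (Fin.last (n + 1))
  have h1 := h (Fin.last n).castSucc
  rw [normPoints_last, normPoints_last, mul_zero, zero_add] at h0
  rw [normPoints_castSucc_last, normPoints_castSucc_last, ← h0, mul_one, add_zero] at h1
  refine injective_normPoints (funext fun j => ?_)
  rw [h, ← h0, ← h1, one_mul, add_zero]

theorem eq_of_rootMult_eq {d : ℕ} {a b : K} {p : Fin d → K} {j : Fin d}
    (h : rootMult a p j = rootMult b p j) (h1 : rootMult b p j ≠ 1) : a = b := by
  rw [rootMult, rootMult, add_right_inj] at h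
  refine mul_right_cancel₀ (fun h0 => h1 ?_) h
  rw [rootMult, h0, mul_zero, add_zero]

theorem injective_of_rootMult_ne_one {d : ℕ} {a : K} {p : Fin d → K}
    (h : ∀ j, rootMult a p j ≠ 1) : Function.Injective p := by
  intro i j hij
  by_contra hne
  refine h i ?_
  rw [rootMult, Finset.prod_eq_zero (Finset.mem_erase.mpr ⟨Ne.symm hne, Finset.mem_univ j⟩)
    (sub_eq_zero.mpr hij), mul_zero, add_zero]

theorem inv_mul_prod_eq_one {d : ℕ} {a : K} {p : Fin d → K} {j : Fin d}
    (h : rootMult a p j ≠ 1) : (rootMult a p j - 1)⁻¹ *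
      (a * ∏ k ∈ Finset.univ.erase j, (p j - p k)) = 1 := by
  have : a * ∏ k ∈ Finset.univ.erase j, (p j - p k) = rootMult a p j - 1 := by
    rw [rootMult, add_sub_cancel_left]
  rw [this, inv_mul_cancel₀ (sub_ne_zero.mpr h)]

variable [CharZero K] [IsAlgClosed K]

/-- The classes in the fibre correspond bijectively to families of normalised solutions, one for
each row of `lam`. -/
theorem ncard_splitFibre {lam : Fin N → Fin (n + 2) → K}
    (hgood : IsGood (n + 2) fun x : Fin N × Fin (n + 2) => lam x.1 x.2) {a₀ : Fin N → K}
    {ρ₀ : Fin N → Fin (n + 2) → K} (hlam : ∀ i j, rootMult (a₀ i) (ρ₀ i) j = lam i j) :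
    (splitFibre (tauOf K lam)).ncard = n.factorial ^ N := by
  have hd : 2 ≤ n + 2 := by omega
  obtain ⟨hg0, hg1, hginj, hgS⟩ := hgood
  have hl0 : ∀ i j, lam i j ≠ 0 := fun i j => hg0 (i, j)
  have hl1 : ∀ i j, lam i j ≠ 1 := fun i j => hg1 (i, j)
  let m : Fin N → Fin (n + 2) → K := fun i j => (lam i j - 1)⁻¹
  have hm : ∀ i, ∀ S : Finset (Fin (n + 2)), S.Nonempty → S.card < n + 2 → ∑ j ∈ S, m i j ≠ 0 :=
    row_sum_ne_zero (m := fun x => (lam x.1 x.2 - 1)⁻¹) hgS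
  -- The identity with exponent `0`, which holds because `lam` comes from actual polynomials.
  have hm0 : ∀ i, ∑ j, m i j = 0 := by
    intro i
    have := sum_mul_pow_eq_zero_of_mul_prod_eq (p := ρ₀ i) (m := m i) (a := a₀ i) (fun j => by
      have := inv_mul_prod_eq_one (a := a₀ i) (p := ρ₀ i) (j := j) (by rw [hlam]; exact hl1 i j)
      rwa [hlam] at this) (Nat.zero_le n)
    simpa using this
  have hex : ∀ x : (∀ i, normSol (m i)), ∃ (f : ProjEnd K N (n + 2)) (a : Fin N → K),
      (∀ i, a i ≠ 0) ∧ f.IsRooted a (fun i => normPoints (x i).1) ∧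
        ∀ i j, rootMult (a i) (normPoints (x i).1) j = lam i j := by
    intro x
    choose a ha hax using fun i => exists_of_mem_normSol (hm i) (hm0 i) (x i).2
    obtain ⟨f, hf⟩ := exists_isRooted hd ha (fun i => normPoints (x i).1)
    refine ⟨f, a, ha, hf, fun i j => ?_⟩
    rw [rootMult, eq_inv_of_mul_eq_one_right (hax i j), inv_inv, add_sub_cancel]
  choose F a ha hF hFlam using hex
  have hrange : splitFibre (tauOf K lam) = Set.range fun x => (F x).toModuli := by
    ext c
    constructor
    · rintro ⟨g, hg, rfl, hgτ⟩
      obtain ⟨b, ρ, hb, hgr⟩ := hg.exists_isRooted hd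
      rw [hgr.tau_eq hd hb] at hgτ
      obtain ⟨σ, e, he, hσ⟩ := exists_perm_of_affSigma_eq (by omega) hginj
        (affSigma_eq_of_tauOf_eq hgτ.symm)
      let e' : Fin N → Equiv.Perm (Fin (n + 2)) := fun i =>
        Equiv.ofBijective (e i) (Finite.injective_iff_bijective.mp (he i))
      have hσ' : ∀ i j, rootMult (b (σ i)) (ρ (σ i)) (e' i j) = lam i j := hσ
      have hρinj : ∀ i, Function.Injective (ρ (σ i)) := fun i =>
        injective_of_rootMult_ne_one (a := b (σ i)) fun j => by
          obtain ⟨j, rfl⟩ := (e' i).surjective j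
          rw [hσ']
          exact hl1 i j
      -- `z ↦ α z + β` sends `0` and `1` to the fixed points with the last two labels, so its
      -- inverse puts the fixed points of each component in normal form.
      let β : Fin N → K := fun i => ρ (σ i) (e' i (Fin.last (n + 1)))
      let α : Fin N → K := fun i => ρ (σ i) (e' i (Fin.last n).castSucc) - β i
      have hα : ∀ i, α i ≠ 0 := fun i => sub_ne_zero.mpr
        ((hρinj i).ne ((e' i).injective.ne (Fin.castSucc_ne_last _)))
      let p : Fin N → Fin (n + 2) → K := fun i j => (ρ (σ i) (e' i j) - β i) / α i
      have hp : ∀ i, p i = normPoints fun j => p i j.castSucc.castSucc := fun i =>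
        eq_normPoints (by simp [p, β]) (div_self (hα i))
      have hpρ : ∀ i j, ρ (σ i) (e' i j) = α i * p i j + β i := fun i j => by
        have := hα i
        simp only [p]
        field_simp
        ring
      have hmul : ∀ i j, rootMult (b (σ i) * α i ^ (n + 2 - 1)) (p i) j = lam i j := fun i j => by
        rw [rootMult_affine (hpρ i), hσ']
      have hx : ∀ i, (fun j => p i j.castSucc.castSucc) ∈ normSol (m i) := by
        intro i
        refine mem_normSol_of_mul_prod_eq (a := b (σ i) * α i ^ (n + 2 - 1)) fun j => ?_
        rw [← hp]
        have := inv_mul_prod_eq_one (a := b (σ i) * α i ^ (n + 2 - 1)) (p := p i) (j := j)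
          (by rw [hmul]; exact hl1 i j)
        rwa [hmul] at this
      refine ⟨fun i => ⟨_, hx i⟩, ?_⟩
      refine (Quotient.sound (s := ProjEnd.conjSetoid K N (n + 2)) ?_).symm
      refine hgr.isConj_of_affine hd (hF _) σ e' (β := β) hα (fun i j => ?_) fun i => ?_
      · rw [hpρ, congrFun (hp i) j]
      -- Once the fixed points are known, a single multiplier different from `1` determines the
      -- leading coefficient.
      · have h1 := hFlam (fun i => ⟨_, hx i⟩) i (Fin.last (n + 1))
        have h2 := hmul i (Fin.last (n + 1))
        rw [hp] at h2
        exact eq_of_rootMult_eq (h1.trans h2.symm) (by rw [h2]; exact hl1 i _)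
    · rintro ⟨x, rfl⟩
      refine ⟨F x, (hF x).isSplit, rfl, ?_⟩
      rw [(hF x).tau_eq hd (ha x)]
      congr 1
      ext i j
      exact hFlam x i j
  have hinj : Function.Injective fun x => (F x).toModuli := by
    intro x y hxy
    have hc : ProjEnd.IsConj (F x) (F y) :=
      Quotient.exact (s := ProjEnd.conjSetoid K N (n + 2)) hxy
    ext1 i
    obtain ⟨A, B, hAB⟩ := exists_affine_of_isConj_of_rootMult_eq hd (hF x) (hF y) (ha x) (ha y)
      hginj hl0 (hFlam x) (hFlam y) hc i
    exact Subtype.ext (normPoints_eq_of_affine hAB)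
  rw [hrange, ← Nat.card_coe_set_eq, Nat.card_range_of_injective hinj, Nat.card_pi]
  simp only [natCard_normSol (hm _), Finset.prod_const, Finset.card_univ, Fintype.card_fin]

end Fibre

end ProjDyn

end

theorem mainTheorem6 {K : Type*} [Field K] [IsAlgClosed K] [CharZero K] (N d : ℕ)
    (hN : 1 ≤ N) (hd : 2 ≤ d) :
    ∃ I : Ideal (MvPolynomial (ProjDyn.SigmaIndex N d) K),
      -- the Zariski-open set `(zeroLocus I)ᶜ` meets the image in a Zariski-dense subset of it
      vanishingIdeal K (ProjDyn.splitImage K N d \ zeroLocus K I) =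
        vanishingIdeal K (ProjDyn.splitImage K N d) ∧
      -- and over each of the points of this subset the fibre has exactly `((d - 2)!) ^ N` points
      ∀ y ∈ ProjDyn.splitImage K N d \ zeroLocus K I,
        (ProjDyn.splitFibre y).ncard = (d - 2).factorial ^ N := by
  obtain ⟨n, rfl⟩ := Nat.exists_eq_add_of_le' hd
  obtain ⟨G, hG⟩ := ProjDyn.exists_eval_ne_zero_iff_isGood (K := K) (N := N) (d := n + 2) (by omega)
  refine ⟨Ideal.span {G}, ?_, ?_⟩
  · obtain ⟨a, ρ, ha, hgood⟩ := ProjDyn.exists_isGood (K := K) (N := N) (n := n)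
    exact ProjDyn.vanishingIdeal_splitImage_diff hd ha ((hG _).mpr hgood)
  · rintro _ ⟨⟨g, hg, rfl⟩, hy⟩
    obtain ⟨a, ρ, ha, hgr⟩ := hg.exists_isRooted hd
    rw [hgr.tau_eq hd ha] at hy ⊢
    refine ProjDyn.ncard_splitFibre ((hG fun i j => ProjDyn.rootMult (a i) (ρ i) j).mp
      fun h0 => hy ?_) (a₀ := a) (ρ₀ := ρ) fun i j => rfl
    rw [zeroLocus_span]
    simpa using h0
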